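/- Let $p$ be a prime and let $H^*(BG)$ denote the mod $p$ cohomology ring of (the classifying space of) a finite group $G$. Let $P$ be a finite $p$-group, let $C=C(P)\le P$ be its maximal central elementary abelian $p$-subgroup, let $c=c(P)$ be the rank of $C$, and let $i^*\colon H^*(BP)\to H^*(BC)$ be the restriction map. Let $e(P)$ denote the top degree of a generator of $H^*(BC)$ as an $H^*(BP)$-module via $i^*$, i.e. the largest degree in which the indecomposables $H^*(BC)\otimes_{H^*(BP)}\mathbb F_p$ are nonzero. Let $A\le P$ be an abelian subgroup of maximal order. Then, for every basis $x_1,\dots,x_c$ of $H^1(BC)$, with Bocksteins $y_i=\beta(x_i)\in H^2(BC)$, the image of $i^*$ contains the subalgebra $\mathbb F_p[y_1^{|P|/|A|},\dots,y_c^{|P|/|A|}]$ of $H^*(BC)$ generated by the elements $y_i^{|P|/|A|}$. Moreover, $e(P)$ is finite and $$e(P)\le c(P)\left(\frac{2|P|}{|A|}-1\right).$$ -/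

import Mathlib

noncomputable section

namespace ModPCohomology

open CategoryTheory

/-! ### Inhomogeneous cochains with trivial coefficients -/

/-- The coboundary `Cⁿ(G, k) → Cⁿ⁺¹(G, k)` of Mathlib's complex of inhomogeneous cochains, for the
trivial coefficient module `k`. -/
abbrev coboundary (k G : Type) [CommRing k] [Group G] (n : ℕ) :
    ((Fin n → G) → k) →ₗ[k] ((Fin (n + 1) → G) → k) :=
  (inhomogeneousCochains.d (Rep.trivial k G k) n).hom

/-- The cochain cup product `(f ∪ g)(v₁, …, vₘ₊ₙ) = f(v₁, …, vₘ) g(vₘ₊₁, …, vₘ₊ₙ)`. -/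
def cochainCup {k G : Type} [CommRing k] {m n : ℕ}
    (f : (Fin m → G) → k) (g : (Fin n → G) → k) : (Fin (m + n) → G) → k :=
  fun v => f (fun i => v (Fin.castAdd n i)) * g (fun j => v (Fin.natAdd m j))


section Auxiliary

variable {k G : Type} [CommRing k]

/-- A cochain evaluated on the first entries of an infinite sequence. -/
def onSeq {n : ℕ} (f : (Fin n → G) → k) (v : ℕ → G) : k := f fun i => v i

lemma onSeq_injective [Group G] {n : ℕ} {f g : (Fin n → G) → k} (h : onSeq f = onSeq g) :
    f = g := by
  funext v
  have := congrFun h (fun i => if hi : i < n then v ⟨i, hi⟩ else 1)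
  simpa [onSeq] using this

/-- Multiply the entries `j` and `j + 1` of a sequence. -/
def contractSeq [Group G] (j : ℕ) (v : ℕ → G) : ℕ → G := fun i =>
  if i < j then v i else if i = j then v i * v (i + 1) else v (i + 1)

lemma onSeq_coboundary [Group G] {n : ℕ} (f : (Fin n → G) → k) (v : ℕ → G) :
    onSeq (coboundary k G n f) v = onSeq f (fun i => v (i + 1)) +
      ∑ j ∈ Finset.range (n + 1), (-1 : k) ^ (j + 1) * onSeq f (contractSeq j v) := by
  rw [Finset.sum_range]
  simp only [onSeq, coboundary]
  rw [inhomogeneousCochains.d_hom_apply]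
  simp only [Representation.trivial, smul_eq_mul]
  congr 1

lemma onSeq_cup {m n : ℕ} (f : (Fin m → G) → k) (g : (Fin n → G) → k) (v : ℕ → G) :
    onSeq (cochainCup f g) v = onSeq f v * onSeq g (fun i => v (m + i)) := rfl

lemma onSeq_congr {n : ℕ} (f : (Fin n → G) → k) {v w : ℕ → G} (h : ∀ i < n, v i = w i) :
    onSeq f v = onSeq f w := by
  unfold onSeq; congr 1; funext i; exact h i i.2

lemma onSeq_coboundary_cup [Group G] {m n : ℕ} (f : (Fin m → G) → k) (g : (Fin n → G) → k)
    (v : ℕ → G) :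
    onSeq (coboundary k G (m + n) (cochainCup f g)) v =
      onSeq (coboundary k G m f) v * onSeq g (fun i => v (m + 1 + i)) +
      (-1) ^ m * (onSeq f v * onSeq (coboundary k G n g) (fun i => v (m + i))) := by
  rw [onSeq_coboundary, onSeq_coboundary, onSeq_coboundary, add_assoc m n 1,
    Finset.sum_range_add, Finset.sum_range_succ (n := m)]
  simp only [onSeq_cup]
  have h1 : ∀ j ∈ Finset.range m,
      (-1 : k) ^ (j + 1) * (onSeq f (contractSeq j v) *
        onSeq g (fun i => contractSeq j v (m + i))) =
      (-1 : k) ^ (j + 1) * onSeq f (contractSeq j v) * onSeq g (fun i => v (m + 1 + i)) := by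
    intro j hj
    rw [mul_assoc]
    congr 2
    apply onSeq_congr
    intro i _
    have := Finset.mem_range.1 hj
    simp only [contractSeq]
    rw [if_neg (by omega), if_neg (by omega)]
    congr 1; omega
  have h2 : ∀ j, onSeq f (contractSeq (m + j) v) = onSeq f v := by
    intro j
    apply onSeq_congr
    intro i hi
    simp only [contractSeq]
    rw [if_pos (by omega)]
  have h3 : ∀ j, (fun i => contractSeq (m + j) v (m + i)) =
      contractSeq j (fun i => v (m + i)) := by
    intro j
    funext i
    simp only [contractSeq, add_lt_add_iff_left, add_right_inj, add_assoc]
  have h4 : (fun i => v (m + i + 1)) = fun i => v (m + 1 + i) := by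
    funext i; congr 1; omega
  have h5 : onSeq f (contractSeq m v) = onSeq f v := h2 0
  have h6 : (fun i => v (m + (i + 1))) = fun i => v (m + 1 + i) := by
    funext i; congr 1; omega
  rw [Finset.sum_congr rfl h1, ← Finset.sum_mul]
  simp only [h2, h3, h4, h5, h6]
  have h7 : ∀ S : ℕ → k, ∑ x ∈ Finset.range (n + 1), (-1 : k) ^ (m + x + 1) * (onSeq f v * S x) =
      (-1) ^ m * (onSeq f v * ∑ x ∈ Finset.range (n + 1), (-1 : k) ^ (x + 1) * S x) := by
    intro S
    rw [Finset.mul_sum, Finset.mul_sum]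
    refine Finset.sum_congr rfl fun x _ => ?_
    ring
  rw [h7]
  ring

lemma coboundary_coboundary [Group G] {n : ℕ} (f : (Fin n → G) → k) :
    coboundary k G (n + 1) (coboundary k G n f) = 0 := by
  have := groupCohomology.inhomogeneousCochains.d_comp_d n (Rep.trivial k G k)
  exact congrArg (fun φ => φ.hom f) this

end Auxiliary

/-! ### Mod `p` cohomology groups and cohomology classes of cocycles -/

/-- `Hⁿ(BG)`: the mod `p` cohomology of the group `G` in degree `n`. -/
abbrev H (p : ℕ) (G : Type) [Group G] (n : ℕ) : Type :=
  groupCohomology (Rep.trivial (ZMod p) G (ZMod p)) n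

section Classes

variable (p : ℕ) (G : Type) [Group G]

/-- The inhomogeneous mod `p` cocycles. -/
abbrev Cocycle (n : ℕ) : Submodule (ZMod p) ((Fin n → G) → ZMod p) :=
  LinearMap.ker (coboundary (ZMod p) G n)

/-- The cohomology class of a cocycle. -/
def cls (n : ℕ) : Cocycle p G n →ₗ[ZMod p] H p G n where
  toFun f := groupCohomology.π (Rep.trivial (ZMod p) G (ZMod p)) n
    (groupCohomology.cocyclesMk f.1 f.2)
  map_add' f g := by
    rw [← map_add]
    congr 1
    apply (ModuleCat.mono_iff_injective
      (groupCohomology.iCocycles (Rep.trivial (ZMod p) G (ZMod p)) n)).1 inferInstance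
    rw [map_add]
    erw [groupCohomology.iCocycles_mk, groupCohomology.iCocycles_mk, groupCohomology.iCocycles_mk]
    rfl
  map_smul' r f := by
    rw [RingHom.id_apply, ← map_smul]
    congr 1
    apply (ModuleCat.mono_iff_injective
      (groupCohomology.iCocycles (Rep.trivial (ZMod p) G (ZMod p)) n)).1 inferInstance
    rw [map_smul]
    erw [groupCohomology.iCocycles_mk, groupCohomology.iCocycles_mk]
    rfl

variable {p G}


lemma cls_surjective (n : ℕ) : Function.Surjective (cls p G n) := by
  intro x
  induction x using groupCohomology_induction_on with
  | h y =>
    have hy : coboundary (ZMod p) G n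
        (groupCohomology.iCocycles (Rep.trivial (ZMod p) G (ZMod p)) n y) = 0 := by
      have h := (groupCohomology.inhomogeneousCochains
        (Rep.trivial (ZMod p) G (ZMod p))).iCycles_d n (n + 1)
      rw [groupCohomology.inhomogeneousCochains.d_def] at h
      exact congrArg (fun φ => φ.hom y) h
    refine ⟨⟨_, hy⟩, ?_⟩
    change groupCohomology.π _ n _ = groupCohomology.π _ n _
    congr 1
    apply (ModuleCat.mono_iff_injective
      (groupCohomology.iCocycles (Rep.trivial (ZMod p) G (ZMod p)) n)).1 inferInstance
    erw [groupCohomology.iCocycles_mk]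

/-- A cochain is a coboundary (in degree `0`: it vanishes). -/
def IsCoboundary {n : ℕ} (f : (Fin n → G) → ZMod p) : Prop :=
  f = 0 ∨ ∃ (m : ℕ) (g : (Fin m → G) → ZMod p), m + 1 = n ∧ onSeq f = onSeq (coboundary (ZMod p) G m g)

lemma cls_eq_zero_iff {n : ℕ} (f : Cocycle p G n) : cls p G n f = 0 ↔ IsCoboundary f.1 := by
  set K := groupCohomology.inhomogeneousCochains (Rep.trivial (ZMod p) G (ZMod p)) with hK
  have key : ∀ i, (ComplexShape.up ℕ).prev n = i →
      (cls p G n f = 0 ↔ ∃ g : K.X i, K.d i n g = f.1) := by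
    intro i hi
    have hex : (ShortComplex.mk (K.toCycles i n) (K.homologyπ n) (by simp)).Exact :=
      ShortComplex.exact_of_g_is_cokernel _ (K.homologyIsCokernel i n hi)
    rw [ShortComplex.moduleCat_exact_iff] at hex
    have hi' : groupCohomology.iCocycles (Rep.trivial (ZMod p) G (ZMod p)) n
        (groupCohomology.cocyclesMk f.1 f.2) = f.1 := by
      exact groupCohomology.iCocycles_mk (A := Rep.trivial (ZMod p) G (ZMod p)) f.1 f.2
    constructor
    · intro h
      obtain ⟨g, hg⟩ := hex _ h
      refine ⟨g, ?_⟩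
      rw [← K.toCycles_i i n, ← hi']
      exact congrArg (K.iCycles n) hg
    · rintro ⟨g, hg⟩
      have : K.toCycles i n g = groupCohomology.cocyclesMk
          (A := Rep.trivial (ZMod p) G (ZMod p)) f.1 f.2 := by
        apply (ModuleCat.mono_iff_injective (K.iCycles n)).1 inferInstance
        refine Eq.trans ?_ hi'.symm
        rw [← hg, ← K.toCycles_i i n]
        rfl
      change K.homologyπ n (groupCohomology.cocyclesMk
        (A := Rep.trivial (ZMod p) G (ZMod p)) f.1 f.2) = 0
      rw [← this]
      have h0 : K.toCycles i n ≫ K.homologyπ n = 0 := by simp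
      exact congrArg (fun φ => φ.hom g) h0
  cases n with
  | zero =>
    rw [key 0 (by simp)]
    constructor
    · rintro ⟨g, hg⟩
      rw [K.shape 0 0 (by simp)] at hg
      exact Or.inl hg.symm
    · rintro (h | ⟨m, g, h, -⟩)
      · exact ⟨0, by rw [map_zero]; exact h.symm⟩
      · omega
  | succ m =>
    rw [key m (by simp)]
    have hd : K.d m (m + 1) = inhomogeneousCochains.d (Rep.trivial (ZMod p) G (ZMod p)) m :=
      groupCohomology.inhomogeneousCochains.d_def _ m
    rw [hd]
    constructor
    · rintro ⟨g, hg⟩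
      exact Or.inr ⟨m, g, rfl, congrArg onSeq hg.symm⟩
    · rintro (h | ⟨m', g, h, hg⟩)
      · exact ⟨0, by rw [map_zero]; exact h.symm⟩
      · obtain rfl : m' = m := by omega
        exact ⟨g, (onSeq_injective hg).symm⟩

/-- Two cocycles (of equal degree) given by the same formula have the same class. -/
lemma mk_cls_congr {m n : ℕ} (h : m = n) (f : Cocycle p G m) (g : Cocycle p G n)
    (hfg : onSeq f.1 = onSeq g.1) :
    GradedMonoid.mk (A := H p G) m (cls p G m f) = GradedMonoid.mk n (cls p G n g) := by
  subst h
  rw [Subtype.ext (onSeq_injective hfg)]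

end Classes

/-- Descend a linear map along a surjective linear map. -/
def descend {R M N L : Type} [Ring R] [AddCommGroup M] [AddCommGroup N] [AddCommGroup L]
    [Module R M] [Module R N] [Module R L] (q : M →ₗ[R] N) (hq : Function.Surjective q)
    (f : M →ₗ[R] L) (h : LinearMap.ker q ≤ LinearMap.ker f) : N →ₗ[R] L :=
  (LinearMap.ker q).liftQ f h ∘ₗ (q.quotKerEquivOfSurjective hq).symm.toLinearMap

lemma descend_apply {R M N L : Type} [Ring R] [AddCommGroup M] [AddCommGroup N] [AddCommGroup L]
    [Module R M] [Module R N] [Module R L] (q : M →ₗ[R] N) (hq : Function.Surjective q)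
    (f : M →ₗ[R] L) (h : LinearMap.ker q ≤ LinearMap.ker f) (x : M) :
    descend q hq f h (q x) = f x := by
  have : (q.quotKerEquivOfSurjective hq).symm (q x) = Submodule.Quotient.mk x := by
    rw [LinearEquiv.symm_apply_eq]; rfl
  simp [descend, this]

/-! ### The cup product -/

section Cup

variable {p : ℕ} {G : Type} [Group G]

/-- The cup product of two cocycles. -/
def cocycleCup {m n : ℕ} (f : Cocycle p G m) (g : Cocycle p G n) : Cocycle p G (m + n) :=
  ⟨cochainCup f.1 g.1, by
    apply onSeq_injective
    funext v
    rw [onSeq_coboundary_cup, LinearMap.mem_ker.1 f.2, LinearMap.mem_ker.1 g.2]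
    simp [onSeq]⟩

/-- The cup product of cocycles, with values in cohomology, as a bilinear map. -/
def cocycleCupClass (m n : ℕ) :
    Cocycle p G m →ₗ[ZMod p] Cocycle p G n →ₗ[ZMod p] H p G (m + n) :=
  LinearMap.mk₂ (ZMod p) (fun f g => cls p G (m + n) (cocycleCup f g))
    (fun f f' g => by
      rw [← map_add]; congr 1; ext v; simp [cocycleCup, cochainCup, add_mul])
    (fun r f g => by
      rw [← map_smul]; congr 1; ext v; simp [cocycleCup, cochainCup, mul_assoc])
    (fun f g g' => by
      rw [← map_add]; congr 1; ext v; simp [cocycleCup, cochainCup, mul_add])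
    (fun r f g => by
      rw [← map_smul]; congr 1; ext v; simp [cocycleCup, cochainCup, mul_left_comm])

lemma cocycleCup_isCoboundary_right {m n : ℕ} (f : Cocycle p G m) (g : Cocycle p G n)
    (hg : IsCoboundary g.1) : IsCoboundary (cocycleCup f g).1 := by
  rcases hg with h0 | ⟨m', h, hm, hh⟩
  · left
    funext v
    simp [cocycleCup, cochainCup, h0]
  · right
    refine ⟨m + m', (-1 : ZMod p) ^ m • cochainCup f.1 h, by omega, ?_⟩
    funext v
    rw [map_smul]
    change _ = (-1 : ZMod p) ^ m * onSeq _ v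
    rw [onSeq_coboundary_cup, LinearMap.mem_ker.1 f.2]
    change onSeq (cochainCup f.1 g.1) v = _
    have h1 : ((-1 : ZMod p) ^ m) * (-1) ^ m = 1 := by rw [← mul_pow]; simp
    have h2 : onSeq (0 : (Fin (m + 1) → G) → ZMod p) v = 0 := rfl
    rw [onSeq_cup, hh, h2, zero_mul, zero_add, ← mul_assoc, h1, one_mul]

lemma cocycleCup_isCoboundary_left {m n : ℕ} (f : Cocycle p G m) (g : Cocycle p G n)
    (hf : IsCoboundary f.1) : IsCoboundary (cocycleCup f g).1 := by
  rcases hf with h0 | ⟨m', h, hm, hh⟩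
  · left
    funext v
    simp [cocycleCup, cochainCup, h0]
  · right
    refine ⟨m' + n, cochainCup h g.1, by omega, ?_⟩
    funext v
    rw [onSeq_coboundary_cup, LinearMap.mem_ker.1 g.2]
    change onSeq (cochainCup f.1 g.1) v = _
    rw [onSeq_cup, hh, ← hm]
    simp [onSeq]

/-- The cup product `Hᵐ(BG) × Hⁿ(BG) → Hᵐ⁺ⁿ(BG)`. -/
def cup (m n : ℕ) : H p G m →ₗ[ZMod p] H p G n →ₗ[ZMod p] H p G (m + n) :=
  descend (cls p G m) (cls_surjective m)
    { toFun := fun f => descend (cls p G n) (cls_surjective n) (cocycleCupClass m n f)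
        (fun g hg => LinearMap.mem_ker.2 <| (cls_eq_zero_iff _).2 <|
          cocycleCup_isCoboundary_right f g ((cls_eq_zero_iff _).1 hg))
      map_add' := fun f f' => by
        ext x
        obtain ⟨g, rfl⟩ := cls_surjective n x
        simp [descend_apply]
      map_smul' := fun r f => by
        ext x
        obtain ⟨g, rfl⟩ := cls_surjective n x
        simp [descend_apply] }
    (fun f hf => by
      rw [LinearMap.mem_ker]
      ext x
      obtain ⟨g, rfl⟩ := cls_surjective n x
      simp only [LinearMap.coe_mk, AddHom.coe_mk, descend_apply, LinearMap.zero_apply]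
      exact (cls_eq_zero_iff _).2 <|
          cocycleCup_isCoboundary_left f g ((cls_eq_zero_iff _).1 hf))

lemma cup_cls {m n : ℕ} (f : Cocycle p G m) (g : Cocycle p G n) :
    cup m n (cls p G m f) (cls p G n g) = cls p G (m + n) (cocycleCup f g) := by
  simp only [cup, descend_apply, LinearMap.coe_mk, AddHom.coe_mk]
  rfl

variable (p G) in
/-- The constant `0`-cocycle `1`. -/
def oneCocycle : Cocycle p G 0 :=
  ⟨fun _ => 1, by
    apply onSeq_injective
    funext v
    rw [onSeq_coboundary]
    simp [onSeq]⟩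

lemma mk_mul_mk_cls {m n : ℕ} (f : Cocycle p G m) (g : Cocycle p G n) :
    (⟨m + n, cup m n (cls p G m f) (cls p G n g)⟩ : GradedMonoid (H p G)) =
      ⟨m + n, cls p G (m + n) (cocycleCup f g)⟩ := by
  rw [cup_cls]

instance instGMul : GradedMonoid.GMul (H p G) where
  mul {m n} a b := cup m n a b

instance instGOne : GradedMonoid.GOne (H p G) where
  one := cls p G 0 (oneCocycle p G)

instance instGMonoid : GradedMonoid.GMonoid (H p G) where
  one_mul := by
    rintro ⟨n, a⟩
    obtain ⟨f, rfl⟩ := cls_surjective n a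
    refine (mk_mul_mk_cls _ f).trans (mk_cls_congr (zero_add n) _ _ ?_)
    funext v
    refine (onSeq_cup _ _ v).trans ?_
    simp [onSeq, oneCocycle]
  mul_one := by
    rintro ⟨n, a⟩
    obtain ⟨f, rfl⟩ := cls_surjective n a
    refine (mk_mul_mk_cls f _).trans (mk_cls_congr (add_zero n) _ _ ?_)
    funext v
    refine (onSeq_cup _ _ v).trans ?_
    simp [onSeq, oneCocycle]
  mul_assoc := by
    rintro ⟨l, a⟩ ⟨m, b⟩ ⟨n, c⟩
    obtain ⟨f, rfl⟩ := cls_surjective l a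
    obtain ⟨g, rfl⟩ := cls_surjective m b
    obtain ⟨h, rfl⟩ := cls_surjective n c
    change (⟨l + m + n, cup (l + m) n (cup l m _ _) _⟩ : GradedMonoid (H p G)) =
      ⟨l + (m + n), cup l (m + n) _ (cup m n _ _)⟩
    rw [cup_cls, cup_cls, cup_cls, cup_cls]
    refine mk_cls_congr (add_assoc l m n) _ _ ?_
    funext v
    change onSeq (cochainCup (cochainCup f.1 g.1) h.1) v =
      onSeq (cochainCup f.1 (cochainCup g.1 h.1)) v
    simp only [onSeq_cup, mul_assoc, add_assoc]

instance instGRing : DirectSum.GRing (H p G) where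
  mul_zero a := map_zero (cup _ _ a)
  zero_mul b := by
    change cup _ _ 0 b = 0
    simp
  mul_add a b c := map_add (cup _ _ a) b c
  add_mul a b c := by
    change cup _ _ (a + b) c = cup _ _ a c + cup _ _ b c
    simp
  natCast n := n • cls p G 0 (oneCocycle p G)
  natCast_zero := zero_smul _ _
  natCast_succ n := succ_nsmul _ _
  intCast n := n • cls p G 0 (oneCocycle p G)
  intCast_ofNat n := natCast_zsmul _ _
  intCast_negSucc_ofNat n := negSucc_zsmul _ _

lemma gmul_def {m n : ℕ} (a : H p G m) (b : H p G n) :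
    GradedMonoid.GMul.mul a b = cup m n a b := rfl

lemma gone_def : (GradedMonoid.GOne.one : H p G 0) = cls p G 0 (oneCocycle p G) := rfl

instance instGAlgebra : DirectSum.GAlgebra (ZMod p) (H p G) where
  toFun := (LinearMap.toSpanSingleton (ZMod p) (H p G 0)
    (cls p G 0 (oneCocycle p G))).toAddMonoidHom
  map_one := one_smul _ _
  map_mul r s := by
    change (⟨0, (r * s) • cls p G 0 (oneCocycle p G)⟩ : GradedMonoid (H p G)) =
      ⟨0 + 0, cup 0 0 (r • cls p G 0 (oneCocycle p G)) (s • cls p G 0 (oneCocycle p G))⟩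
    rw [← map_smul, ← map_smul, ← map_smul, cup_cls]
    refine mk_cls_congr rfl _ _ ?_
    funext v
    refine Eq.trans ?_ (onSeq_cup _ _ v).symm
    simp [onSeq, oneCocycle]
  commutes r := by
    rintro ⟨n, a⟩
    obtain ⟨f, rfl⟩ := cls_surjective n a
    change (⟨0 + n, cup 0 n (r • cls p G 0 (oneCocycle p G)) _⟩ : GradedMonoid (H p G)) =
      ⟨n + 0, cup n 0 _ (r • cls p G 0 (oneCocycle p G))⟩
    rw [← map_smul, cup_cls, cup_cls]
    refine mk_cls_congr (by omega) _ _ ?_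
    funext v
    refine (onSeq_cup _ _ v).trans (Eq.trans ?_ (onSeq_cup _ _ v).symm)
    simp [onSeq, oneCocycle, mul_comm]
  smul_def r := by
    rintro ⟨n, a⟩
    obtain ⟨f, rfl⟩ := cls_surjective n a
    change (⟨n, r • _⟩ : GradedMonoid (H p G)) =
      ⟨0 + n, cup 0 n (r • cls p G 0 (oneCocycle p G)) _⟩
    rw [← map_smul, ← map_smul, cup_cls]
    refine mk_cls_congr (by omega) _ _ ?_
    funext v
    refine Eq.trans ?_ (onSeq_cup _ _ v).symm
    simp [onSeq, oneCocycle]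

end Cup

open DirectSum in
/-- The mod `p` cohomology ring `H*(BG)`, an `𝔽_p`-algebra under the cup product. -/
abbrev HStar (p : ℕ) (G : Type) [Group G] : Type := ⨁ n, H p G n

/-- A class of degree `n`, viewed in the cohomology ring. -/
abbrev inDegree (p : ℕ) (G : Type) [Group G] (n : ℕ) : H p G n →ₗ[ZMod p] HStar p G :=
  DirectSum.lof (ZMod p) ℕ (H p G) n

/-! ### Restriction -/

section Restriction

variable (p : ℕ) {G K : Type} [Group G] [Group K] (φ : K →* G)

/-- The map `Hⁿ(BG) → Hⁿ(BK)` induced by `φ : K →* G` (restriction, if `φ` is an inclusion). -/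
def resDegree (n : ℕ) : H p G n →ₗ[ZMod p] H p K n :=
  (groupCohomology.map (A := Rep.trivial (ZMod p) G (ZMod p))
    (B := Rep.trivial (ZMod p) K (ZMod p)) φ (Rep.ofHom ⟨LinearMap.id, fun _ => rfl⟩) n).hom

variable {p}

/-- The pull-back of a cocycle. -/
def cocycleRes {n : ℕ} (f : Cocycle p G n) : Cocycle p K n :=
  ⟨fun v => f.1 (φ ∘ v), by
    have h : ∀ {n : ℕ} (f : (Fin n → G) → ZMod p) (v : ℕ → K),
      onSeq (fun v => f (φ ∘ v)) v = onSeq f (φ ∘ v) := fun _ _ => rfl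
    have h' : ∀ j (v : ℕ → K), contractSeq j (φ ∘ v) = φ ∘ contractSeq j v := by
      intro j v
      funext i
      simp only [contractSeq, Function.comp_apply]
      split_ifs <;> simp
    apply onSeq_injective
    funext v
    have hf := congrFun (congrArg onSeq (LinearMap.mem_ker.1 f.2)) (φ ∘ v)
    rw [onSeq_coboundary] at hf ⊢
    simp only [h, h'] at hf ⊢
    exact hf⟩

lemma resDegree_cls {n : ℕ} (f : Cocycle p G n) :
    resDegree p φ n (cls p G n f) = cls p K n (cocycleRes φ f) := by
  have h := groupCohomology.π_map_apply (A := Rep.trivial (ZMod p) G (ZMod p))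
    (B := Rep.trivial (ZMod p) K (ZMod p)) φ (Rep.ofHom ⟨LinearMap.id, fun _ => rfl⟩) n
    (groupCohomology.cocyclesMk f.1 f.2)
  refine h.trans ?_
  change groupCohomology.π _ n _ = groupCohomology.π _ n _
  congr 1
  apply (ModuleCat.mono_iff_injective
    (groupCohomology.iCocycles (Rep.trivial (ZMod p) K (ZMod p)) n)).1 inferInstance
  erw [groupCohomology.iCocycles_mk]
  have h1 := HomologicalComplex.cyclesMap_i (groupCohomology.cochainsMap
    (A := Rep.trivial (ZMod p) G (ZMod p)) (B := Rep.trivial (ZMod p) K (ZMod p)) φ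
    (Rep.ofHom ⟨LinearMap.id, fun _ => rfl⟩)) n
  refine (congrArg (fun ψ => ψ.hom (groupCohomology.cocyclesMk
    (A := Rep.trivial (ZMod p) G (ZMod p)) f.1 f.2)) h1).trans ?_
  have h2 := groupCohomology.iCocycles_mk (A := Rep.trivial (ZMod p) G (ZMod p)) f.1 f.2
  exact congrArg (fun x => ((groupCohomology.cochainsMap
    (A := Rep.trivial (ZMod p) G (ZMod p)) (B := Rep.trivial (ZMod p) K (ZMod p)) φ
    (Rep.ofHom ⟨LinearMap.id, fun _ => rfl⟩)).f n).hom x) h2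

variable (p) in
/-- The ring homomorphism `H*(BG) → H*(BK)` induced by `φ : K →* G`. -/
def res : HStar p G →ₐ[ZMod p] HStar p K :=
  DirectSum.toAlgebra (ZMod p) (H p G) (fun n => inDegree p K n ∘ₗ resDegree p φ n)
    (by
      rw [gone_def, LinearMap.comp_apply, resDegree_cls]
      rfl)
    (by
      intro i j a b
      obtain ⟨f, rfl⟩ := cls_surjective i a
      obtain ⟨g, rfl⟩ := cls_surjective j b
      simp only [gmul_def, LinearMap.comp_apply, cup_cls, resDegree_cls, inDegree,
        DirectSum.lof_eq_of, DirectSum.of_mul_of]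
      rfl)

end Restriction

/-! ### The Bockstein -/

section Bockstein

variable {p : ℕ} {G : Type} [Group G]

/-- Reduction modulo `p` of an integral cochain. -/
def reduce (p : ℕ) {n : ℕ} (F : (Fin n → G) → ℤ) : (Fin n → G) → ZMod p := fun v => (F v : ZMod p)

lemma coboundary_reduce {n : ℕ} (F : (Fin n → G) → ℤ) :
    coboundary (ZMod p) G n (reduce p F) = reduce p (coboundary ℤ G n F) := by
  apply onSeq_injective
  funext v
  have h : ∀ {n : ℕ} (F : (Fin n → G) → ℤ) (v : ℕ → G),
      onSeq (reduce p F) v = ((onSeq F v : ℤ) : ZMod p) := fun _ _ => rfl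
  rw [h, onSeq_coboundary, onSeq_coboundary]
  simp [h]

lemma exists_of_reduce_eq_zero {n : ℕ} {F : (Fin n → G) → ℤ} (h : reduce p F = 0) :
    ∃ D : (Fin n → G) → ℤ, F = (p : ℤ) • D := by
  have : ∀ v, ∃ d : ℤ, F v = p * d := fun v =>
    (ZMod.intCast_zmod_eq_zero_iff_dvd (F v) p).1 (congrFun h v)
  choose D hD using this
  exact ⟨D, funext fun v => by simp [hD]⟩

variable [NeZero p]

lemma smul_cancel {n : ℕ} {D E : (Fin n → G) → ℤ} (h : (p : ℤ) • D = (p : ℤ) • E) : D = E :=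
  smul_right_injective _ (Int.natCast_ne_zero.2 (NeZero.ne p)) h

/-- If an integral cochain `F` satisfies `δF = p E` then `E` is a cocycle modulo `p`. -/
lemma reduce_mem_cocycle {n : ℕ} {F : (Fin n → G) → ℤ} {E : (Fin (n + 1) → G) → ℤ}
    (h : coboundary ℤ G n F = (p : ℤ) • E) : reduce p E ∈ Cocycle p G (n + 1) := by
  rw [LinearMap.mem_ker, coboundary_reduce]
  have h0 : coboundary ℤ G (n + 1) E = 0 := by
    apply smul_cancel (p := p)
    rw [← map_smul, ← h, coboundary_coboundary, smul_zero]
  rw [h0]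
  funext v
  simp [reduce]

lemma isCoboundary_reduce {n : ℕ} {F : (Fin n → G) → ℤ} {E : (Fin (n + 1) → G) → ℤ}
    (h : coboundary ℤ G n F = (p : ℤ) • E) (hF : IsCoboundary (reduce p F)) :
    IsCoboundary (reduce p E) := by
  have main : ∀ F' : (Fin n → G) → ℤ, coboundary ℤ G n F' = (p : ℤ) • E → reduce p F' = 0 →
      IsCoboundary (reduce p E) := by
    intro F' h' hF'
    obtain ⟨D, rfl⟩ := exists_of_reduce_eq_zero hF'
    rw [map_smul] at h'
    refine Or.inr ⟨n, reduce p D, rfl, ?_⟩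
    rw [coboundary_reduce, smul_cancel h']
  rcases hF with hF | ⟨m, g, rfl, hg⟩
  · exact main F h hF
  · let g' : (Fin m → G) → ℤ := fun v => (g v).cast
    have hg' : reduce p g' = g := by
      funext v
      simp [reduce, g']
    refine main (F - coboundary ℤ G m g') ?_ ?_
    · rw [map_sub, h, coboundary_coboundary, sub_zero]
    · have h1 := onSeq_injective hg
      have h2 := coboundary_reduce (p := p) g'
      rw [hg', ← h1] at h2
      funext v
      have h3 := congrFun h2 v
      simp only [reduce] at h3
      simp [reduce, h3]

/-- The standard integral lift of a mod `p` cochain. -/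
def lift {n : ℕ} (f : (Fin n → G) → ZMod p) : (Fin n → G) → ℤ := fun v => ((f v).cast : ℤ)

/-- For a mod `p` cocycle `f` with integral lift `F`, the integral cochain `δF / p`. -/
def divCoboundary {n : ℕ} (f : (Fin n → G) → ZMod p) : (Fin (n + 1) → G) → ℤ :=
  fun v => coboundary ℤ G n (lift f) v / (p : ℤ)

lemma reduce_lift {n : ℕ} (f : (Fin n → G) → ZMod p) : reduce p (lift f) = f := by
  funext v
  simp [reduce, lift]

lemma coboundary_lift {n : ℕ} (f : Cocycle p G n) :
    coboundary ℤ G n (lift f.1) = (p : ℤ) • divCoboundary f.1 := by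
  have h := coboundary_reduce (p := p) (lift f.1)
  rw [reduce_lift, LinearMap.mem_ker.1 f.2] at h
  funext v
  have hv := (ZMod.intCast_zmod_eq_zero_iff_dvd _ p).1 (congrFun h v).symm
  simp only [Pi.smul_apply, smul_eq_mul, divCoboundary]
  exact (Int.mul_ediv_cancel' hv).symm

/-- The Bockstein of a cocycle `f`: the class of `δF / p`, where `F` is an integral lift of `f`. -/
def bocksteinCocycle (n : ℕ) : Cocycle p G n →+ H p G (n + 1) :=
  AddMonoidHom.mk' (fun f => cls p G (n + 1)
      ⟨reduce p (divCoboundary f.1), reduce_mem_cocycle (coboundary_lift f)⟩) <| by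
    intro f g
    rw [← sub_eq_zero, ← map_add, ← map_sub, cls_eq_zero_iff]
    have h : coboundary ℤ G n (lift (f + g).1 - (lift f.1 + lift g.1)) =
        (p : ℤ) • (divCoboundary (f + g).1 - (divCoboundary f.1 + divCoboundary g.1)) := by
      rw [map_sub, map_add, coboundary_lift, coboundary_lift, coboundary_lift, smul_sub, smul_add]
    have h' := isCoboundary_reduce h (Or.inl (by funext v; simp [reduce, lift]))
    convert h' using 1
    funext v
    simp [reduce]

/-- The Bockstein `β : Hⁿ(BG) → Hⁿ⁺¹(BG)`, the connecting homomorphism of the coefficient sequence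
`0 → ℤ/p → ℤ/p² → ℤ/p → 0`: lift a cocycle to an integral cochain `F` and take the class of
`δF / p`. -/
def bockstein (n : ℕ) : H p G n →ₗ[ZMod p] H p G (n + 1) :=
  descend (cls p G n) (cls_surjective n) ((bocksteinCocycle n).toZModLinearMap p) (by
    intro f hf
    refine (cls_eq_zero_iff _).2 (isCoboundary_reduce (coboundary_lift f) ?_)
    rw [reduce_lift]
    exact (cls_eq_zero_iff _).1 hf)

/-- The Bockstein may be computed from any integral lift `F` of any representing cocycle. -/
lemma bockstein_cls {n : ℕ} (f : Cocycle p G n) {F : (Fin n → G) → ℤ}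
    {E : (Fin (n + 1) → G) → ℤ} (hF : reduce p F = f.1)
    (h : coboundary ℤ G n F = (p : ℤ) • E) :
    bockstein n (cls p G n f) = cls p G (n + 1) ⟨reduce p E, reduce_mem_cocycle h⟩ := by
  refine (descend_apply (cls p G n) (cls_surjective n)
    ((bocksteinCocycle n).toZModLinearMap p) _ f).trans ?_
  change cls p G (n + 1) _ = _
  rw [← sub_eq_zero, ← map_sub, cls_eq_zero_iff]
  have h1 : coboundary ℤ G n (lift f.1 - F) = (p : ℤ) • (divCoboundary f.1 - E) := by
    rw [map_sub, coboundary_lift, h, smul_sub]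
  have h' := isCoboundary_reduce h1 (Or.inl (by
    funext v
    have := congrFun hF v
    simp only [reduce] at this
    simp [reduce, lift, this]))
  convert h' using 1
  funext v
  simp [reduce]

end Bockstein

/-! ### The central elementary abelian subgroup and the invariants `c` and `e` -/

section Invariants

variable (p : ℕ) (G : Type) [Group G]

/-- `C(G)`: the elements of the centre of `G` whose `p`-th power is `1`. -/
def C : Subgroup G where
  carrier := {x | x ∈ Subgroup.center G ∧ x ^ p = 1}
  one_mem' := ⟨one_mem _, one_pow p⟩
  mul_mem' := by
    rintro x y ⟨hx, hx'⟩ ⟨hy, hy'⟩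
    have hxy : Commute x y := Subgroup.mem_center_iff.1 hy x
    exact ⟨mul_mem hx hy, by rw [hxy.mul_pow, hx', hy', one_mul]⟩
  inv_mem' := by
    rintro x ⟨hx, hx'⟩
    exact ⟨inv_mem hx, by rw [inv_pow, hx', inv_one]⟩

/-- `C(G)` is the maximal central elementary abelian `p`-subgroup of `G`. -/
lemma isGreatest_C :
    IsGreatest {V : Subgroup G | V ≤ Subgroup.center G ∧ ∀ x ∈ V, x ^ p = 1} (C p G) :=
  ⟨⟨fun _ hx => hx.1, fun _ hx => hx.2⟩, fun _ hV x hx => ⟨hV.1 hx, hV.2 x hx⟩⟩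

instance instAddCommGroupC : AddCommGroup (Additive (C p G)) where
  add_comm x y := Subtype.ext (Subgroup.mem_center_iff.1 y.toMul.2.1 x.toMul.1)

instance instModuleC : Module (ZMod p) (Additive (C p G)) :=
  AddCommGroup.zmodModule fun x => Subtype.ext x.toMul.2.2

/-- `c(G)`: the rank of `C(G)`, i.e. its dimension as a vector space over `𝔽_p`. -/
def c : ℕ := Module.finrank (ZMod p) (Additive (C p G))

/-- The restriction `i* : H*(BG) → H*(BC(G))`. -/
def resC : HStar p G →ₐ[ZMod p] HStar p (C p G) := res p (C p G).subtype

/-- The `H*(BG)`-decomposables of `H*(BC(G))`: the span of the products `i*(a) b` with `a` of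
positive degree. -/
def decomposables : Submodule (ZMod p) (HStar p (C p G)) :=
  Submodule.span (ZMod p) {z | ∃ (n : ℕ) (a : H p G n) (b : HStar p (C p G)),
    0 < n ∧ z = resC p G (inDegree p G n a) * b}

/-- `e(G)`: the top degree of an `H*(BG)`-module generator of `H*(BC(G))`, that is, the top degree
in which the indecomposables `H*(BC(G)) ⊗_{H*(BG)} 𝔽_p = H*(BC(G)) / decomposables` are nonzero
(`⊤` if they are nonzero in arbitrarily high degrees). -/
def e : ℕ∞ :=
  ⨆ n ∈ {n : ℕ | ∃ b : H p (C p G) n, inDegree p (C p G) n b ∉ decomposables p G}, (n : ℕ∞)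

end Invariants

end ModPCohomology

end

/-! Let `A ≤ P` be an abelian subgroup containing `C = C(P)` and let `n = |P : A|`. A character of
`C` extends to a character of `A` with values in a cyclic group `ℤ/M`, which acts on a triangulated
circle by rotations. Inducing from `A` to `P` gives an action of `P` on the join of the `n` circles
indexed by `P ⧸ A`, a simplicial sphere of dimension `2n - 1` whose fundamental cycle is invariant.
The obstruction to extending an equivariant chain map from the bar resolution to the chains of this
sphere beyond its dimension is an Euler class in `H²ⁿ(BP)`. The central subgroup `C` rotates all
circles by the same angle, so over `C` the chain map can be written down explicitly, with the
`n`-th power of the Bockstein of the character as obstruction. Hence all `yᵢⁿ` lie in the image of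
`i*`.

For the bound on `e(P)`, write `C = D × ⟨t⟩` with `t` of order `p`. Then every class of `C` is a sum
of a class pulled back from `D`, a multiple of `x` by such a class, and a multiple of `y = β(x)`.
Removing factors `y` one at a time shows that a class of degree larger than `c(2n - 1)` lies in the
ideal generated by the `yᵢⁿ`, because each of the `c` variables contributes at most
`1 + 2(n - 1) = 2n - 1` to the degree of a monomial outside this ideal. -/

noncomputable section

namespace ModPCohomology

/-! ### Homogeneous cochains -/

section Sequences

variable {G H M N : Type*}

/-- The sequence `a, w 0, w 1, …`. -/
def scons (a : G) (w : ℕ → G) : ℕ → G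
  | 0 => a
  | j + 1 => w j

/-- The sequence `w 1, w 2, …`. -/
def stail (w : ℕ → G) : ℕ → G := fun j ↦ w (j + 1)

@[simp] lemma scons_zero (a : G) (w : ℕ → G) : scons a w 0 = a := rfl

@[simp] lemma scons_succ (a : G) (w : ℕ → G) (j : ℕ) : scons a w (j + 1) = w j := rfl

@[simp] lemma stail_apply (w : ℕ → G) (j : ℕ) : stail w j = w (j + 1) := rfl

@[simp] lemma stail_scons (a : G) (w : ℕ → G) : stail (scons a w) = w := rfl

@[simp] lemma scons_stail (w : ℕ → G) : scons (w 0) (stail w) = w := by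
  funext j; cases j <;> rfl

lemma comp_scons (f : G → H) (a : G) (w : ℕ → G) : f ∘ scons a w = scons (f a) (f ∘ w) := by
  funext j; cases j <;> rfl

lemma comp_stail (f : G → H) (w : ℕ → G) : f ∘ stail w = stail (f ∘ w) := rfl

lemma dependsOn_scons {d : ℕ} {F : (ℕ → G) → M} (hF : DependsOn F (Set.Iio (d + 1))) (a : G) :
    DependsOn (fun u ↦ F (scons a u)) (Set.Iio d) := by
  intro u u' hu
  refine hF ?_
  rintro (_ | i) hi
  · rfl
  · exact hu i (Nat.lt_of_succ_lt_succ hi)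

lemma dependsOn_stail {d : ℕ} {F : (ℕ → G) → M} (hF : DependsOn F (Set.Iio d)) :
    DependsOn (fun u ↦ F (stail u)) (Set.Iio (d + 1)) :=
  fun _ _ hu ↦ hF fun i hi ↦ hu (i + 1) (Nat.succ_lt_succ hi)

variable [AddCommGroup M] [AddCommGroup N]

/-- The alternating sum of `F` over the sequences obtained from `w` by deleting one of its first
`d` entries. A homogeneous cochain of degree `n` is encoded as a function of infinite sequences that
depends on the first `n + 1` entries only; its coboundary is then `altSum (n + 2) F`. -/
def altSum : ℕ → ((ℕ → G) → M) → (ℕ → G) → M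
  | 0, _, _ => 0
  | d + 1, F, w => F (stail w) - altSum d (fun u ↦ F (scons (w 0) u)) (stail w)

lemma altSum_zero (F : (ℕ → G) → M) (w : ℕ → G) : altSum 0 F w = 0 := rfl

lemma altSum_succ (d : ℕ) (F : (ℕ → G) → M) (w : ℕ → G) :
    altSum (d + 1) F w = F (stail w) - altSum d (fun u ↦ F (scons (w 0) u)) (stail w) := rfl

lemma altSum_map (φ : M →+ N) (d : ℕ) (F : (ℕ → G) → M) (w : ℕ → G) :
    φ (altSum d F w) = altSum d (fun u ↦ φ (F u)) w := by
  induction d generalizing w F with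
  | zero => simp only [altSum_zero, map_zero]
  | succ d ih => simp only [altSum_succ, map_sub, ih]

lemma altSum_zero_fun (d : ℕ) (w : ℕ → G) : altSum d (fun _ ↦ (0 : M)) w = 0 :=
  (altSum_map (0 : M →+ M) d (fun _ ↦ 0) w).symm

lemma altSum_add (d : ℕ) (F F' : (ℕ → G) → M) (w : ℕ → G) :
    altSum d (fun u ↦ F u + F' u) w = altSum d F w + altSum d F' w := by
  induction d generalizing w F F' with
  | zero => simp only [altSum_zero, add_zero]
  | succ d ih => simp only [altSum_succ, ih]; abel

lemma altSum_neg (d : ℕ) (F : (ℕ → G) → M) (w : ℕ → G) :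
    altSum d (fun u ↦ -F u) w = -altSum d F w :=
  (altSum_map (-AddMonoidHom.id M) d F w).symm

lemma altSum_sub (d : ℕ) (F F' : (ℕ → G) → M) (w : ℕ → G) :
    altSum d (fun u ↦ F u - F' u) w = altSum d F w - altSum d F' w := by
  simp only [sub_eq_add_neg, altSum_add, altSum_neg]

lemma altSum_sum {ι : Type*} (s : Finset ι) (d : ℕ) (F : ι → (ℕ → G) → M) (w : ℕ → G) :
    altSum d (fun u ↦ ∑ i ∈ s, F i u) w = ∑ i ∈ s, altSum d (F i) w := by
  classical
  induction s using Finset.induction_on with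
  | empty => simp only [Finset.sum_empty, altSum_zero_fun]
  | insert a s ha ih => simp only [Finset.sum_insert ha, altSum_add, ih]

lemma altSum_comp (f : G → H) (d : ℕ) (F : (ℕ → H) → M) (w : ℕ → G) :
    altSum d F (f ∘ w) = altSum d (fun u ↦ F (f ∘ u)) w := by
  induction d generalizing w F with
  | zero => rfl
  | succ d ih => simp only [altSum_succ, ← comp_stail, ih, comp_scons, Function.comp_apply]

lemma altSum_mem {S : Type*} [SetLike S M] [AddSubgroupClass S M] (X : S) (d : ℕ)
    (F : (ℕ → G) → M) (hF : ∀ w, F w ∈ X) (w : ℕ → G) : altSum d F w ∈ X := by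
  induction d generalizing w F with
  | zero => exact zero_mem X
  | succ d ih => exact sub_mem (hF _) (ih _ (fun _ ↦ hF _) _)

lemma altSum_altSum (d : ℕ) (F : (ℕ → G) → M) (w : ℕ → G) :
    altSum (d + 1) (altSum d F) w = 0 := by
  induction d generalizing w F with
  | zero => simp only [altSum_succ, altSum_zero, sub_zero]
  | succ d ih =>
    have h_scons : (fun u ↦ altSum (d + 1) F (scons (w 0) u)) =
        fun u ↦ F u - altSum d (fun u ↦ F (scons (w 0) u)) u := rfl
    rw [altSum_succ, h_scons, altSum_sub, ih, sub_zero, sub_self]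

lemma dependsOn_altSum {d : ℕ} {F : (ℕ → G) → M} (hF : DependsOn F (Set.Iio d)) :
    DependsOn (altSum (d + 1) F) (Set.Iio (d + 1)) := by
  induction d generalizing F with
  | zero =>
    intro w w' hw
    simpa only [altSum_succ, altSum_zero, sub_zero] using dependsOn_stail hF hw
  | succ d ih =>
    intro w w' hw
    rw [altSum_succ, altSum_succ, hw 0 (Nat.succ_pos _)]
    exact congrArg₂ (· - ·) (dependsOn_stail hF hw)
      (dependsOn_stail (ih (dependsOn_scons hF (w' 0))) hw)

/-- The increasing map `ℕ → ℕ` with image `ℕ \ {i}`. -/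
def skipIndex (i j : ℕ) : ℕ := if j < i then j else j + 1

lemma comp_skipIndex_zero (w : ℕ → G) : w ∘ skipIndex 0 = stail w := by
  funext j; simp [skipIndex]

lemma scons_stail_comp_skipIndex (w : ℕ → G) (i : ℕ) :
    scons (w 0) (stail w ∘ skipIndex i) = w ∘ skipIndex (i + 1) := by
  funext j
  cases j with
  | zero => simp [skipIndex]
  | succ j =>
    simp only [scons_succ, Function.comp_apply, skipIndex, stail_apply, add_lt_add_iff_right]
    split_ifs <;> rfl

lemma altSum_eq_sum (d : ℕ) (F : (ℕ → G) → M) (w : ℕ → G) :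
    altSum d F w = ∑ i ∈ Finset.range d, (-1 : ℤ) ^ i • F (w ∘ skipIndex i) := by
  induction d generalizing w F with
  | zero => rfl
  | succ d ih =>
    rw [altSum_succ, Finset.sum_range_succ', ih]
    simp only [comp_skipIndex_zero, scons_stail_comp_skipIndex, pow_succ, mul_neg, mul_one,
      neg_smul, Finset.sum_neg_distrib, pow_zero, one_smul]
    abel

end Sequences

section CupProduct

variable {G R M : Type*} [CommRing R] [AddCommGroup M] [Module R M]

/-- The cup product of homogeneous cochains, the first of which has degree `m`. -/
def homogeneousCup (m : ℕ) (F : (ℕ → G) → R) (F' : (ℕ → G) → M) : (ℕ → G) → M :=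
  fun w ↦ F w • F' fun j ↦ w (m + j)

lemma homogeneousCup_scons (m : ℕ) (F : (ℕ → G) → R) (F' : (ℕ → G) → M) (a : G) (w : ℕ → G) :
    homogeneousCup (m + 1) F F' (scons a w) =
      homogeneousCup m (fun u ↦ F (scons a u)) F' w := by
  simp only [homogeneousCup]
  congr 2
  funext j
  rw [add_right_comm, scons_succ]

lemma dependsOn_homogeneousCup {m n : ℕ} {F : (ℕ → G) → R} {F' : (ℕ → G) → M}
    (hF : DependsOn F (Set.Iio (m + 1))) (hF' : DependsOn F' (Set.Iio (n + 1))) :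
    DependsOn (homogeneousCup m F F') (Set.Iio (m + n + 1)) := by
  intro w w' h
  simp only [Set.mem_Iio] at h
  refine congrArg₂ (· • ·) (hF fun i hi ↦ h i ?_) (hF' fun i hi ↦ h (m + i) ?_) <;>
  · rw [Set.mem_Iio] at hi
    omega

lemma altSum_const_smul (d : ℕ) (r : R) (F : (ℕ → G) → M) (w : ℕ → G) :
    altSum d (fun u ↦ r • F u) w = r • altSum d F w :=
  (altSum_map (DistribSMul.toAddMonoidHom M r) d F w).symm

lemma altSum_homogeneousCup_zero (n : ℕ) {F : (ℕ → G) → R} (F' : (ℕ → G) → M)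
    (hF : DependsOn F (Set.Iio 1)) (w : ℕ → G) :
    altSum (n + 2) (homogeneousCup 0 F F') w =
      altSum 2 F w • F' (stail w) + F w • altSum (n + 2) F' w := by
  have hcup : homogeneousCup 0 F F' = fun u ↦ F u • F' u := by
    funext u; simp only [homogeneousCup, zero_add]
  have hhead : ∀ u, F (scons (w 0) u) = F w := fun u ↦ hF fun i hi ↦ by
    rw [Nat.lt_one_iff.1 hi, scons_zero]
  rw [hcup, altSum_succ (n + 1), altSum_succ (n + 1), altSum_succ 1, altSum_succ 0, altSum_zero]
  simp only [hhead, altSum_const_smul]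
  module

lemma altSum_homogeneousCup (m n : ℕ) {F : (ℕ → G) → R} (F' : (ℕ → G) → M)
    (hF : DependsOn F (Set.Iio (m + 1))) (w : ℕ → G) :
    altSum (m + n + 2) (homogeneousCup m F F') w =
      altSum (m + 2) F w • F' (fun j ↦ w (m + 1 + j)) +
        (-1 : R) ^ m • F w • altSum (n + 2) F' fun j ↦ w (m + j) := by
  induction m generalizing F w with
  | zero =>
    have hstail : (fun j ↦ w (0 + 1 + j)) = stail w := by
      funext j; rw [stail_apply, zero_add, add_comm]
    rw [hstail, zero_add, altSum_homogeneousCup_zero n F' hF w]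
    simp only [zero_add, pow_zero, one_smul]
  | succ m ih =>
    have hshift : ∀ c, (fun j ↦ w (c + j + 1)) = fun j ↦ w (c + 1 + j) := fun c ↦ by
      simp only [add_right_comm]
    rw [show m + 1 + n + 2 = (m + n + 2) + 1 by omega, altSum_succ, altSum_succ (m + 2)]
    simp only [homogeneousCup_scons]
    rw [ih (dependsOn_scons hF (w 0))]
    simp only [homogeneousCup, scons_stail, stail_apply, hshift]
    module

lemma altSum_homogeneousCup_of_altSum_eq_zero {m : ℕ} (n : ℕ) {F : (ℕ → G) → R}
    (F' : (ℕ → G) → M) (hF : DependsOn F (Set.Iio (m + 1))) (hc : ∀ w, altSum (m + 2) F w = 0)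
    (w : ℕ → G) :
    altSum (m + n + 2) (homogeneousCup m F F') w =
      (-1 : R) ^ m • F w • altSum (n + 2) F' fun j ↦ w (m + j) := by
  rw [altSum_homogeneousCup m n F' hF, hc, zero_smul, zero_add]

end CupProduct

/-! ### Homogeneous representatives of cohomology classes -/

section Ratios

variable {G : Type*} [Group G]

/-- The sequence `w 0⁻¹ * w 1, w 1⁻¹ * w 2, …`, which turns inhomogeneous cochains into
homogeneous ones. -/
def ratios (w : ℕ → G) : ℕ → G := fun i ↦ (w i)⁻¹ * w (i + 1)

/-- The sequence `1, v 0, v 0 * v 1, …`. -/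
def partialProds (v : ℕ → G) : ℕ → G
  | 0 => 1
  | i + 1 => partialProds v i * v i

lemma ratios_partialProds (v : ℕ → G) : ratios (partialProds v) = v := by
  funext i; simp [ratios, partialProds]

lemma mul_partialProds_ratios (w : ℕ → G) (i : ℕ) : w 0 * partialProds (ratios w) i = w i := by
  induction i with
  | zero => simp [partialProds]
  | succ i ih => rw [partialProds, ← mul_assoc, ih]; simp [ratios]

lemma partialProds_congr {v v' : ℕ → G} {d : ℕ} (h : ∀ i < d, v i = v' i) :
    ∀ i < d + 1, partialProds v i = partialProds v' i := by
  intro i hi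
  induction i with
  | zero => rfl
  | succ i ih => rw [partialProds, partialProds, ih (by omega), h i (by omega)]

lemma ratios_mul_left (g : G) (w : ℕ → G) : ratios ((g * ·) ∘ w) = ratios w := by
  funext i; simp [ratios, mul_assoc]

lemma ratios_comp {K F : Type*} [Group K] [FunLike F K G] [MonoidHomClass F K G] (φ : F)
    (w : ℕ → K) : ratios (φ ∘ w) = φ ∘ ratios w := by
  funext i; simp [ratios]

lemma ratios_comp_skipIndex_zero (w : ℕ → G) : ratios (w ∘ skipIndex 0) = stail (ratios w) := by
  rw [comp_skipIndex_zero]; rfl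

end Ratios

/-- A function of sequences is invariant under left translation by the elements of `S`. -/
def InvariantUnder {G M : Type*} [Mul G] (S : Set G) (F : (ℕ → G) → M) : Prop :=
  ∀ g ∈ S, ∀ w : ℕ → G, F ((g * ·) ∘ w) = F w

section Homogenization

variable {k G : Type} [Group G]

lemma ratios_comp_skipIndex_succ (w : ℕ → G) (j : ℕ) :
    ratios (w ∘ skipIndex (j + 1)) = contractSeq j (ratios w) := by
  funext i
  simp only [ratios, skipIndex, contractSeq, Function.comp_apply]
  rcases lt_trichotomy i j with h | rfl | h
  · rw [if_pos (by omega), if_pos (by omega), if_pos h]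
  · rw [if_pos (by omega), if_neg (by omega), if_neg (by omega), if_pos rfl, mul_assoc,
      mul_inv_cancel_left]
  · rw [if_neg (by omega), if_neg (by omega), if_neg (by omega), if_neg (by omega)]

lemma dependsOn_onSeq_ratios {d : ℕ} (f : (Fin d → G) → k) :
    DependsOn (fun w ↦ onSeq f (ratios w)) (Set.Iio (d + 1)) := by
  intro w w' h
  refine congrArg f (funext fun i ↦ ?_)
  rw [ratios, ratios, h i (Nat.lt_succ_of_lt i.2), h (i + 1) (Nat.succ_lt_succ i.2)]

lemma exists_onSeq_ratios_eq {d : ℕ} {F : (ℕ → G) → k} (hd : DependsOn F (Set.Iio (d + 1)))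
    (hi : InvariantUnder Set.univ F) : ∃ f : (Fin d → G) → k, ∀ w, onSeq f (ratios w) = F w := by
  refine ⟨fun v ↦ F (partialProds fun i ↦ if h : i < d then v ⟨i, h⟩ else 1), fun w ↦ ?_⟩
  rw [onSeq, ← hi (w 0) trivial]
  refine hd fun i hi ↦ Eq.trans ?_ (mul_partialProds_ratios w i)
  refine congrArg (w 0 * ·) (partialProds_congr (fun j hj ↦ ?_) i hi)
  rw [dif_pos hj]

lemma altSum_onSeq_ratios [CommRing k] {n : ℕ} (f : (Fin n → G) → k) (w : ℕ → G) :
    altSum (n + 2) (fun u ↦ onSeq f (ratios u)) w = onSeq (coboundary k G n f) (ratios w) := by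
  rw [onSeq_coboundary, altSum_eq_sum, Finset.sum_range_succ', add_comm]
  simp only [ratios_comp_skipIndex_zero, ratios_comp_skipIndex_succ, pow_zero, one_smul,
    zsmul_eq_mul, Int.cast_pow, Int.cast_neg, Int.cast_one]
  rfl

end Homogenization

section Represents

variable {p : ℕ} {G K : Type} [Group G] [Group K]

/-- The homogeneous cochain `F` is the homogeneous form of a cocycle of degree `d` whose class
is `u`. -/
def Represents (d : ℕ) (F : (ℕ → G) → ZMod p) (u : HStar p G) : Prop :=
  ∃ f : Cocycle p G d, (∀ w, onSeq f.1 (ratios w) = F w) ∧ u = inDegree p G d (cls p G d f)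

lemma represents_cls {d : ℕ} (f : Cocycle p G d) :
    Represents d (fun w ↦ onSeq f.1 (ratios w)) (inDegree p G d (cls p G d f)) :=
  ⟨f, fun _ ↦ rfl, rfl⟩

lemma represents_one : Represents (p := p) (G := G) 0 (fun _ ↦ 1) 1 :=
  represents_cls (oneCocycle p G)

lemma exists_represents {d : ℕ} {F : (ℕ → G) → ZMod p} (hd : DependsOn F (Set.Iio (d + 1)))
    (hi : InvariantUnder Set.univ F) (hc : ∀ w, altSum (d + 2) F w = 0) :
    ∃ u, Represents d F u := by
  obtain ⟨f, hf⟩ := exists_onSeq_ratios_eq hd hi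
  obtain rfl : (fun w ↦ onSeq f (ratios w)) = F := funext hf
  have hf_cocycle : f ∈ Cocycle p G d := by
    refine LinearMap.mem_ker.2 (onSeq_injective (funext fun v ↦ ?_))
    rw [← ratios_partialProds v, ← altSum_onSeq_ratios, hc]
    rfl
  exact ⟨_, represents_cls ⟨f, hf_cocycle⟩⟩

lemma exists_represents_of_mem_range {d : ℕ} {u : HStar p G}
    (hu : u ∈ LinearMap.range (inDegree p G d)) : ∃ F, Represents d F u := by
  obtain ⟨c, rfl⟩ := hu
  obtain ⟨f, rfl⟩ := cls_surjective d c
  exact ⟨_, represents_cls f⟩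

namespace Represents

variable {d m n : ℕ} {F F' : (ℕ → G) → ZMod p} {u u' : HStar p G}

lemma dependsOn (h : Represents d F u) : DependsOn F (Set.Iio (d + 1)) := by
  obtain ⟨f, hf, -⟩ := h
  rw [← show (fun w ↦ onSeq f.1 (ratios w)) = F from funext hf]
  exact dependsOn_onSeq_ratios f.1

lemma invariant (h : Represents d F u) : InvariantUnder Set.univ F := by
  obtain ⟨f, hf, -⟩ := h
  intro g _ w
  rw [← hf, ← hf, ratios_mul_left]

lemma altSum_eq_zero (h : Represents d F u) (w : ℕ → G) : altSum (d + 2) F w = 0 := by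
  obtain ⟨f, hf, -⟩ := h
  rw [← show (fun w ↦ onSeq f.1 (ratios w)) = F from funext hf, altSum_onSeq_ratios,
    LinearMap.mem_ker.1 f.2]
  rfl

lemma mem_range (h : Represents d F u) : u ∈ LinearMap.range (inDegree p G d) := by
  obtain ⟨f, -, rfl⟩ := h
  exact ⟨_, rfl⟩

lemma add (h : Represents d F u) (h' : Represents d F' u') :
    Represents d (fun w ↦ F w + F' w) (u + u') := by
  obtain ⟨f, hf, rfl⟩ := h
  obtain ⟨f', hf', rfl⟩ := h'
  refine ⟨f + f', fun w ↦ ?_, by rw [map_add, map_add]⟩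
  exact congrArg₂ (· + ·) (hf w) (hf' w)

lemma smul (r : ZMod p) (h : Represents d F u) : Represents d (fun w ↦ r * F w) (r • u) := by
  obtain ⟨f, hf, rfl⟩ := h
  refine ⟨r • f, fun w ↦ ?_, by rw [map_smul, map_smul]⟩
  exact congrArg (r * ·) (hf w)

lemma sub (h : Represents d F u) (h' : Represents d F' u') :
    Represents d (fun w ↦ F w - F' w) (u - u') := by
  simpa [sub_eq_add_neg] using h.add (h'.smul (-1))

lemma mul (h : Represents m F u) (h' : Represents n F' u') :
    Represents (m + n) (homogeneousCup m F F') (u * u') := by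
  obtain ⟨f, hf, rfl⟩ := h
  obtain ⟨f', hf', rfl⟩ := h'
  refine ⟨cocycleCup f f', fun w ↦ ?_, ?_⟩
  · rw [homogeneousCup, ← hf, ← hf']
    exact onSeq_cup _ _ _
  · simp only [inDegree, DirectSum.lof_eq_of, DirectSum.of_mul_of, gmul_def, cup_cls]

lemma eq_zero_of_eq_altSum (h : Represents (d + 1) F u) (hd : DependsOn F' (Set.Iio (d + 1)))
    (hi : InvariantUnder Set.univ F') (hF : ∀ w, F w = altSum (d + 2) F' w) : u = 0 := by
  obtain ⟨f, hf, rfl⟩ := h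
  obtain ⟨g, hg⟩ := exists_onSeq_ratios_eq hd hi
  obtain rfl : (fun w ↦ onSeq g (ratios w)) = F' := funext hg
  have hfg : onSeq f.1 = onSeq (coboundary (ZMod p) G d g) := funext fun v ↦ by
    rw [← ratios_partialProds v, hf, hF, altSum_onSeq_ratios]
  rw [(cls_eq_zero_iff f).2 (Or.inr ⟨d, g, rfl, hfg⟩), map_zero]

lemma unique (h : Represents d F u) (h' : Represents d F u') : u = u' := by
  obtain ⟨f, hf, rfl⟩ := h
  obtain ⟨f', hf', rfl⟩ := h'
  have hff' : f = f' := Subtype.ext <| onSeq_injective <| funext fun v ↦ by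
    rw [← ratios_partialProds v, hf, hf']
  rw [hff']

lemma res (φ : K →* G) (h : Represents d F u) :
    Represents d (fun w ↦ F (φ ∘ w)) (res p φ u) := by
  obtain ⟨f, hf, rfl⟩ := h
  refine ⟨cocycleRes φ f, fun w ↦ ?_, ?_⟩
  · exact (congrArg (onSeq f.1) (ratios_comp φ w)).symm.trans (hf (φ ∘ w))
  · rw [← resDegree_cls]
    exact DirectSum.toModule_lof (ZMod p) (φ := fun n ↦ inDegree p K n ∘ₗ resDegree p φ n) d _

end Represents

end Represents

/-! ### The prism homotopy -/

section Prism

variable {G M : Type*} [AddCommGroup M]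

/-- The prism operator of a self-map `ρ`, a homotopy from the identity to composition with `ρ`:
the alternating sum over `i < m` of the values of `F` at
`w 0, …, w i, ρ (w i), ρ (w (i + 1)), …`. -/
def prism (ρ : G → G) : ℕ → ((ℕ → G) → M) → (ℕ → G) → M
  | 0, _, _ => 0
  | m + 1, F, w => F (scons (w 0) (ρ ∘ w)) - prism ρ m (fun u ↦ F (scons (w 0) u)) (stail w)

lemma prism_zero (ρ : G → G) (F : (ℕ → G) → M) (w : ℕ → G) : prism ρ 0 F w = 0 := rfl

lemma prism_succ (ρ : G → G) (m : ℕ) (F : (ℕ → G) → M) (w : ℕ → G) :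
    prism ρ (m + 1) F w =
      F (scons (w 0) (ρ ∘ w)) - prism ρ m (fun u ↦ F (scons (w 0) u)) (stail w) := rfl

lemma prism_sub (ρ : G → G) (m : ℕ) (F F' : (ℕ → G) → M) (w : ℕ → G) :
    prism ρ m (fun u ↦ F u - F' u) w = prism ρ m F w - prism ρ m F' w := by
  induction m generalizing w F F' with
  | zero => simp only [prism_zero, sub_zero]
  | succ d ih => simp only [prism_succ, ih]; abel

lemma prism_zero_fun (ρ : G → G) (m : ℕ) (w : ℕ → G) : prism ρ m (fun _ ↦ (0 : M)) w = 0 := by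
  induction m generalizing w with
  | zero => rfl
  | succ d ih => rw [prism_succ, ih, sub_zero]

lemma dependsOn_prism (ρ : G → G) {m : ℕ} {F : (ℕ → G) → M}
    (hF : DependsOn F (Set.Iio (m + 1))) : DependsOn (prism ρ m F) (Set.Iio m) := by
  induction m generalizing F with
  | zero => exact fun _ _ _ ↦ rfl
  | succ m ih =>
    intro w w' hw
    rw [prism_succ, prism_succ, hw 0 (Nat.succ_pos m)]
    refine congrArg₂ (· - ·) (dependsOn_scons hF _ fun i hi ↦ congrArg ρ (hw i hi)) ?_
    exact dependsOn_stail (ih (dependsOn_scons hF _)) hw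

lemma prism_translate [Mul G] (ρ : G → G) {g : G} (hg : ∀ h, ρ (g * h) = g * ρ h) (m : ℕ)
    (F : (ℕ → G) → M) (w : ℕ → G) :
    prism ρ m F ((g * ·) ∘ w) = prism ρ m (fun u ↦ F ((g * ·) ∘ u)) w := by
  induction m generalizing F w with
  | zero => rfl
  | succ m ih =>
    have hρ : ρ ∘ (g * ·) ∘ w = (g * ·) ∘ ρ ∘ w := funext fun i ↦ hg (w i)
    simp only [prism_succ, ← comp_stail, ih, comp_scons, Function.comp_apply, hρ]

lemma altSum_prism (ρ : G → G) (m : ℕ) (F : (ℕ → G) → M) (hF : DependsOn F (Set.Iio (m + 1)))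
    (w : ℕ → G) :
    altSum (m + 1) (prism ρ m F) w + prism ρ (m + 1) (altSum (m + 2) F) w =
      F (ρ ∘ w) - F w := by
  induction m generalizing F w with
  | zero =>
    have hhead : F (scons (w 0) (stail (ρ ∘ w))) = F w := hF fun i hi ↦ by
      rw [Nat.lt_one_iff.1 hi, scons_zero]
    simp only [prism, altSum, scons_zero, stail_scons, hhead]
    abel
  | succ m ih =>
    have h_altSum_prism : altSum (m + 2) (prism ρ (m + 1) F) w = prism ρ (m + 1) F (stail w) -
        (altSum (m + 1) (fun u ↦ F (scons (w 0) (scons (ρ (w 0)) (ρ ∘ u)))) (stail w) -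
          altSum (m + 1) (prism ρ m fun u ↦ F (scons (w 0) u)) (stail w)) := by
      rw [altSum_succ, ← altSum_sub]
      simp only [prism_succ ρ m, scons_zero, stail_scons, comp_scons]
    have h_prism_altSum :
        prism ρ (m + 2) (altSum (m + 3) F) w = altSum (m + 3) F (scons (w 0) (ρ ∘ w)) -
          (prism ρ (m + 1) F (stail w) -
            prism ρ (m + 1) (altSum (m + 2) fun u ↦ F (scons (w 0) u)) (stail w)) := by
      rw [prism_succ, ← prism_sub]
      rfl
    have h_altSum_scons : altSum (m + 3) F (scons (w 0) (ρ ∘ w)) = F (ρ ∘ w) -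
        (F (scons (w 0) (ρ ∘ stail w)) -
          altSum (m + 1) (fun u ↦ F (scons (w 0) (scons (ρ (w 0)) (ρ ∘ u)))) (stail w)) := by
      rw [altSum_succ, altSum_succ, ← altSum_comp ρ (m + 1) fun u ↦
        F (scons (w 0) (scons (ρ (w 0)) u))]
      rfl
    have h_ih := ih (fun u ↦ F (scons (w 0) u)) (dependsOn_scons hF _) (stail w)
    rw [scons_stail] at h_ih
    rw [h_altSum_prism, h_prism_altSum, h_altSum_scons, sub_eq_iff_eq_add.1 h_ih.symm]
    abel

lemma altSum_prism_of_altSum_eq_zero (ρ : G → G) {m : ℕ} {F : (ℕ → G) → M}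
    (hF : DependsOn F (Set.Iio (m + 1))) (hc : ∀ w, altSum (m + 2) F w = 0) (w : ℕ → G) :
    altSum (m + 1) (prism ρ m F) w = F (ρ ∘ w) - F w := by
  rw [← altSum_prism ρ m F hF w, funext hc, prism_zero_fun, add_zero]

end Prism

/-! ### Characters, carries and the Bockstein -/

section Carry

variable {M : ℕ}

/-- The carry `0` or `1` in the addition of two residues modulo `M`. -/
def carry (a b : ZMod M) : ℤ := ((a.val : ℤ) + b.val - (a + b).val) / M

lemma mul_carry [NeZero M] (a b : ZMod M) :
    (M : ℤ) * carry a b = (a.val : ℤ) + b.val - (a + b).val := by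
  refine Int.mul_ediv_cancel' ?_
  rw [← ZMod.intCast_zmod_eq_zero_iff_dvd]
  simp

lemma carry_cocycle [NeZero M] (a b c : ZMod M) :
    carry b c - carry (a + b) c + carry a (b + c) - carry a b = 0 := by
  refine (mul_eq_zero.1 ?_).resolve_left (Int.natCast_ne_zero.2 (NeZero.ne M))
  have h_ab_c := mul_carry (a + b) c
  rw [add_assoc] at h_ab_c
  linear_combination mul_carry b c - h_ab_c + mul_carry a (b + c) - mul_carry a b

end Carry

section Bockstein

lemma onSeq_one {k G : Type} (f : (Fin 1 → G) → k) (v : ℕ → G) : onSeq f v = f fun _ ↦ v 0 :=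
  congrArg f <| funext fun i ↦ by rw [Subsingleton.elim i 0, Fin.val_zero]

variable {p : ℕ} {G : Type} [Group G]

lemma onSeq_coboundary_one {k : Type} [CommRing k] (f : (Fin 1 → G) → k) (v : ℕ → G) :
    onSeq (coboundary k G 1 f) v =
      f (fun _ ↦ v 1) - f (fun _ ↦ v 0 * v 1) + f (fun _ ↦ v 0) := by
  rw [onSeq_coboundary, Finset.sum_range_succ, Finset.sum_range_one]
  simp only [onSeq_one, contractSeq, zero_add, pow_one, lt_self_iff_false, ↓reduceIte, neg_mul,
    one_mul, Nat.reduceAdd, even_two, Even.neg_pow, one_pow, Order.lt_one_iff]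
  ring

lemma mem_cocycle_one_iff {f : (Fin 1 → G) → ZMod p} :
    f ∈ Cocycle p G 1 ↔ ∀ g h, f (fun _ ↦ g * h) = f (fun _ ↦ g) + f (fun _ ↦ h) := by
  refine ⟨fun hf g h ↦ ?_, fun hf ↦ LinearMap.mem_ker.2 <| onSeq_injective <| funext fun v ↦ ?_⟩
  · have h_onSeq := congrFun (congrArg onSeq (LinearMap.mem_ker.1 hf)) (scons g fun _ ↦ h)
    rw [onSeq_coboundary_one] at h_onSeq
    change f (fun _ ↦ h) - f (fun _ ↦ g * h) + f (fun _ ↦ g) = 0 at h_onSeq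
    linear_combination -h_onSeq
  · rw [onSeq_coboundary_one, hf]
    change _ = (0 : ZMod p)
    ring

lemma represents_bockstein [NeZero p] (f : Cocycle p G 1) :
    Represents 2 (fun w ↦ ((carry (f.1 fun _ ↦ (w 0)⁻¹ * w 1) (f.1 fun _ ↦ (w 1)⁻¹ * w 2) : ℤ) :
      ZMod p)) (inDegree p G 2 (bockstein 1 (cls p G 1 f))) := by
  let E : (Fin 2 → G) → ℤ := fun v ↦ carry (f.1 fun _ ↦ v 0) (f.1 fun _ ↦ v 1)
  have hE : coboundary ℤ G 1 (lift f.1) = (p : ℤ) • E := by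
    refine onSeq_injective (funext fun v ↦ ?_)
    change _ = (p : ℤ) * carry (f.1 fun _ ↦ v 0) (f.1 fun _ ↦ v 1)
    rw [onSeq_coboundary_one, mul_carry, ← mem_cocycle_one_iff.1 f.2]
    simp only [lift, ZMod.natCast_val]
    ring
  rw [bockstein_cls f (reduce_lift f.1) hE]
  exact ⟨_, fun w ↦ rfl, rfl⟩

end Bockstein

/-! ### Invariant cochains and norms along an element -/

section Invariance

lemma dependsOn_comp {G M : Type*} {d : ℕ} {F : (ℕ → G) → M} (hF : DependsOn F (Set.Iio d))
    (f : G → G) : DependsOn (fun w ↦ F (f ∘ w)) (Set.Iio d) :=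
  fun _ _ h ↦ hF fun i hi ↦ congrArg f (h i hi)

namespace InvariantUnder

variable {G M : Type*} [Mul G] {S T : Set G}

lemma mono {F : (ℕ → G) → M} (hF : InvariantUnder T F) (h : S ⊆ T) : InvariantUnder S F :=
  fun g hg ↦ hF g (h hg)

lemma sub [AddGroup M] {F F' : (ℕ → G) → M} (hF : InvariantUnder S F)
    (hF' : InvariantUnder S F') : InvariantUnder S fun w ↦ F w - F' w :=
  fun g hg w ↦ congrArg₂ (· - ·) (hF g hg w) (hF' g hg w)

lemma neg [AddGroup M] {F : (ℕ → G) → M} (hF : InvariantUnder S F) :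
    InvariantUnder S fun w ↦ -F w :=
  fun g hg w ↦ congrArg Neg.neg (hF g hg w)

lemma altSum [AddCommGroup M] {F : (ℕ → G) → M} (hF : InvariantUnder S F) (d : ℕ) :
    InvariantUnder S (altSum d F) := fun g hg w ↦ by
  rw [altSum_comp, funext (hF g hg)]

lemma homogeneousCup {R : Type*} [CommRing R] [AddCommGroup M] [Module R M] {F : (ℕ → G) → R}
    {F' : (ℕ → G) → M} (hF : InvariantUnder S F) (hF' : InvariantUnder S F') (m : ℕ) :
    InvariantUnder S (homogeneousCup m F F') :=
  fun g hg w ↦ congrArg₂ (· • ·) (hF g hg w) (hF' g hg fun j ↦ w (m + j))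

end InvariantUnder

lemma homogeneousCup_comp {G H R M : Type*} [CommRing R] [AddCommGroup M] [Module R M] (m : ℕ)
    (F : (ℕ → H) → R) (F' : (ℕ → H) → M) (f : G → H) (w : ℕ → G) :
    homogeneousCup m F F' (f ∘ w) = F (f ∘ w) • F' (f ∘ fun j ↦ w (m + j)) := rfl

/-- The sum of the translates of `F` by `1, t, …, t ^ (n - 1)`; for `t` of order `n` this is the
norm of `F`. -/
def translateNorm {G M : Type*} [Monoid G] [AddCommMonoid M] (t : G) (n : ℕ) (F : (ℕ → G) → M) :
    (ℕ → G) → M :=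
  fun w ↦ ∑ j ∈ Finset.range n, F ((t ^ j * ·) ∘ w)

section TranslateNorm

variable {G M : Type*} [Monoid G] {t : G} {n : ℕ}

lemma mul_left_comp_comp (g h : G) (w : ℕ → G) :
    (g * ·) ∘ (h * ·) ∘ w = ((g * h) * ·) ∘ w :=
  funext fun i ↦ (mul_assoc g h (w i)).symm

lemma one_mul_comp (w : ℕ → G) : ((1 : G) * ·) ∘ w = w := funext fun i ↦ one_mul (w i)

lemma dependsOn_translateNorm [AddCommMonoid M] {d : ℕ} {F : (ℕ → G) → M}
    (hF : DependsOn F (Set.Iio d)) : DependsOn (translateNorm t n F) (Set.Iio d) :=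
  fun _ _ h ↦ Finset.sum_congr rfl fun _ _ ↦ dependsOn_comp hF _ h

variable [AddCommGroup M]

lemma translateNorm_comp_add (F : (ℕ → G) → M) (w : ℕ → G) :
    translateNorm t n F ((t * ·) ∘ w) + F w = translateNorm t (n + 1) F w := by
  simp only [translateNorm, mul_left_comp_comp, ← pow_succ, Finset.sum_range_succ', pow_zero,
    one_mul_comp]

lemma translateNorm_comp (ht : t ^ n = 1) (F : (ℕ → G) → M) (w : ℕ → G) :
    translateNorm t n F ((t * ·) ∘ w) = translateNorm t n F w := by
  rw [← add_left_inj (F w), translateNorm_comp_add, translateNorm, Finset.sum_range_succ, ht,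
    one_mul_comp]
  rfl

lemma translateNorm_sub (F F' : (ℕ → G) → M) (w : ℕ → G) :
    translateNorm t n (fun u ↦ F u - F' u) w = translateNorm t n F w - translateNorm t n F' w :=
  Finset.sum_sub_distrib _ _

lemma translateNorm_comp_sub (ht : t ^ n = 1) (F : (ℕ → G) → M) (w : ℕ → G) :
    translateNorm t n (fun u ↦ F ((t * ·) ∘ u) - F u) w = 0 := by
  rw [translateNorm_sub, sub_eq_zero, ← translateNorm_comp ht F]
  simp only [translateNorm, mul_left_comp_comp, ← pow_succ, ← pow_succ']

lemma altSum_translateNorm (d : ℕ) (F : (ℕ → G) → M) (w : ℕ → G) :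
    altSum d (translateNorm t n F) w = translateNorm t n (altSum d F) w := by
  unfold translateNorm
  simp only [altSum_sum, altSum_comp]

lemma translateNorm_of_invariant {F : (ℕ → G) → M} (hF : InvariantUnder Set.univ F)
    (w : ℕ → G) : translateNorm t n F w = n • F w := by
  rw [translateNorm, Finset.sum_congr rfl fun j _ ↦ hF (t ^ j) trivial w, Finset.sum_const,
    Finset.card_range]

lemma InvariantUnder.translateNorm {S : Set G} {F : (ℕ → G) → M} (hF : InvariantUnder S F)
    (ht : ∀ g, Commute t g) : InvariantUnder S (translateNorm t n F) := by
  refine fun g hg w ↦ Finset.sum_congr rfl fun j _ ↦ ?_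
  rw [← hF g hg ((t ^ j * ·) ∘ w), mul_left_comp_comp, mul_left_comp_comp,
    ((ht g).pow_left j).eq]

end TranslateNorm

end Invariance

/-! ### Cohomology of a group with a split central subgroup of order `p` -/

/-- A central element `t` of order `p` together with a character `x` with `x t = 1`; `ρ` is the
projection onto the kernel of `x` along `t`. -/
structure CentralSplitting (p : ℕ) (G : Type) [Group G] where
  x : G → ZMod p
  t : G
  ρ : G →* G
  x_mul : ∀ g h, x (g * h) = x g + x h
  t_comm : ∀ g, Commute t g
  t_pow : t ^ p = 1
  x_t : x t = 1
  eq_mul : ∀ g, g = ρ g * t ^ (x g).val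

namespace CentralSplitting

variable {p : ℕ} {G : Type} [Group G] (S : CentralSplitting p G)

/-- The set of elements of the kernel of the character. -/
def ker : Set G := {g | S.x g = 0}

lemma x_one : S.x 1 = 0 := by simpa using S.x_mul 1 1

lemma x_inv_mul (g h : G) : S.x (g⁻¹ * h) = S.x h - S.x g := by
  rw [eq_sub_iff_add_eq', ← S.x_mul, mul_inv_cancel_left]

lemma x_t_pow (n : ℕ) : S.x (S.t ^ n) = n := by
  induction n with
  | zero => simp [S.x_one]
  | succ n ih => rw [pow_succ, S.x_mul, ih, S.x_t, Nat.cast_succ]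

lemma x_ker_mul {g : G} (hg : g ∈ S.ker) (h : G) : S.x (g * h) = S.x h := by
  rw [S.x_mul, show S.x g = 0 from hg, zero_add]

lemma ρ_of_mem_ker {g : G} (hg : g ∈ S.ker) : S.ρ g = g := by
  have h_split := S.eq_mul g
  rw [show S.x g = 0 from hg, ZMod.val_zero, pow_zero, mul_one] at h_split
  exact h_split.symm

lemma ρ_t [Fact (1 < p)] : S.ρ S.t = 1 := by
  have h_split := S.eq_mul S.t
  rwa [S.x_t, ZMod.val_one, pow_one, eq_comm, mul_eq_right] at h_split

lemma ρ_mem_ker [NeZero p] (g : G) : S.ρ g ∈ S.ker := by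
  have h_split := congrArg S.x (S.eq_mul g)
  rw [S.x_mul, S.x_t_pow, ZMod.natCast_val, ZMod.cast_id] at h_split
  exact right_eq_add.1 h_split

lemma ρ_ρ [NeZero p] (g : G) : S.ρ (S.ρ g) = S.ρ g := S.ρ_of_mem_ker (S.ρ_mem_ker g)

section Invariance

lemma invariant_of_ker [NeZero p] {M : Type*} {F : (ℕ → G) → M} (hK : InvariantUnder S.ker F)
    (ht : ∀ w, F ((S.t * ·) ∘ w) = F w) : InvariantUnder Set.univ F := by
  have ht_pow : ∀ (n : ℕ) w, F ((S.t ^ n * ·) ∘ w) = F w := by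
    intro n
    induction n with
    | zero => intro w; rw [pow_zero, one_mul_comp]
    | succ n ih => intro w; rw [pow_succ', ← mul_left_comp_comp, ht, ih]
  intro g _ w
  rw [S.eq_mul g, ← mul_left_comp_comp, hK _ (S.ρ_mem_ker g), ht_pow]

lemma invariant_comp_ρ [NeZero p] {M : Type*} {F : (ℕ → G) → M} (hK : InvariantUnder S.ker F) :
    InvariantUnder Set.univ fun w ↦ F (S.ρ ∘ w) := fun g _ w ↦
  (congrArg F (funext fun i ↦ map_mul S.ρ g (w i))).trans (hK _ (S.ρ_mem_ker g) (S.ρ ∘ w))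

variable {M : Type*} [AddCommGroup M] {F : (ℕ → G) → M}

lemma invariant_prism (hK : InvariantUnder S.ker F) (m : ℕ) :
    InvariantUnder S.ker (prism S.ρ m F) := by
  intro g hg w
  rw [prism_translate, funext (hK g hg)]
  intro h
  rw [map_mul, S.ρ_of_mem_ker hg]

lemma invariant_translateNorm [NeZero p] (hK : InvariantUnder S.ker F) :
    InvariantUnder Set.univ (translateNorm S.t p F) :=
  S.invariant_of_ker (hK.translateNorm S.t_comm) (translateNorm_comp S.t_pow F)

variable [Fact (1 < p)]

lemma val_x_t_mul_of_lt {g : G} (hg : (S.x g).val + 1 < p) :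
    (S.x (S.t * g)).val = (S.x g).val + 1 := by
  rw [← ZMod.val_one p] at hg
  rw [S.x_mul, S.x_t, add_comm, ZMod.val_add_of_lt hg, ZMod.val_one]

lemma val_x_t_mul_of_eq {g : G} (hg : (S.x g).val + 1 = p) : (S.x (S.t * g)).val = 0 := by
  rw [ZMod.val_eq_zero, S.x_mul, S.x_t, add_comm, ← ZMod.natCast_zmod_val (S.x g)]
  exact_mod_cast (congrArg (Nat.cast : ℕ → ZMod p) hg).trans (ZMod.natCast_self p)

lemma exists_eq_translate_sub {d : ℕ} (hd : DependsOn F (Set.Iio (d + 1)))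
    (hK : InvariantUnder S.ker F) (hn : ∀ w, translateNorm S.t p F w = 0) :
    ∃ K : (ℕ → G) → M, DependsOn K (Set.Iio (d + 1)) ∧ InvariantUnder S.ker K ∧
      ∀ w, K ((S.t * ·) ∘ w) - K w = F w := by
  refine ⟨fun w ↦ -translateNorm S.t (p - (S.x (w 0)).val) F w, fun w w' h ↦ ?_, fun g hg w ↦ ?_,
    fun w ↦ ?_⟩
  · simp only [h 0 (Nat.succ_pos d), dependsOn_translateNorm hd h]
  · simp only [Function.comp_apply, S.x_ker_mul hg, hK.translateNorm S.t_comm g hg w]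
  · have h_val_lt := ZMod.val_lt (S.x (w 0))
    rcases Nat.lt_or_eq_of_le (Nat.succ_le_of_lt h_val_lt) with h_lt | h_eq
    · have h_sub : p - (S.x (w 0)).val = p - ((S.x (w 0)).val + 1) + 1 := by omega
      simp only [Function.comp_apply, S.val_x_t_mul_of_lt h_lt, h_sub, ← translateNorm_comp_add]
      abel
    · have h_sub : p - (S.x (w 0)).val = 1 := by omega
      simp only [Function.comp_apply, S.val_x_t_mul_of_eq h_eq, h_sub, Nat.sub_zero, hn]
      rw [translateNorm, Finset.sum_range_one, pow_zero, one_mul_comp, neg_zero, zero_sub, neg_neg]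

end Invariance

/-- The character of the splitting as a cocycle. -/
def charCocycle : Cocycle p G 1 := ⟨fun v ↦ S.x (v 0), mem_cocycle_one_iff.2 S.x_mul⟩

/-- The class of the character in `H¹`. -/
def charClass : HStar p G := inDegree p G 1 (cls p G 1 S.charCocycle)

/-- The Bockstein in `H²` of the class of the character. -/
def bocksteinClass [NeZero p] : HStar p G :=
  inDegree p G 2 (bockstein 1 (cls p G 1 S.charCocycle))

lemma represents_charClass : Represents 1 (fun w ↦ S.x ((w 0)⁻¹ * w 1)) S.charClass :=
  represents_cls S.charCocycle

/-- The homogeneous Bockstein cocycle of the character. -/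
def bocksteinCochain (w : ℕ → G) : ZMod p :=
  (carry (S.x ((w 0)⁻¹ * w 1)) (S.x ((w 1)⁻¹ * w 2)) : ℤ)

lemma represents_bocksteinClass [NeZero p] :
    Represents 2 S.bocksteinCochain S.bocksteinClass :=
  represents_bockstein S.charCocycle

/-- The cochain `w ↦ x (w 0)`, whose coboundary is the homogeneous cocycle of the character. It is
invariant under the kernel of the character only. -/
def charCochain (w : ℕ → G) : ZMod p := S.x (w 0)

/-- A cochain invariant under the kernel of the character whose coboundary is the Bockstein
cocycle. -/
def carryCochain (w : ℕ → G) : ZMod p := (carry (S.x (w 0)) (S.x ((w 0)⁻¹ * w 1)) : ℤ)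

/-- The carry of `1 + x (w 0)`: the indicator of `x (w 0) = -1`. Its coboundary measures how far
`carryCochain` is from being invariant under `t`. -/
def wrapCochain (w : ℕ → G) : ZMod p := (carry 1 (S.x (w 0)) : ℤ)

lemma dependsOn_charCochain : DependsOn S.charCochain (Set.Iio 1) := fun w w' h ↦ by
  rw [charCochain, charCochain, h 0 Nat.one_pos]

lemma dependsOn_wrapCochain : DependsOn S.wrapCochain (Set.Iio 1) := fun w w' h ↦ by
  rw [wrapCochain, wrapCochain, h 0 Nat.one_pos]

lemma dependsOn_carryCochain : DependsOn S.carryCochain (Set.Iio 2) := fun w w' h ↦ by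
  rw [carryCochain, carryCochain, h 0 Nat.two_pos, h 1 Nat.one_lt_two]

lemma invariant_charCochain : InvariantUnder S.ker S.charCochain :=
  fun _ hg w ↦ S.x_ker_mul hg (w 0)

lemma invariant_wrapCochain : InvariantUnder S.ker S.wrapCochain := fun g hg w ↦ by
  simp only [wrapCochain, Function.comp_apply, S.x_ker_mul hg]

lemma invariant_carryCochain : InvariantUnder S.ker S.carryCochain := fun g hg w ↦ by
  simp only [carryCochain, Function.comp_apply, S.x_ker_mul hg, S.x_inv_mul]

lemma charCochain_translate (w : ℕ → G) :
    S.charCochain ((S.t * ·) ∘ w) = 1 + S.charCochain w := by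
  rw [charCochain, Function.comp_apply, S.x_mul, S.x_t, charCochain]

lemma altSum_charCochain (w : ℕ → G) : altSum 2 S.charCochain w = S.x ((w 0)⁻¹ * w 1) := by
  simp [altSum, charCochain, S.x_inv_mul]

lemma altSum_carryCochain [NeZero p] (w : ℕ → G) :
    altSum 3 S.carryCochain w = S.bocksteinCochain w := by
  have h_carry := congrArg (Int.cast : ℤ → ZMod p)
    (carry_cocycle (S.x (w 0)) (S.x ((w 0)⁻¹ * w 1)) (S.x ((w 1)⁻¹ * w 2)))
  simp only [S.x_inv_mul, add_sub_cancel, sub_add_sub_cancel'] at h_carry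
  push_cast at h_carry
  simp only [altSum, carryCochain, bocksteinCochain, S.x_inv_mul, scons_zero, stail_apply,
    scons_succ]
  linear_combination -h_carry

lemma carryCochain_translate_sub [NeZero p] (w : ℕ → G) :
    S.carryCochain ((S.t * ·) ∘ w) - S.carryCochain w = altSum 2 S.wrapCochain w := by
  have h_carry := congrArg (Int.cast : ℤ → ZMod p)
    (carry_cocycle 1 (S.x (w 0)) (S.x ((w 0)⁻¹ * w 1)))
  simp only [S.x_inv_mul, add_sub_cancel] at h_carry
  push_cast at h_carry
  simp only [altSum, carryCochain, wrapCochain, S.x_inv_mul, S.x_mul, S.x_t, scons_zero,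
    stail_apply, Function.comp_apply, add_sub_add_left_eq_sub, sub_zero]
  linear_combination -h_carry

lemma sum_carry_one [Fact (1 < p)] (a : ZMod p) :
    ∑ j ∈ Finset.range p, carry 1 ((j : ZMod p) + a) = 1 := by
  refine mul_left_cancel₀ (Int.natCast_ne_zero.2 (NeZero.ne p)) ?_
  have h_telescope : ∀ j : ℕ, (p : ℤ) * carry 1 ((j : ZMod p) + a) =
      1 - ((((j + 1 : ℕ) : ZMod p) + a).val - ((j : ZMod p) + a).val : ℤ) := by
    intro j
    rw [mul_carry, ZMod.val_one, ← add_assoc, add_comm 1 (j : ZMod p), ← Nat.cast_succ]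
    push_cast
    ring
  rw [Finset.mul_sum, Finset.sum_congr rfl fun j _ ↦ h_telescope j, Finset.sum_sub_distrib,
    Finset.sum_range_sub fun j : ℕ ↦ (((j : ZMod p) + a).val : ℤ)]
  simp

lemma translateNorm_wrapCochain [Fact (1 < p)] (w : ℕ → G) :
    translateNorm S.t p S.wrapCochain w = 1 := by
  simp only [translateNorm, wrapCochain, Function.comp_apply, S.x_mul, S.x_t_pow]
  exact_mod_cast congrArg (Int.cast : ℤ → ZMod p) (sum_carry_one (S.x (w 0)))

lemma translateNorm_cup_of_invariant {m : ℕ} {F F' : (ℕ → G) → ZMod p}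
    (hF' : InvariantUnder Set.univ F') (t : G) (n : ℕ) (w : ℕ → G) :
    translateNorm t n (homogeneousCup m F F') w =
      homogeneousCup m (translateNorm t n F) F' w := by
  simp only [translateNorm, homogeneousCup, Finset.sum_smul]
  exact Finset.sum_congr rfl fun j _ ↦
    congrArg (F ((t ^ j * ·) ∘ w) • ·) (hF' (t ^ j) trivial fun i ↦ w (m + i))

section Correction

variable [Fact (1 < p)] {m : ℕ}

/-- `wrapCochain` has norm `1`, so that `F` and its cup product with the norm of `F` have the same
norm. -/
lemma exists_translate_sub_eq_sub_cup_norm {F : (ℕ → G) → ZMod p}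
    (hd : DependsOn F (Set.Iio (m + 1))) (hK : InvariantUnder S.ker F) :
    ∃ K : (ℕ → G) → ZMod p, DependsOn K (Set.Iio (m + 1)) ∧ InvariantUnder S.ker K ∧
      ∀ w, K ((S.t * ·) ∘ w) - K w =
        F w - homogeneousCup 0 S.wrapCochain (translateNorm S.t p F) w := by
  have h_norm_inv := S.invariant_translateNorm hK
  have h_cup_dependsOn := dependsOn_homogeneousCup S.dependsOn_wrapCochain
    (dependsOn_translateNorm (t := S.t) (n := p) hd)
  rw [zero_add] at h_cup_dependsOn
  refine S.exists_eq_translate_sub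
    (fun _ _ h ↦ congrArg₂ (· - ·) (hd h) (h_cup_dependsOn h))
    (hK.sub (S.invariant_wrapCochain.homogeneousCup (h_norm_inv.mono (Set.subset_univ _)) 0))
    fun w ↦ ?_
  rw [translateNorm_sub, translateNorm_cup_of_invariant h_norm_inv, homogeneousCup,
    S.translateNorm_wrapCochain, one_smul, sub_eq_zero]
  simp only [zero_add]

/-- Under `t`, the cochain `s ∪ x` varies by `s`, and `carryCochain ∪ N` with `N` the norm of `F`
varies by the coboundary of `wrapCochain ∪ N`, which differs from `F` by the variation of `K`. -/
lemma exists_invariant_correction {a s F : (ℕ → G) → ZMod p}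
    (haK : InvariantUnder S.ker a) (hs_inv : InvariantUnder Set.univ s)
    (hF : DependsOn F (Set.Iio (m + 1))) (hFK : InvariantUnder S.ker F)
    (hδ : ∀ w, altSum (m + 2) (translateNorm S.t p F) w = 0)
    (ht : ∀ w, a ((S.t * ·) ∘ w) - a w = s w + altSum (m + 2) F w) :
    ∃ K : (ℕ → G) → ZMod p, DependsOn K (Set.Iio (m + 1)) ∧
      InvariantUnder Set.univ fun w ↦ a w - homogeneousCup (m + 1) s S.charCochain w -
        homogeneousCup 1 S.carryCochain (translateNorm S.t p F) w - altSum (m + 2) K w := by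
  obtain ⟨K, hK_dep, hK_inv, hK_translate⟩ := S.exists_translate_sub_eq_sub_cup_norm hF hFK
  have hv_inv := S.invariant_translateNorm hFK
  refine ⟨K, hK_dep, S.invariant_of_ker ?_ fun w ↦ ?_⟩
  · have h_cup_char :=
      (hs_inv.mono (Set.subset_univ S.ker)).homogeneousCup S.invariant_charCochain (m + 1)
    have h_cup_carry :=
      S.invariant_carryCochain.homogeneousCup (hv_inv.mono (Set.subset_univ S.ker)) 1
    exact ((haK.sub h_cup_char).sub h_cup_carry).sub (hK_inv.altSum _)
  · have h_cup_char : homogeneousCup (m + 1) s S.charCochain ((S.t * ·) ∘ w) =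
        s w + homogeneousCup (m + 1) s S.charCochain w := by
      have h_char := S.charCochain_translate fun j ↦ w (m + 1 + j)
      rw [homogeneousCup_comp, hs_inv S.t trivial w, homogeneousCup, smul_eq_mul, smul_eq_mul]
      linear_combination s w * h_char
    have h_cup_carry :
        homogeneousCup 1 S.carryCochain (translateNorm S.t p F) ((S.t * ·) ∘ w) =
          homogeneousCup 1 S.carryCochain (translateNorm S.t p F) w +
            altSum 2 S.wrapCochain w * translateNorm S.t p F fun j ↦ w (1 + j) := by
      have h_v := hv_inv S.t trivial fun j ↦ w (1 + j)
      rw [homogeneousCup_comp, homogeneousCup, smul_eq_mul, smul_eq_mul,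
        ← S.carryCochain_translate_sub]
      linear_combination S.carryCochain ((S.t * ·) ∘ w) * h_v
    have h_altSum_K : altSum (m + 2) K ((S.t * ·) ∘ w) = altSum (m + 2) K w +
        altSum (m + 2) F w -
          altSum 2 S.wrapCochain w * translateNorm S.t p F fun j ↦ w (1 + j) := by
      have h_cup := altSum_homogeneousCup 0 m (translateNorm S.t p F) S.dependsOn_wrapCochain w
      simp only [zero_add, hδ, smul_eq_mul, mul_zero, add_zero] at h_cup
      rw [add_sub_assoc, ← h_cup, ← altSum_sub, ← sub_eq_iff_eq_add', altSum_comp, ← altSum_sub]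
      simp only [hK_translate]
    rw [h_cup_char, h_cup_carry, h_altSum_K]
    linear_combination ht w

end Correction

variable {m : ℕ}

lemma altSum_translate_sub {F U : (ℕ → G) → ZMod p} {d : ℕ} [Fact (1 < p)]
    (hU : InvariantUnder Set.univ U) (hF : ∀ w, altSum d F w = U (S.ρ ∘ w) - U w) (w : ℕ → G) :
    altSum d (fun u ↦ F ((S.t * ·) ∘ u) - F u) w = 0 := by
  have hρ : S.ρ ∘ (S.t * ·) ∘ w = S.ρ ∘ w := funext fun i ↦ by simp [S.ρ_t]
  rw [altSum_sub, ← altSum_comp, hF, hF, hρ, hU S.t trivial, sub_self]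

lemma exists_invariant_add_coboundary [NeZero p] {b : (ℕ → G) → ZMod p}
    (hd : DependsOn b (Set.Iio (m + 2))) (hK : InvariantUnder S.ker b)
    (hδ : ∀ w, altSum (m + 3) b w = 0) (hn : ∀ w, translateNorm S.t p b w = 0) :
    ∃ F : (ℕ → G) → ZMod p, DependsOn F (Set.Iio (m + 1)) ∧ InvariantUnder S.ker F ∧
      (∀ w, b w = b (S.ρ ∘ w) + altSum (m + 2) F w) ∧
      ∀ w, altSum (m + 2) (translateNorm S.t p F) w = 0 := by
  have h_altSum_F : ∀ w, altSum (m + 2) (fun w ↦ -prism S.ρ (m + 1) b w) w =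
      b w - b (S.ρ ∘ w) := fun w ↦ by
    rw [altSum_neg, altSum_prism_of_altSum_eq_zero S.ρ hd hδ, neg_sub]
  refine ⟨fun w ↦ -prism S.ρ (m + 1) b w, fun w w' h ↦ congrArg Neg.neg (dependsOn_prism S.ρ hd h),
    (S.invariant_prism hK _).neg, fun w ↦ ?_, fun w ↦ ?_⟩
  · rw [h_altSum_F, add_sub_cancel]
  · rw [altSum_translateNorm, funext h_altSum_F, translateNorm_sub, hn,
      translateNorm_of_invariant (S.invariant_comp_ρ hK), nsmul_eq_mul, ZMod.natCast_self,
      zero_mul, sub_zero]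

lemma altSum_correction [NeZero p] {a s v K : (ℕ → G) → ZMod p}
    (hs : DependsOn s (Set.Iio (m + 2))) (hsδ : ∀ w, altSum (m + 3) s w = 0)
    (hvδ : ∀ w, altSum (m + 2) v w = 0) (w : ℕ → G) :
    altSum (m + 3) (fun w ↦ a w - homogeneousCup (m + 1) s S.charCochain w -
        homogeneousCup 1 S.carryCochain v w - altSum (m + 2) K w) w =
      altSum (m + 3) a w -
        (-1) ^ (m + 1) * homogeneousCup (m + 1) s (fun w ↦ S.x ((w 0)⁻¹ * w 1)) w -
        homogeneousCup 2 S.bocksteinCochain v w := by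
  have h_char : altSum (m + 3) (homogeneousCup (m + 1) s S.charCochain) w =
      (-1) ^ (m + 1) * homogeneousCup (m + 1) s (fun w ↦ S.x ((w 0)⁻¹ * w 1)) w := by
    rw [altSum_homogeneousCup_of_altSum_eq_zero 0 S.charCochain hs hsδ w, S.altSum_charCochain]
    rfl
  have h_carry : altSum (m + 3) (homogeneousCup 1 S.carryCochain v) w =
      homogeneousCup 2 S.bocksteinCochain v w := by
    have h_cup := altSum_homogeneousCup 1 m v S.dependsOn_carryCochain w
    rwa [hvδ, smul_zero, smul_zero, add_zero, S.altSum_carryCochain,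
      show 1 + m + 2 = m + 3 by ring] at h_cup
  rw [altSum_sub, altSum_sub, altSum_sub, altSum_altSum, sub_zero, h_char, h_carry]

variable [Fact (1 < p)]

lemma exists_invariant_homotopy {U : (ℕ → G) → ZMod p} (hd : DependsOn U (Set.Iio (m + 3)))
    (hU : InvariantUnder Set.univ U) (hδ : ∀ w, altSum (m + 4) U w = 0) :
    ∃ b v κ : (ℕ → G) → ZMod p,
      (DependsOn b (Set.Iio (m + 2)) ∧ InvariantUnder S.ker b ∧ ∀ w, altSum (m + 3) b w = 0) ∧
      (DependsOn v (Set.Iio (m + 1)) ∧ InvariantUnder Set.univ v ∧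
        ∀ w, altSum (m + 2) v w = 0) ∧
      DependsOn κ (Set.Iio (m + 2)) ∧ InvariantUnder Set.univ κ ∧
      ∀ w, altSum (m + 3) κ w = U (S.ρ ∘ w) - U w -
        (-1) ^ (m + 1) * homogeneousCup (m + 1) (fun w ↦ b (S.ρ ∘ w))
          (fun w ↦ S.x ((w 0)⁻¹ * w 1)) w - homogeneousCup 2 S.bocksteinCochain v w := by
  set a : (ℕ → G) → ZMod p := prism S.ρ (m + 2) U
  have ha : DependsOn a (Set.Iio (m + 2)) := dependsOn_prism S.ρ hd
  have haK : InvariantUnder S.ker a := S.invariant_prism (hU.mono (Set.subset_univ _)) _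
  have haδ := altSum_prism_of_altSum_eq_zero S.ρ hd hδ
  set b : (ℕ → G) → ZMod p := fun w ↦ a ((S.t * ·) ∘ w) - a w
  have hb : DependsOn b (Set.Iio (m + 2)) :=
    fun _ _ h ↦ congrArg₂ (· - ·) (dependsOn_comp ha _ h) (ha h)
  have hbK : InvariantUnder S.ker b := by
    refine InvariantUnder.sub (fun g hg w ↦ ?_) haK
    rw [mul_left_comp_comp, (S.t_comm g).eq, ← mul_left_comp_comp, haK g hg]
  have hbδ := S.altSum_translate_sub hU haδ
  have hs : DependsOn (fun w ↦ b (S.ρ ∘ w)) (Set.Iio (m + 2)) := dependsOn_comp hb _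
  have hsδ : ∀ w, altSum (m + 3) (fun w ↦ b (S.ρ ∘ w)) w = 0 := fun w ↦ by
    rw [← altSum_comp, hbδ]
  obtain ⟨F, hF, hFK, hbF, hvδ⟩ := S.exists_invariant_add_coboundary hb hbK hbδ
    (translateNorm_comp_sub S.t_pow a)
  obtain ⟨K, hK, hκ⟩ := S.exists_invariant_correction haK (S.invariant_comp_ρ hbK) hF hFK hvδ hbF
  refine ⟨b, _, _, ⟨hb, hbK, hbδ⟩,
    ⟨dependsOn_translateNorm hF, S.invariant_translateNorm hFK, hvδ⟩,
    fun w w' h ↦ ?_, hκ, fun w ↦ ?_⟩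
  · have h_char := dependsOn_homogeneousCup hs S.dependsOn_charCochain h
    have h_carry := dependsOn_homogeneousCup (m := 1) S.dependsOn_carryCochain
      (dependsOn_translateNorm (t := S.t) (n := p) hF) fun i hi ↦
        h i (by rwa [add_comm 1 m] at hi)
    simp only [ha h, h_char, h_carry, dependsOn_altSum hK h]
  · rw [S.altSum_correction hs hsδ hvδ, haδ]

theorem exists_eq_res_add_mul_charClass_add {u : HStar p G}
    (hu : u ∈ LinearMap.range (inDegree p G (m + 2))) :
    ∃ s ∈ LinearMap.range (inDegree p G (m + 1)), ∃ v ∈ LinearMap.range (inDegree p G m),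
      u = res p S.ρ u + res p S.ρ s * S.charClass + S.bocksteinClass * v := by
  obtain ⟨U, hU⟩ := exists_represents_of_mem_range hu
  obtain ⟨b, v, κ, ⟨hb, hbK, hbδ⟩, ⟨hv, hv_inv, hvδ⟩, hκ, hκ_inv, hκδ⟩ :=
    S.exists_invariant_homotopy hU.dependsOn hU.invariant hU.altSum_eq_zero
  obtain ⟨s', hs'⟩ := exists_represents (dependsOn_comp hb S.ρ) (S.invariant_comp_ρ hbK)
    fun w ↦ by rw [← altSum_comp, hbδ]
  obtain ⟨v', hv'⟩ := exists_represents hv hv_inv hvδ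
  have h_ρ_ρ : ∀ w : ℕ → G, S.ρ ∘ S.ρ ∘ w = S.ρ ∘ w := fun w ↦ funext fun i ↦ S.ρ_ρ (w i)
  have h_res_s : res p S.ρ s' = s' :=
    (hs'.res S.ρ).unique (by simpa only [h_ρ_ρ] using hs')
  have h_zero := ((((hU.res S.ρ).sub hU).sub ((hs'.mul S.represents_charClass).smul
    ((-1) ^ (m + 1)))).sub (show Represents (m + 2) _ _ from
      add_comm 2 m ▸ S.represents_bocksteinClass.mul hv')).eq_zero_of_eq_altSum hκ hκ_inv
      fun w ↦ (hκδ w).symm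
  refine ⟨-((-1 : ZMod p) ^ (m + 1) • s'), neg_mem (Submodule.smul_mem _ _ hs'.mem_range), -v',
    neg_mem hv'.mem_range, ?_⟩
  rw [map_neg, map_smul, h_res_s, neg_mul, smul_mul_assoc, mul_neg, ← sub_eq_zero, ← neg_eq_zero,
    ← h_zero]
  abel

end CentralSplitting

/-! ### The ordered chain complex on words -/

section Words

variable (k : Type*) [CommRing k] {V : Type*}

/-- The linear map on chains of words that prepends the letter `v`. -/
def prepend (v : V) : (List V →₀ k) →ₗ[k] (List V →₀ k) := Finsupp.lmapDomain k k (List.cons v)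

@[simp] lemma prepend_single (v : V) (w : List V) (r : k) :
    prepend k v (Finsupp.single w r) = Finsupp.single (v :: w) r := by
  simp [prepend, Finsupp.lmapDomain]

/-- The boundary of a word: the alternating sum of the words obtained by deleting a letter. -/
def wordBoundary : List V → (List V →₀ k)
  | [] => 0
  | v :: w => Finsupp.single w 1 - prepend k v (wordBoundary w)

/-- The boundary map of the augmented ordered chain complex on the letters `V`. A word of length `d`
has degree `d`, so that the empty word spans the augmentation. -/
def boundary : (List V →₀ k) →ₗ[k] (List V →₀ k) := Finsupp.linearCombination k (wordBoundary k)

lemma boundary_single (w : List V) : boundary k (Finsupp.single w 1) = wordBoundary k w := by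
  simp [boundary]

lemma boundary_single_nil : boundary k (Finsupp.single ([] : List V) 1) = 0 :=
  boundary_single k []

@[simp] lemma boundary_prepend (v : V) (x : List V →₀ k) :
    boundary k (prepend k v x) = x - prepend k v (boundary k x) := by
  suffices h : boundary k ∘ₗ prepend k v = LinearMap.id - prepend k v ∘ₗ boundary k from
    LinearMap.congr_fun h x
  ext w : 2
  simp [boundary_single, wordBoundary]

lemma boundary_wordBoundary (w : List V) : boundary k (wordBoundary k w) = 0 := by
  induction w with
  | nil => exact map_zero _
  | cons v w ih =>
    rw [wordBoundary, map_sub, boundary_prepend, boundary_single, ih, map_zero, sub_zero, sub_self]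

lemma boundary_boundary (x : List V →₀ k) : boundary k (boundary k x) = 0 := by
  suffices h : boundary k ∘ₗ boundary k = (0 : (List V →₀ k) →ₗ[k] _) from LinearMap.congr_fun h x
  ext w : 2
  simp [boundary_single, boundary_wordBoundary]

/-- The chains supported on the words of length `d` of a language. -/
def chains (L : Set (List V)) (d : ℕ) : Submodule k (List V →₀ k) :=
  Finsupp.supported k k {w | w ∈ L ∧ w.length = d}

variable {k} {L L' X Y : Set (List V)} {d : ℕ} {x : List V →₀ k}

lemma single_mem_chains {w : List V} (h : w ∈ L) (r : k) :
    Finsupp.single w r ∈ chains k L w.length :=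
  Finsupp.single_mem_supported k r ⟨h, rfl⟩

lemma chains_mono (h : L ⊆ L') (d : ℕ) : chains k L d ≤ chains k L' d :=
  Finsupp.supported_mono fun _ hw ↦ ⟨h hw.1, hw.2⟩

lemma map_mem_of_mem_chains {N : Type*} [AddCommGroup N] [Module k N]
    (f : (List V →₀ k) →ₗ[k] N) (Q : Submodule k N)
    (h : ∀ w ∈ L, w.length = d → f (Finsupp.single w 1) ∈ Q) (hx : x ∈ chains k L d) : f x ∈ Q := by
  rw [chains, Finsupp.supported_eq_span_single] at hx
  suffices h_le : Submodule.span k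
      ((fun w ↦ Finsupp.single w (1 : k)) '' {w | w ∈ L ∧ w.length = d}) ≤ Q.comap f from h_le hx
  rw [Submodule.span_le]
  rintro _ ⟨w, hw, rfl⟩
  exact h w hw.1 hw.2

lemma prepend_mem_chains {v : V} (h : ∀ w ∈ L, v :: w ∈ L') (hx : x ∈ chains k L d) :
    prepend k v x ∈ chains k L' (d + 1) := by
  refine map_mem_of_mem_chains (prepend k v) _ (fun w hw hd ↦ ?_) hx
  rw [prepend_single, ← hd]
  exact single_mem_chains (h w hw) 1

/-- A language is closed under subwords if it contains the subwords of its words; its chains then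
form a subcomplex. -/
def SubwordClosed (L : Set (List V)) : Prop := ∀ w ∈ L, ∀ w', w'.Sublist w → w' ∈ L

lemma wordBoundary_mem_chains (hL : SubwordClosed L) {w : List V} (hw : w ∈ L)
    (hd : w.length = d + 1) : wordBoundary k w ∈ chains k L d := by
  induction w generalizing L d with
  | nil => simp at hd
  | cons v w ih =>
    obtain rfl : w.length = d := by simpa using hd
    refine sub_mem (single_mem_chains (hL _ hw _ (List.sublist_cons_self _ _)) 1) ?_
    cases w with
    | nil => simp [wordBoundary]
    | cons u w =>
      refine prepend_mem_chains (L := {w' | v :: w' ∈ L}) (fun _ h ↦ h) (ih ?_ hw rfl)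
      exact fun w₁ h₁ w₂ h₂ ↦ hL _ h₁ _ (List.Sublist.cons_cons v h₂)

lemma SubwordClosed.boundary_mem (hL : SubwordClosed L) (hx : x ∈ chains k L (d + 1)) :
    boundary k x ∈ chains k L d := by
  refine map_mem_of_mem_chains (boundary k) _ (fun w hw hd ↦ ?_) hx
  rw [boundary_single]
  exact wordBoundary_mem_chains hL hw hd

lemma boundary_eq_zero_of_mem_chains_zero (hx : x ∈ chains k L 0) : boundary k x = 0 := by
  refine (Submodule.mem_bot k).1 (map_mem_of_mem_chains (boundary k) ⊥ (fun w _ hd ↦ ?_) hx)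
  rw [List.length_eq_zero_iff.1 hd, boundary_single_nil]
  exact zero_mem _

lemma exists_add_of_mem_chains_union (hx : x ∈ chains k (X ∪ Y) d) :
    ∃ a ∈ chains k X d, ∃ b ∈ chains k Y d, a + b = x := by
  rw [← Submodule.mem_sup, chains, chains, ← Finsupp.supported_union]
  exact Finsupp.supported_mono (fun w hw ↦ hw.1.imp (⟨·, hw.2⟩) (⟨·, hw.2⟩)) hx

lemma mem_chains_inter (hX : x ∈ chains k X d) (hY : x ∈ chains k Y d) :
    x ∈ chains k (X ∩ Y) d := by
  rw [chains, Finsupp.mem_supported] at *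
  exact fun w hw ↦ ⟨⟨(hX hw).1, (hY hw).1⟩, (hX hw).2⟩

variable (k) in
/-- Exactness of the chains of a language in degree `d`: every cycle is a boundary. -/
def ExactAt (L : Set (List V)) (d : ℕ) : Prop :=
  ∀ x ∈ chains k L d, boundary k x = 0 → ∃ y ∈ chains k L (d + 1), boundary k y = x

/-- The language has the reduced homology of a sphere up to degree `d`, the top homology being
spanned by the fundamental cycle `z`. -/
structure Spherical (L : Set (List V)) (d : ℕ) (z : List V →₀ k) : Prop where
  mem : z ∈ chains k L d
  cycle : boundary k z = 0
  exactAt : ∀ e < d, ExactAt k L e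
  top : ∀ x ∈ chains k L d, boundary k x = 0 →
    ∃ r : k, ∃ y ∈ chains k L (d + 1), x = r • z + boundary k y

lemma exactAt_of_forall_cons_mem (v : V) (h : ∀ w ∈ L, v :: w ∈ L) (d : ℕ) : ExactAt k L d :=
  fun x hx hx0 ↦
    ⟨prepend k v x, prepend_mem_chains h hx, by rw [boundary_prepend, hx0, map_zero, sub_zero]⟩

end Words

/-! ### The Mayer–Vietoris argument -/

section MayerVietoris

variable {k : Type*} [CommRing k] {V : Type*} {X Y : Set (List V)} {d : ℕ}

lemma add_mem_chains_union {a b : List V →₀ k} (ha : a ∈ chains k X d) (hb : b ∈ chains k Y d) :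
    a + b ∈ chains k (X ∪ Y) d :=
  add_mem (chains_mono Set.subset_union_left _ ha) (chains_mono Set.subset_union_right _ hb)

lemma exactAt_union_zero (hX : ExactAt k X 0) (hY : ExactAt k Y 0) : ExactAt k (X ∪ Y) 0 := by
  intro x hx _
  obtain ⟨a, ha, b, hb, rfl⟩ := exists_add_of_mem_chains_union hx
  obtain ⟨a', ha', rfl⟩ := hX a ha (boundary_eq_zero_of_mem_chains_zero ha)
  obtain ⟨b', hb', rfl⟩ := hY b hb (boundary_eq_zero_of_mem_chains_zero hb)
  exact ⟨a' + b', add_mem_chains_union ha' hb', map_add _ _ _⟩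

lemma boundary_mem_chains_inter (hX : SubwordClosed X) (hY : SubwordClosed Y) {a b : List V →₀ k}
    (ha : a ∈ chains k X (d + 1)) (hb : b ∈ chains k Y (d + 1)) (h : boundary k (a + b) = 0) :
    boundary k a ∈ chains k (X ∩ Y) d := by
  refine mem_chains_inter (hX.boundary_mem ha) ?_
  rw [map_add, add_eq_zero_iff_eq_neg] at h
  rw [h]
  exact neg_mem (hY.boundary_mem hb)

/-- If the boundary of the `X`-part `a` of a cycle `a + b` is bounded by `c` in `X ∩ Y`, then
`a - c` and `b + c` are cycles in `X` and in `Y`. -/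
lemma exists_boundary_eq_add_of_union (hX : ExactAt k X d) (hY : ExactAt k Y d)
    {a b c : List V →₀ k} (ha : a ∈ chains k X d) (hb : b ∈ chains k Y d)
    (hc : c ∈ chains k (X ∩ Y) d) (hca : boundary k c = boundary k a)
    (h : boundary k (a + b) = 0) : ∃ y ∈ chains k (X ∪ Y) (d + 1), boundary k y = a + b := by
  obtain ⟨a', ha', haa'⟩ := hX (a - c) (sub_mem ha (chains_mono Set.inter_subset_left _ hc))
    (by rw [map_sub, hca, sub_self])
  obtain ⟨b', hb', hbb'⟩ := hY (b + c) (add_mem hb (chains_mono Set.inter_subset_right _ hc))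
    (by rw [map_add, hca, add_comm, ← map_add, h])
  exact ⟨a' + b', add_mem_chains_union ha' hb', by rw [map_add, haa', hbb']; abel⟩

lemma exactAt_union_succ (cX : SubwordClosed X) (cY : SubwordClosed Y)
    (hX : ExactAt k X (d + 1)) (hY : ExactAt k Y (d + 1)) (hXY : ExactAt k (X ∩ Y) d) :
    ExactAt k (X ∪ Y) (d + 1) := by
  intro x hx hx0
  obtain ⟨a, ha, b, hb, rfl⟩ := exists_add_of_mem_chains_union hx
  obtain ⟨c, hc, hca⟩ :=
    hXY _ (boundary_mem_chains_inter cX cY ha hb hx0) (boundary_boundary k a)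
  exact exists_boundary_eq_add_of_union hX hY ha hb hc hca hx0

lemma exactAt_union (cX : SubwordClosed X) (cY : SubwordClosed Y) (hX : ∀ d, ExactAt k X d)
    (hY : ∀ d, ExactAt k Y d) (hXY : ∀ d, ExactAt k (X ∩ Y) d) (d : ℕ) :
    ExactAt k (X ∪ Y) d := by
  cases d with
  | zero => exact exactAt_union_zero (hX 0) (hY 0)
  | succ d => exact exactAt_union_succ cX cY (hX _) (hY _) (hXY d)

lemma spherical_union (cX : SubwordClosed X) (cY : SubwordClosed Y) {z : List V →₀ k}
    (hX : ∀ d, ExactAt k X d) (hY : ∀ d, ExactAt k Y d) (hXY : Spherical (X ∩ Y) d z)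
    {a b : List V →₀ k} (ha : a ∈ chains k X (d + 1)) (hb : b ∈ chains k Y (d + 1))
    (haz : boundary k a = z) (hbz : boundary k b = -z) : Spherical (X ∪ Y) (d + 1) (a + b) where
  mem := add_mem_chains_union ha hb
  cycle := by rw [map_add, haz, hbz, add_neg_cancel]
  exactAt e he := by
    cases e with
    | zero => exact exactAt_union_zero (hX 0) (hY 0)
    | succ e => exact exactAt_union_succ cX cY (hX _) (hY _) (hXY.exactAt e (by omega))
  top x hx hx0 := by
    obtain ⟨u, hu, v, hv, rfl⟩ := exists_add_of_mem_chains_union hx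
    obtain ⟨r, c, hc, hcu⟩ :=
      hXY.top _ (boundary_mem_chains_inter cX cY hu hv hx0) (boundary_boundary k u)
    obtain ⟨y, hy, hyuv⟩ := exists_boundary_eq_add_of_union (hX _) (hY _)
      (sub_mem hu (Submodule.smul_mem _ r ha)) (sub_mem hv (Submodule.smul_mem _ r hb)) hc
      (by rw [map_sub, map_smul, haz, hcu, add_sub_cancel_left])
      (by rw [sub_add_sub_comm, ← smul_add, map_sub, hx0, map_smul, map_add, haz, hbz,
        add_neg_cancel, smul_zero, sub_zero])
    refine ⟨r, y, hy, ?_⟩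
    rw [hyuv, smul_add]
    abel

end MayerVietoris

/-! ### Maps of letters -/

section MapLetters

variable (k : Type*) [CommRing k] {V : Type*}

/-- The linear map on chains of words induced by a map of letters. -/
def mapLetters (σ : V → V) : (List V →₀ k) →ₗ[k] (List V →₀ k) :=
  Finsupp.lmapDomain k k (List.map σ)

@[simp] lemma mapLetters_single (σ : V → V) (w : List V) (r : k) :
    mapLetters k σ (Finsupp.single w r) = Finsupp.single (w.map σ) r := by
  simp [mapLetters, Finsupp.lmapDomain]

lemma mapLetters_prepend (σ : V → V) (v : V) (x : List V →₀ k) :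
    mapLetters k σ (prepend k v x) = prepend k (σ v) (mapLetters k σ x) := by
  suffices h : mapLetters k σ ∘ₗ prepend k v = prepend k (σ v) ∘ₗ mapLetters k σ from
    LinearMap.congr_fun h x
  ext w : 2
  simp

lemma mapLetters_mapLetters (σ τ : V → V) (x : List V →₀ k) :
    mapLetters k σ (mapLetters k τ x) = mapLetters k (σ ∘ τ) x := by
  suffices h : mapLetters k σ ∘ₗ mapLetters k τ = mapLetters k (σ ∘ τ) from LinearMap.congr_fun h x
  ext w : 2
  simp

lemma mapLetters_wordBoundary (σ : V → V) (w : List V) :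
    mapLetters k σ (wordBoundary k w) = wordBoundary k (w.map σ) := by
  induction w with
  | nil => exact map_zero _
  | cons v w ih => rw [wordBoundary, map_sub, mapLetters_prepend, ih, mapLetters_single]; rfl

lemma mapLetters_boundary (σ : V → V) (x : List V →₀ k) :
    mapLetters k σ (boundary k x) = boundary k (mapLetters k σ x) := by
  suffices h : mapLetters k σ ∘ₗ boundary k = boundary k ∘ₗ mapLetters k σ from
    LinearMap.congr_fun h x
  ext w : 2
  simp [boundary_single, mapLetters_wordBoundary]

lemma mapLetters_mem_chains (σ : V → V) {L : Set (List V)} (hL : ∀ w ∈ L, w.map σ ∈ L) {d : ℕ}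
    {x : List V →₀ k} (hx : x ∈ chains k L d) : mapLetters k σ x ∈ chains k L d := by
  refine map_mem_of_mem_chains (mapLetters k σ) _ (fun w hw hd ↦ ?_) hx
  rw [mapLetters_single, ← hd, ← List.length_map σ]
  exact single_mem_chains (hL w hw) 1

end MapLetters

/-! ### Joins with a circle -/

section JoinLang

variable {k Ω : Type*} [CommRing k] [DecidableEq Ω] {M : ℕ} {ω : Ω} {K : Set (List (Ω × ZMod M))}

/-- The join of the language `K` with the simplicial complex with facets `𝓕` on the letters
`(ω, s)`. -/
def joinLang (ω : Ω) (𝓕 : Set (Set (ZMod M))) (K : Set (List (Ω × ZMod M))) :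
    Set (List (Ω × ZMod M)) :=
  {w | w.filter (fun v ↦ v.1 ≠ ω) ∈ K ∧ ∃ B ∈ 𝓕, ∀ s, (ω, s) ∈ w → s ∈ B}

lemma SubwordClosed.joinLang (hK : SubwordClosed K) (𝓕 : Set (Set (ZMod M))) :
    SubwordClosed (joinLang ω 𝓕 K) := by
  rintro w ⟨h, B, hB, hw⟩ w' hw'
  exact ⟨hK _ h _ (hw'.filter _), B, hB, fun s hs ↦ hw s (hw'.subset hs)⟩

lemma joinLang_mono {𝓕 𝓖 : Set (Set (ZMod M))} (h : ∀ B ∈ 𝓕, ∃ E ∈ 𝓖, B ⊆ E) :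
    joinLang ω 𝓕 K ⊆ joinLang ω 𝓖 K := by
  rintro w ⟨h', B, hB, hw⟩
  obtain ⟨E, hE, hBE⟩ := h B hB
  exact ⟨h', E, hE, fun s hs ↦ hBE (hw s hs)⟩

lemma joinLang_union (𝓕 𝓖 : Set (Set (ZMod M))) :
    joinLang ω 𝓕 K ∪ joinLang ω 𝓖 K = joinLang ω (𝓕 ∪ 𝓖) K := by
  refine Set.Subset.antisymm (Set.union_subset (joinLang_mono fun B hB ↦ ⟨B, Or.inl hB, le_rfl⟩)
    (joinLang_mono fun B hB ↦ ⟨B, Or.inr hB, le_rfl⟩)) ?_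
  rintro w ⟨h, B, hB | hB, hw⟩
  · exact Or.inl ⟨h, B, hB, hw⟩
  · exact Or.inr ⟨h, B, hB, hw⟩

lemma joinLang_inter {𝓕 𝓕' 𝓖 : Set (Set (ZMod M))}
    (h_le : ∀ B ∈ 𝓕, ∀ B' ∈ 𝓕', ∃ E ∈ 𝓖, B ∩ B' ⊆ E)
    (h_ge : ∀ E ∈ 𝓖, (∃ B ∈ 𝓕, E ⊆ B) ∧ ∃ B ∈ 𝓕', E ⊆ B) :
    joinLang ω 𝓕 K ∩ joinLang ω 𝓕' K = joinLang ω 𝓖 K := by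
  refine Set.Subset.antisymm ?_ (Set.subset_inter (joinLang_mono fun E hE ↦ (h_ge E hE).1)
    (joinLang_mono fun E hE ↦ (h_ge E hE).2))
  rintro w ⟨⟨h, B, hB, hw⟩, -, B', hB', hw'⟩
  obtain ⟨E, hE, hBE⟩ := h_le B hB B' hB'
  exact ⟨h, E, hE, fun s hs ↦ hBE ⟨hw s hs, hw' s hs⟩⟩

lemma joinLang_empty (hK : ∀ w ∈ K, ∀ v ∈ w, v.1 ≠ ω) : joinLang ω {∅} K = K := by
  ext w
  constructor
  · rintro ⟨h, B, rfl, hw⟩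
    rwa [List.filter_eq_self.2] at h
    rintro ⟨ω', s⟩ hv
    refine decide_eq_true ?_
    rintro rfl
    exact hw s hv
  · intro h
    refine ⟨?_, ∅, rfl, fun s hs ↦ absurd rfl (hK w h _ hs)⟩
    rwa [List.filter_eq_self.2]
    exact fun v hv ↦ decide_eq_true (hK w h v hv)

lemma cons_mem_joinLang {B : Set (ZMod M)} {s : ZMod M} (hs : s ∈ B) {w : List (Ω × ZMod M)}
    (hw : w ∈ joinLang ω {B} K) : (ω, s) :: w ∈ joinLang ω {B} K := by
  obtain ⟨h, _, rfl, hw⟩ := hw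
  refine ⟨by simpa using h, _, rfl, fun s' hs' ↦ ?_⟩
  rcases List.mem_cons.1 hs' with h' | h'
  · obtain rfl : s' = s := (Prod.ext_iff.1 h').2
    exact hs
  · exact hw s' h'

lemma exactAt_joinLang_singleton {B : Set (ZMod M)} {s : ZMod M} (hs : s ∈ B) (d : ℕ) :
    ExactAt k (joinLang ω {B} K) d :=
  exactAt_of_forall_cons_mem (ω, s) (fun _ ↦ cons_mem_joinLang hs) d

variable {𝓕 : Set (Set (ZMod M))} {B : Set (ZMod M)} {s s' : ZMod M} {d : ℕ}
  {x : List (Ω × ZMod M) →₀ k}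

lemma prepend_mem_chains_joinLang_singleton (hK : ∀ w ∈ K, ∀ v ∈ w, v.1 ≠ ω) (hs : s ∈ B)
    (hx : x ∈ chains k K d) : prepend k (ω, s) x ∈ chains k (joinLang ω {B} K) (d + 1) := by
  refine prepend_mem_chains (fun w hw ↦ cons_mem_joinLang hs ?_) hx
  rw [← joinLang_empty hK] at hw
  exact joinLang_mono (𝓖 := {B})
    (fun _ h ↦ ⟨B, Set.mem_singleton B, h.subset.trans (Set.empty_subset B)⟩) hw

lemma prepend_mem_chains_joinLang (hK : ∀ w ∈ K, ∀ v ∈ w, v.1 ≠ ω) (hB : B ∈ 𝓕) (hs : s ∈ B)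
    (hx : x ∈ chains k K d) : prepend k (ω, s) x ∈ chains k (joinLang ω 𝓕 K) (d + 1) :=
  chains_mono (joinLang_mono fun _ h ↦ ⟨B, hB, h.le⟩) _
    (prepend_mem_chains_joinLang_singleton hK hs hx)

lemma prepend_prepend_mem_chains_joinLang (hK : ∀ w ∈ K, ∀ v ∈ w, v.1 ≠ ω) (hB : B ∈ 𝓕)
    (hs : s ∈ B) (hs' : s' ∈ B) (hx : x ∈ chains k K d) :
    prepend k (ω, s) (prepend k (ω, s') x) ∈ chains k (joinLang ω 𝓕 K) (d + 2) :=
  chains_mono (joinLang_mono fun _ h ↦ ⟨B, hB, h.le⟩) _ <|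
    prepend_mem_chains (fun _ ↦ cons_mem_joinLang hs)
      (prepend_mem_chains_joinLang_singleton hK hs' hx)

end JoinLang

section Edges

variable {M : ℕ}

/-- The edge from `a` to `a + 1` of the circle triangulated with vertex set `ZMod M`. -/
def edge (a : ZMod M) : Set (ZMod M) := {a, a + 1}

lemma left_mem_edge (a : ZMod M) : a ∈ edge a := Set.mem_insert _ _

lemma right_mem_edge (a : ZMod M) : a + 1 ∈ edge a := Set.mem_insert_of_mem _ rfl

lemma natCast_inj_of_lt {i j : ℕ} (hi : i < M) (hj : j < M) : (i : ZMod M) = j ↔ i = j :=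
  (CharP.natCast_injOn_Iio (ZMod M) M).eq_iff hi hj

lemma natCast_mem_edge_iff {i j : ℕ} (hi : i + 1 < M) (hj : j < M) :
    (j : ZMod M) ∈ edge (i : ZMod M) ↔ j = i ∨ j = i + 1 := by
  rw [edge, Set.mem_insert_iff, Set.mem_singleton_iff, ← Nat.cast_succ,
    natCast_inj_of_lt hj (by omega), natCast_inj_of_lt hj hi]

variable (M) in
/-- The facets of the path with vertices `0, …, l`. -/
def pathEdges (l : ℕ) : Set (Set (ZMod M)) := (fun i : ℕ ↦ edge (i : ZMod M)) '' Set.Iio l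

variable (M) in
/-- The facets of the circle. -/
def circleEdges : Set (Set (ZMod M)) := Set.range edge

lemma pathEdges_succ (l : ℕ) :
    pathEdges M (l + 1) = pathEdges M l ∪ {edge (l : ZMod M)} := by
  rw [pathEdges, ← Order.succ_eq_add_one, Order.Iio_succ_eq_insert, Set.image_insert_eq,
    Set.insert_eq, Set.union_comm]
  rfl

lemma pathEdges_modulus [NeZero M] : pathEdges M M = circleEdges M := by
  refine Set.Subset.antisymm (by rintro _ ⟨i, -, rfl⟩; exact ⟨i, rfl⟩) ?_
  rintro _ ⟨a, rfl⟩
  exact ⟨a.val, ZMod.val_lt a, by simp⟩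

end Edges

section JoinPath

variable {Ω : Type*} [DecidableEq Ω]

lemma joinLang_pathEdges_inter_next {M l : ℕ} (hl : l + 2 < M) (ω : Ω)
    (K : Set (List (Ω × ZMod M))) :
    joinLang ω (pathEdges M (l + 1)) K ∩ joinLang ω {edge ((l + 1 : ℕ) : ZMod M)} K =
      joinLang ω {{((l + 1 : ℕ) : ZMod M)}} K := by
  refine joinLang_inter ?_ ?_
  · rintro _ ⟨i, hi, rfl⟩ _ rfl
    refine ⟨_, rfl, ?_⟩
    rintro s ⟨h_left, rfl | rfl⟩
    · rfl
    · rw [← Nat.cast_succ] at h_left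
      have hi' : i < l + 1 := hi
      have := (natCast_mem_edge_iff (by omega) (by omega)).1 h_left
      omega
  · rintro _ rfl
    refine ⟨⟨_, ⟨l, Nat.lt_succ_self l, rfl⟩, ?_⟩, _, rfl, ?_⟩
    · simpa using right_mem_edge (l : ZMod M)
    · simpa using left_mem_edge ((l + 1 : ℕ) : ZMod M)

lemma joinLang_pathEdges_inter_last (l : ℕ) (ω : Ω) (K : Set (List (Ω × ZMod (l + 3)))) :
    joinLang ω (pathEdges (l + 3) (l + 2)) K ∩
        joinLang ω {edge ((l + 2 : ℕ) : ZMod (l + 3))} K =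
      joinLang ω {{((l + 2 : ℕ) : ZMod (l + 3))}, {0}} K := by
  have h_wrap : ((l + 2 : ℕ) : ZMod (l + 3)) + 1 = 0 := by
    rw [← Nat.cast_succ]
    exact ZMod.natCast_self (l + 3)
  refine joinLang_inter ?_ ?_
  · rintro _ ⟨i, hi, rfl⟩ _ rfl
    have hi' : i < l + 2 := hi
    by_cases h_last : ((l + 2 : ℕ) : ZMod (l + 3)) ∈ edge (i : ZMod (l + 3))
    · refine ⟨_, Or.inl rfl, ?_⟩
      rintro s ⟨h_left, rfl | rfl⟩
      · rfl
      · rw [h_wrap, ← Nat.cast_zero] at h_left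
        have h_last' := (natCast_mem_edge_iff (by omega) (by omega)).1 h_last
        have h_zero := (natCast_mem_edge_iff (by omega) (by omega)).1 h_left
        omega
    · refine ⟨_, Or.inr rfl, ?_⟩
      rintro s ⟨h_left, rfl | rfl⟩
      · exact absurd h_left h_last
      · exact h_wrap
  · rintro _ (rfl | rfl)
    · refine ⟨⟨_, ⟨l + 1, Nat.lt_succ_self _, rfl⟩, ?_⟩, _, rfl, ?_⟩
      · simpa [add_assoc, one_add_one_eq_two] using right_mem_edge ((l + 1 : ℕ) : ZMod (l + 3))
      · exact Set.singleton_subset_iff.2 (left_mem_edge _)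
    · refine ⟨⟨_, ⟨0, Nat.succ_pos _, rfl⟩, ?_⟩, _, rfl, ?_⟩
      · simpa using left_mem_edge ((0 : ℕ) : ZMod (l + 3))
      · exact Set.singleton_subset_iff.2 (h_wrap ▸ right_mem_edge ((l + 2 : ℕ) : ZMod (l + 3)))

lemma exactAt_joinLang_pathEdges {k : Type*} [CommRing k] {M l : ℕ} (hl : l + 1 < M) (ω : Ω)
    {K : Set (List (Ω × ZMod M))} (hK : SubwordClosed K) (d : ℕ) :
    ExactAt k (joinLang ω (pathEdges M (l + 1)) K) d := by
  induction l generalizing d with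
  | zero =>
    have h_single : pathEdges M (0 + 1) = {edge ((0 : ℕ) : ZMod M)} := by
      rw [pathEdges_succ]
      simp [pathEdges]
    rw [h_single]
    exact exactAt_joinLang_singleton (left_mem_edge _) d
  | succ l ih =>
    rw [pathEdges_succ, ← joinLang_union]
    refine exactAt_union (hK.joinLang _) (hK.joinLang _) (ih (by omega))
      (exactAt_joinLang_singleton (left_mem_edge _)) ?_ d
    rw [joinLang_pathEdges_inter_next (by omega)]
    exact exactAt_joinLang_singleton rfl

end JoinPath

section JoinCircle

variable (k : Type*) {Ω : Type*} [CommRing k] {M : ℕ}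

/-- The join of a chain with the path from `(ω, a)` to `(ω, a + l)`. -/
def joinPath (ω : Ω) (a : ZMod M) (l : ℕ) :
    (List (Ω × ZMod M) →₀ k) →ₗ[k] (List (Ω × ZMod M) →₀ k) :=
  ∑ i ∈ Finset.range l, prepend k (ω, a + i) ∘ₗ prepend k (ω, a + i + 1)

lemma joinPath_apply (ω : Ω) (a : ZMod M) (l : ℕ) (x : List (Ω × ZMod M) →₀ k) :
    joinPath k ω a l x =
      ∑ i ∈ Finset.range l, prepend k (ω, a + i) (prepend k (ω, a + i + 1) x) := by
  simp only [joinPath, LinearMap.sum_apply, LinearMap.comp_apply]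

lemma joinPath_add (ω : Ω) (a : ZMod M) (l l' : ℕ) :
    joinPath k ω a (l + l') = joinPath k ω a l + joinPath k ω (a + (l : ZMod M)) l' := by
  simp only [joinPath, Finset.sum_range_add, Nat.cast_add, add_assoc]

variable {k} in
lemma boundary_joinPath (ω : Ω) (a : ZMod M) (l : ℕ) {x : List (Ω × ZMod M) →₀ k}
    (hx : boundary k x = 0) :
    boundary k (joinPath k ω a l x) = prepend k (ω, a + l) x - prepend k (ω, a) x := by
  have h_edge (i : ℕ) : boundary k (prepend k (ω, a + i) (prepend k (ω, a + i + 1) x)) =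
      prepend k (ω, a + (i + 1 : ℕ)) x - prepend k (ω, a + i) x := by
    rw [boundary_prepend, boundary_prepend, hx, map_zero, sub_zero, Nat.cast_succ, add_assoc]
  rw [joinPath_apply, map_sum, Finset.sum_congr rfl fun i _ ↦ h_edge i,
    Finset.sum_range_sub fun i : ℕ ↦ prepend k (ω, a + (i : ZMod M)) x, Nat.cast_zero, add_zero]

variable [NeZero M]

/-- The join of a chain with the fundamental cycle of the circle at `ω`. -/
def joinCircle (ω : Ω) : (List (Ω × ZMod M) →₀ k) →ₗ[k] (List (Ω × ZMod M) →₀ k) :=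
  ∑ a : ZMod M, prepend k (ω, a) ∘ₗ prepend k (ω, a + 1)

lemma joinCircle_apply (ω : Ω) (x : List (Ω × ZMod M) →₀ k) :
    joinCircle k ω x = ∑ a : ZMod M, prepend k (ω, a) (prepend k (ω, a + 1) x) := by
  simp only [joinCircle, LinearMap.sum_apply, LinearMap.comp_apply]

lemma joinPath_modulus (ω : Ω) (a : ZMod M) : joinPath k ω a M = joinCircle k ω := by
  refine Finset.sum_nbij' (fun i ↦ a + i) (fun b ↦ (b - a).val) (by simp)
    (fun b _ ↦ Finset.mem_range.2 (ZMod.val_lt _)) (fun i hi ↦ ?_) (fun b _ ↦ by simp)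
    (fun _ _ ↦ rfl)
  simp [ZMod.val_natCast_of_lt (Finset.mem_range.1 hi)]

lemma boundary_joinCircle (ω : Ω) (x : List (Ω × ZMod M) →₀ k) :
    boundary k (joinCircle k ω x) = joinCircle k ω (boundary k x) := by
  have h_edge (a : ZMod M) : boundary k (prepend k (ω, a) (prepend k (ω, a + 1) x)) =
      prepend k (ω, a) (prepend k (ω, a + 1) (boundary k x)) +
        (prepend k (ω, a + 1) x - prepend k (ω, a) x) := by
    rw [boundary_prepend, boundary_prepend, map_sub]
    abel
  have h_shift : ∑ a : ZMod M, prepend k (ω, a + 1) x = ∑ a : ZMod M, prepend k (ω, a) x :=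
    Fintype.sum_equiv (Equiv.addRight 1) _ _ fun _ ↦ rfl
  simp only [joinCircle_apply, map_sum, h_edge, Finset.sum_add_distrib, Finset.sum_sub_distrib,
    h_shift, sub_self, add_zero]

end JoinCircle

section Suspension

variable {k Ω : Type*} [CommRing k] [DecidableEq Ω] {M : ℕ} {ω : Ω}
  {K : Set (List (Ω × ZMod M))} {d : ℕ} {z : List (Ω × ZMod M) →₀ k}

lemma Spherical.joinLang_pair (h : Spherical K d z) (cK : SubwordClosed K)
    (hK : ∀ w ∈ K, ∀ v ∈ w, v.1 ≠ ω) {a b : ZMod M} (hab : a ≠ b) :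
    Spherical (joinLang ω {{a}, {b}} K) (d + 1) (prepend k (ω, a) z - prepend k (ω, b) z) := by
  have h_inter : joinLang ω {{a}} K ∩ joinLang ω {{b}} K = K := by
    rw [joinLang_inter (𝓖 := {∅}), joinLang_empty hK]
    · rintro _ rfl _ rfl
      exact ⟨∅, rfl, fun s hs ↦ hab (hs.1.symm.trans hs.2)⟩
    · rintro _ rfl
      exact ⟨⟨_, rfl, Set.empty_subset _⟩, _, rfl, Set.empty_subset _⟩
  rw [← h_inter] at h
  rw [← Set.singleton_union, ← joinLang_union, sub_eq_add_neg]
  have hz := h_inter ▸ h.mem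
  refine spherical_union (cK.joinLang _) (cK.joinLang _)
    (exactAt_joinLang_singleton (Set.mem_singleton a))
    (exactAt_joinLang_singleton (Set.mem_singleton b)) h
    (prepend_mem_chains_joinLang hK rfl rfl hz)
    (neg_mem (prepend_mem_chains_joinLang hK rfl rfl hz)) ?_ ?_
  · rw [boundary_prepend, h.cycle, map_zero, sub_zero]
  · rw [map_neg, boundary_prepend, h.cycle, map_zero, sub_zero]

lemma joinPath_mem_chains (hK : ∀ w ∈ K, ∀ v ∈ w, v.1 ≠ ω) {𝓕 : Set (Set (ZMod M))} {a : ZMod M}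
    {l : ℕ} (h𝓕 : ∀ i < l, edge (a + (i : ZMod M)) ∈ 𝓕) (hz : z ∈ chains k K d) :
    joinPath k ω a l z ∈ chains k (joinLang ω 𝓕 K) (d + 2) := by
  rw [joinPath_apply]
  exact Submodule.sum_mem _ fun i hi ↦ prepend_prepend_mem_chains_joinLang hK
    (h𝓕 i (Finset.mem_range.1 hi)) (left_mem_edge _) (right_mem_edge _) hz

lemma joinCircle_mem_chains [NeZero M] (hK : ∀ w ∈ K, ∀ v ∈ w, v.1 ≠ ω) (hz : z ∈ chains k K d) :
    joinCircle k ω z ∈ chains k (joinLang ω (circleEdges M) K) (d + 2) := by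
  rw [← joinPath_modulus k ω 0]
  exact joinPath_mem_chains hK (fun i _ ↦ ⟨0 + (i : ZMod M), rfl⟩) hz

/-- The circle is the union of a path and a last edge, which meet in the two points of a
`0`-sphere. -/
theorem Spherical.joinLang_circleEdges [NeZero M] (hM : 3 ≤ M) (h : Spherical K d z)
    (cK : SubwordClosed K) (hK : ∀ w ∈ K, ∀ v ∈ w, v.1 ≠ ω) :
    Spherical (joinLang ω (circleEdges M) K) (d + 2) (joinCircle k ω z) := by
  obtain ⟨l, rfl⟩ := Nat.exists_eq_add_of_le' hM
  set q : ZMod (l + 3) := ((l + 2 : ℕ) : ZMod (l + 3)) with hq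
  have hq_add : q + 1 = 0 := by
    rw [hq, ← Nat.cast_succ]
    exact ZMod.natCast_self (l + 3)
  have hq_ne : q ≠ 0 := fun h_zero ↦ by
    rw [hq, ← Nat.cast_zero, natCast_inj_of_lt (by omega) (by omega)] at h_zero
    omega
  have h_pair := h.joinLang_pair cK hK hq_ne
  rw [← joinLang_pathEdges_inter_last] at h_pair
  have h_cycle : joinCircle k ω z = joinPath k ω 0 (l + 2) z + joinPath k ω q 1 z := by
    rw [← joinPath_modulus k ω 0, joinPath_add k ω 0 (l + 2) 1, zero_add, LinearMap.add_apply]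
  rw [← pathEdges_modulus, pathEdges_succ, ← joinLang_union, h_cycle]
  refine spherical_union (cK.joinLang _) (cK.joinLang _)
    (exactAt_joinLang_pathEdges (by omega) ω cK) (exactAt_joinLang_singleton (left_mem_edge _))
    h_pair (joinPath_mem_chains hK (fun i hi ↦ ⟨i, hi, by rw [zero_add]⟩) h.mem)
    (joinPath_mem_chains hK (fun i hi ↦ ?_) h.mem) ?_ ?_
  · rw [Nat.lt_one_iff.1 hi, Nat.cast_zero, add_zero, Set.mem_singleton_iff]
  · rw [boundary_joinPath ω 0 _ h.cycle, zero_add]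
  · rw [boundary_joinPath ω q 1 h.cycle, Nat.cast_one, hq_add, neg_sub]

end Suspension

section SphereLang

variable {k Ω : Type*} [CommRing k] [DecidableEq Ω] {M : ℕ} {l : List Ω} {w : List (Ω × ZMod M)}

/-- The join of the circles indexed by a list. -/
def sphereLang (M : ℕ) : List Ω → Set (List (Ω × ZMod M))
  | [] => {[]}
  | ω :: l => joinLang ω (circleEdges M) (sphereLang M l)

variable (k M) in
/-- The fundamental cycle of a join of circles. -/
def sphereCycle [NeZero M] : List Ω → (List (Ω × ZMod M) →₀ k)
  | [] => Finsupp.single [] 1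
  | ω :: l => joinCircle k ω (sphereCycle l)

lemma fst_mem_of_mem_sphereLang (hw : w ∈ sphereLang M l) : ∀ v ∈ w, v.1 ∈ l := by
  induction l generalizing w with
  | nil =>
    obtain rfl : w = [] := hw
    simp
  | cons ω l ih =>
    intro v hv
    by_cases h : v.1 = ω
    · exact h ▸ List.mem_cons_self
    · exact List.mem_cons_of_mem _ (ih hw.1 v (List.mem_filter.2 ⟨hv, decide_eq_true h⟩))

lemma ne_of_mem_sphereLang {ω : Ω} (hω : ω ∉ l) : ∀ w ∈ sphereLang M l, ∀ v ∈ w, v.1 ≠ ω :=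
  fun _ hw v hv h ↦ hω (h ▸ fst_mem_of_mem_sphereLang hw v hv)

lemma subwordClosed_sphereLang (l : List Ω) : SubwordClosed (sphereLang M l) := by
  induction l with
  | nil =>
    rintro _ rfl w' hw'
    exact List.sublist_nil.1 hw'
  | cons ω l ih => exact ih.joinLang _

lemma spherical_sphereLang_nil :
    Spherical (sphereLang M ([] : List Ω)) 0 (Finsupp.single [] (1 : k)) where
  mem := single_mem_chains (w := []) (Set.mem_singleton _) 1
  cycle := boundary_single_nil k
  exactAt e he := absurd he (Nat.not_lt_zero e)
  top x hx _ := by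
    obtain ⟨r, rfl⟩ := Finsupp.support_subset_singleton'.1
      fun w hw ↦ Finset.mem_singleton.2 (hx (Finset.mem_coe.2 hw)).1
    exact ⟨r, 0, zero_mem _, by simp⟩

theorem spherical_sphereLang [NeZero M] (hM : 3 ≤ M) (hl : l.Nodup) :
    Spherical (sphereLang M l) (2 * l.length) (sphereCycle k M l) := by
  induction l with
  | nil => exact spherical_sphereLang_nil
  | cons ω l ih =>
    obtain ⟨hω, hl⟩ := List.nodup_cons.1 hl
    exact (ih hl).joinLang_circleEdges hM (subwordClosed_sphereLang l) (ne_of_mem_sphereLang hω)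

lemma exists_edge_of_mem_sphereLang (hl : l.Nodup) (hw : w ∈ sphereLang M l) :
    ∀ ω ∈ l, ∃ a, ∀ s, (ω, s) ∈ w → s ∈ edge a := by
  induction l generalizing w with
  | nil => simp
  | cons ω l ih =>
    obtain ⟨hω, hl⟩ := List.nodup_cons.1 hl
    obtain ⟨h_filter, _, ⟨a, rfl⟩, ha⟩ := hw
    rintro ω' (_ | ⟨_, hω'⟩)
    · exact ⟨a, ha⟩
    · obtain ⟨b, hb⟩ := ih hl h_filter ω' hω'
      have h_ne : ω' ≠ ω := fun h ↦ hω (h ▸ hω')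
      exact ⟨b, fun s hs ↦ hb s (List.mem_filter.2 ⟨hs, decide_eq_true h_ne⟩)⟩

lemma mem_sphereLang (h_fst : ∀ v ∈ w, v.1 ∈ l)
    (h_edge : ∀ ω ∈ l, ∃ a, ∀ s, (ω, s) ∈ w → s ∈ edge a) : w ∈ sphereLang M l := by
  induction l generalizing w with
  | nil => exact List.eq_nil_iff_forall_not_mem.2 fun v hv ↦ List.not_mem_nil (h_fst v hv)
  | cons ω l ih =>
    obtain ⟨a, ha⟩ := h_edge ω List.mem_cons_self
    refine ⟨ih (fun v hv ↦ ?_) (fun ω' hω' ↦ ?_), _, ⟨a, rfl⟩, ha⟩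
    · obtain ⟨hv, h_ne⟩ := List.mem_filter.1 hv
      exact (List.mem_cons.1 (h_fst v hv)).resolve_left (of_decide_eq_true h_ne)
    · obtain ⟨b, hb⟩ := h_edge ω' (List.mem_cons_of_mem _ hω')
      exact ⟨b, fun s hs ↦ hb s (List.mem_of_mem_filter hs)⟩

lemma nil_mem_sphereLang (l : List Ω) : [] ∈ sphereLang M l :=
  mem_sphereLang (by simp) fun _ _ ↦ ⟨0, by simp⟩

lemma length_le_of_mem_sphereLang (hw : w ∈ sphereLang M l) (hn : w.Nodup) :
    w.length ≤ 2 * l.length := by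
  induction l generalizing w with
  | nil =>
    obtain rfl : w = [] := hw
    exact le_rfl
  | cons ω l ih =>
    obtain ⟨h_filter, _, ⟨a, rfl⟩, ha⟩ := hw
    have h_other := ih h_filter (hn.filter _)
    have h_circle : (w.filter fun v ↦ !decide (v.1 ≠ ω)).length ≤ 2 := by
      refine List.Subperm.length_le (l₂ := [(ω, a), (ω, a + 1)])
        ((hn.filter _).subperm fun ⟨ω', s⟩ hv ↦ ?_)
      obtain ⟨hs, h_eq⟩ := List.mem_filter.1 hv
      obtain rfl : ω' = ω := by simpa using h_eq
      rcases ha s hs with rfl | rfl <;> simp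
    have h_split := List.length_eq_length_filter_add (l := w) fun v ↦ decide (v.1 ≠ ω)
    rw [List.length_cons]
    omega

end SphereLang

/-! ### Passing to the exterior algebra -/

open CliffordAlgebra (contractLeft)

section Wedge

variable (k : Type*) [CommRing k] {V : Type*}

/-- The generator of the exterior algebra given by a letter. -/
def letter (v : V) : ExteriorAlgebra k (V →₀ k) := ExteriorAlgebra.ι k (Finsupp.single v 1)

/-- The map from ordered chains to alternating chains. -/
def wedge : (List V →₀ k) →ₗ[k] ExteriorAlgebra k (V →₀ k) :=
  Finsupp.linearCombination k fun w ↦ (w.map (letter k)).prod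

/-- The augmentation of the free module on the letters. -/
def augmentation : Module.Dual k (V →₀ k) := Finsupp.linearCombination k fun _ ↦ 1

lemma wedge_single (w : List V) : wedge k (Finsupp.single w 1) = (w.map (letter k)).prod := by
  simp [wedge]

lemma wedge_prepend (v : V) (x : List V →₀ k) :
    wedge k (prepend k v x) = letter k v * wedge k x := by
  suffices h : wedge k ∘ₗ prepend k v = LinearMap.mulLeft k (letter k v) ∘ₗ wedge k from
    LinearMap.congr_fun h x
  ext w
  simp [wedge_single]

lemma contractLeft_letter_mul (D : Module.Dual k (V →₀ k)) (v : V)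
    (x : ExteriorAlgebra k (V →₀ k)) :
    contractLeft D (letter k v * x) = D (Finsupp.single v 1) • x - letter k v * contractLeft D x :=
  CliffordAlgebra.contractLeft_ι_mul D _ x

lemma wedge_wordBoundary (w : List V) :
    wedge k (wordBoundary k w) = contractLeft (augmentation k) (w.map (letter k)).prod := by
  induction w with
  | nil => simp [wordBoundary]
  | cons v w ih =>
    rw [wordBoundary, map_sub, wedge_prepend, ih, wedge_single, List.map_cons, List.prod_cons,
      contractLeft_letter_mul, augmentation, Finsupp.linearCombination_single, one_smul, one_smul]

lemma wedge_boundary (x : List V →₀ k) :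
    wedge k (boundary k x) = contractLeft (augmentation k) (wedge k x) := by
  suffices h : wedge k ∘ₗ boundary k = contractLeft (augmentation k) ∘ₗ wedge k from
    LinearMap.congr_fun h x
  ext w
  simp [boundary_single, wedge_wordBoundary, wedge_single]

lemma prod_letter_eq_zero {w : List V} (h : ¬w.Nodup) : (w.map (letter k)).prod = 0 := by
  simp only [List.nodup_iff_injective_get, Function.Injective, not_forall] at h
  obtain ⟨i, j, hij, hne⟩ := h
  have h_alt := (ExteriorAlgebra.ιMulti k w.length).map_eq_zero_of_eq
    (fun i ↦ Finsupp.single (w.get i) (1 : k)) (congrArg (Finsupp.single · 1) hij) hne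
  rw [ExteriorAlgebra.ιMulti_apply] at h_alt
  rw [← h_alt, ← congrArg (List.map (letter k)) (List.ofFn_get w), List.map_ofFn]
  rfl

lemma letter_mul_letter (a b : V) : letter k a * letter k b = -(letter k b * letter k a) :=
  eq_neg_of_add_eq_zero_left (ExteriorAlgebra.ι_add_mul_swap _ _)

lemma commute_letter_mul_letter (u v s t : V) :
    Commute (letter k u * letter k v) (letter k s * letter k t) := by
  have h_letter (c : V) : Commute (letter k u * letter k v) (letter k c) := by
    rw [Commute, SemiconjBy, mul_assoc, letter_mul_letter k v c, mul_neg, ← mul_assoc,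
      letter_mul_letter k u c, neg_mul, neg_neg, mul_assoc]
  exact (h_letter s).mul_right (h_letter t)

lemma wedge_mapLetters (σ : V → V) (x : List V →₀ k) :
    wedge k (mapLetters k σ x) = ExteriorAlgebra.map (Finsupp.lmapDomain k k σ) (wedge k x) := by
  suffices h : wedge k ∘ₗ mapLetters k σ =
      (ExteriorAlgebra.map (Finsupp.lmapDomain k k σ)).toLinearMap ∘ₗ wedge k from
    LinearMap.congr_fun h x
  ext w
  simp only [LinearMap.coe_comp, Function.comp_apply, Finsupp.lsingle_apply, mapLetters_single,
    wedge_single, AlgHom.toLinearMap_apply, map_list_prod, List.map_map]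
  congr 2
  funext v
  simp [letter, Finsupp.lmapDomain]

end Wedge

section CircleWedge

variable (k : Type*) [CommRing k] {Ω : Type*} {M : ℕ} [NeZero M]

variable (M) in
/-- The image of the fundamental cycle of a circle in the exterior algebra. -/
def circleWedge (ω : Ω) : ExteriorAlgebra k (Ω × ZMod M →₀ k) :=
  ∑ a : ZMod M, letter k (ω, a) * letter k (ω, a + 1)

lemma wedge_joinCircle (ω : Ω) (x : List (Ω × ZMod M) →₀ k) :
    wedge k (joinCircle k ω x) = circleWedge k M ω * wedge k x := by
  simp only [joinCircle_apply, map_sum, wedge_prepend, circleWedge, Finset.sum_mul, mul_assoc]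

lemma commute_circleWedge (ω ω' : Ω) : Commute (circleWedge k M ω) (circleWedge k M ω') :=
  Commute.sum_left _ _ _ fun _ _ ↦ Commute.sum_right _ _ _ fun _ _ ↦
    commute_letter_mul_letter k _ _ _ _

variable {k} {D : Module.Dual k (Ω × ZMod M →₀ k)} {ω : Ω}
  {y : ExteriorAlgebra k (Ω × ZMod M →₀ k)}

lemma contractLeft_circleWedge_mul (hy : contractLeft D y = 0) :
    contractLeft D (circleWedge k M ω * y) =
      ∑ a : ZMod M, (D (Finsupp.single (ω, a) 1) • (letter k (ω, a + 1) * y) -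
        D (Finsupp.single (ω, a + 1) 1) • (letter k (ω, a) * y)) := by
  simp only [circleWedge, Finset.sum_mul, map_sum, mul_assoc, contractLeft_letter_mul, hy,
    mul_zero, sub_zero, mul_smul_comm]

lemma contractLeft_prod_circleWedge {l : List Ω}
    (h : ∀ ω ∈ l, ∀ a, D (Finsupp.single (ω, a) 1) = 0) :
    contractLeft D (l.map (circleWedge k M)).prod = 0 := by
  induction l with
  | nil => simp
  | cons ω l ih =>
    obtain ⟨hω, hl⟩ := List.forall_mem_cons.1 h
    rw [List.map_cons, List.prod_cons, contractLeft_circleWedge_mul (ih hl)]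
    simp [hω]

lemma contractLeft_lapply_circleWedge_mul {b : ZMod M}
    (hy : contractLeft (Finsupp.lapply (ω, b)) y = 0) :
    contractLeft (Finsupp.lapply (ω, b)) (circleWedge k M ω * y) =
      letter k (ω, b + 1) * y - letter k (ω, b - 1) * y := by
  classical
  rw [contractLeft_circleWedge_mul hy, Finset.sum_sub_distrib]
  congr 1
  · simp [Finsupp.single_apply]
  · simp [Finsupp.single_apply, ← eq_sub_iff_add_eq]

lemma contractLeft_contractLeft_circleWedge_mul (hM : 3 ≤ M)
    (hy : ∀ b, contractLeft (Finsupp.lapply (ω, b)) y = 0) :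
    contractLeft (Finsupp.lapply (ω, 1))
      (contractLeft (Finsupp.lapply (ω, 0)) (circleWedge k M ω * y)) = y := by
  have h_ne : (-1 : ZMod M) ≠ 1 := by
    intro h
    have h_two : ((2 : ℕ) : ZMod M) = ((0 : ℕ) : ZMod M) := by
      push_cast
      linear_combination -h
    rw [natCast_inj_of_lt (by omega) (by omega)] at h_two
    omega
  rw [contractLeft_lapply_circleWedge_mul (hy 0), map_sub, contractLeft_letter_mul,
    contractLeft_letter_mul, hy, mul_zero, mul_zero]
  simp [h_ne]

theorem prod_circleWedge_ne_zero [Nontrivial k] (hM : 3 ≤ M) {l : List Ω} (hl : l.Nodup) :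
    (l.map (circleWedge k M)).prod ≠ 0 := by
  induction l with
  | nil => simp
  | cons ω l ih =>
    obtain ⟨hω, hl⟩ := List.nodup_cons.1 hl
    have h_contract (b : ZMod M) :
        contractLeft (Finsupp.lapply (ω, b)) (l.map (circleWedge k M)).prod = 0 := by
      refine contractLeft_prod_circleWedge fun ω' hω' a ↦ Finsupp.single_eq_of_ne ?_
      rintro ⟨⟩
      exact hω hω'
    intro h_zero
    refine ih hl ?_
    rw [← contractLeft_contractLeft_circleWedge_mul hM h_contract, ← List.prod_cons,
      ← List.map_cons, h_zero, map_zero, map_zero]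

end CircleWedge

section Rotate

variable (k : Type*) [CommRing k] {Ω : Type*} {M : ℕ}

/-- A map of the circles followed by rotations. -/
def rotate (τ : Ω → Ω) (κ : Ω → ZMod M) (v : Ω × ZMod M) : Ω × ZMod M := (τ v.1, v.2 + κ v.1)

lemma map_rotate_mem_sphereLang [DecidableEq Ω] {l : List Ω} (hl : l.Nodup) (h_all : ∀ ω, ω ∈ l)
    (τ : Equiv.Perm Ω) (κ : Ω → ZMod M) {w : List (Ω × ZMod M)} (hw : w ∈ sphereLang M l) :
    w.map (rotate τ κ) ∈ sphereLang M l := by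
  refine mem_sphereLang (fun _ _ ↦ h_all _) fun ω _ ↦ ?_
  obtain ⟨a, ha⟩ := exists_edge_of_mem_sphereLang hl hw (τ.symm ω) (h_all _)
  refine ⟨a + κ (τ.symm ω), fun s hs ↦ ?_⟩
  obtain ⟨⟨ω', s'⟩, hv, h_eq⟩ := List.mem_map.1 hs
  obtain ⟨rfl, rfl⟩ := Prod.ext_iff.1 h_eq
  simp only [rotate, Equiv.symm_apply_apply] at ha ⊢
  rcases ha s' hv with rfl | rfl
  · exact left_mem_edge _
  · exact add_right_comm a 1 _ ▸ right_mem_edge _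

lemma mapLetters_rotate_joinPath (τ : Ω → Ω) (κ : Ω → ZMod M) (ω : Ω) (a : ZMod M) (n : ℕ)
    (x : List (Ω × ZMod M) →₀ k) :
    mapLetters k (rotate τ κ) (joinPath k ω a n x) =
      joinPath k (τ ω) (a + κ ω) n (mapLetters k (rotate τ κ) x) := by
  simp only [joinPath_apply, map_sum, mapLetters_prepend, rotate, add_right_comm _ _ (κ ω)]

variable [NeZero M]

lemma mapLetters_rotate_joinCircle (τ : Ω → Ω) (κ : Ω → ZMod M) (ω : Ω)
    (x : List (Ω × ZMod M) →₀ k) :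
    mapLetters k (rotate τ κ) (joinCircle k ω x) =
      joinCircle k (τ ω) (mapLetters k (rotate τ κ) x) := by
  rw [← joinPath_modulus k ω 0, mapLetters_rotate_joinPath, joinPath_modulus]

lemma wedge_mapLetters_rotate_sphereCycle (τ : Ω → Ω) (κ : Ω → ZMod M) (l : List Ω) :
    wedge k (mapLetters k (rotate τ κ) (sphereCycle k M l)) =
      ((l.map τ).map (circleWedge k M)).prod := by
  induction l with
  | nil => simp [sphereCycle, wedge_single]
  | cons ω l ih =>
    rw [sphereCycle, mapLetters_rotate_joinCircle, wedge_joinCircle, ih, List.map_cons,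
      List.map_cons, List.prod_cons]

lemma wedge_sphereCycle (l : List Ω) :
    wedge k (sphereCycle k M l) = (l.map (circleWedge k M)).prod := by
  induction l with
  | nil => simp [sphereCycle, wedge_single]
  | cons ω l ih => rw [sphereCycle, wedge_joinCircle, ih, List.map_cons, List.prod_cons]

lemma wedge_mapLetters_rotate_sphereCycle_of_perm {l : List Ω} (hl : l.Nodup)
    (h_all : ∀ ω, ω ∈ l) (τ : Equiv.Perm Ω) (κ : Ω → ZMod M) :
    wedge k (mapLetters k (rotate τ κ) (sphereCycle k M l)) = wedge k (sphereCycle k M l) := by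
  have h_perm : (l.map τ).Perm l := (List.perm_ext_iff_of_nodup (hl.map τ.injective) hl).2 fun ω ↦
    ⟨fun _ ↦ h_all ω, fun _ ↦ List.mem_map.2 ⟨τ.symm ω, h_all _, τ.apply_symm_apply ω⟩⟩
  rw [wedge_mapLetters_rotate_sphereCycle, wedge_sphereCycle]
  refine (h_perm.map _).prod_eq' ?_
  rw [List.pairwise_map]
  exact List.pairwise_of_forall fun _ _ ↦ commute_circleWedge k _ _

end Rotate

section InvariantFunctional

variable {Ω : Type*} [DecidableEq Ω] {M : ℕ} {l : List Ω}

lemma wedge_eq_zero_of_mem_chains_sphereLang (k : Type*) [CommRing k] {x : List (Ω × ZMod M) →₀ k}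
    (hx : x ∈ chains k (sphereLang M l) (2 * l.length + 1)) : wedge k x = 0 := by
  refine (Submodule.mem_bot k).1 (map_mem_of_mem_chains (wedge k) ⊥ (fun w hw hd ↦ ?_) hx)
  rw [wedge_single, prod_letter_eq_zero]
  · exact zero_mem _
  · intro h_nodup
    have := length_le_of_mem_sphereLang hw h_nodup
    omega

/-- The fundamental cycle and its image under a rotation have the same image in the exterior
algebra, so any linear functional there which is nonzero on it will do. -/
theorem exists_invariant_functional (k : Type*) [Field k] [NeZero M] (hM : 3 ≤ M) (hl : l.Nodup)
    (h_all : ∀ ω, ω ∈ l) :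
    ∃ Θ : (List (Ω × ZMod M) →₀ k) →ₗ[k] k, Θ (sphereCycle k M l) = 1 ∧
      ∀ (τ : Equiv.Perm Ω) (κ : Ω → ZMod M), ∀ x ∈ chains k (sphereLang M l) (2 * l.length),
        boundary k x = 0 → Θ (mapLetters k (rotate τ κ) x) = Θ x := by
  obtain ⟨ξ, hξ⟩ : ∃ ξ : Module.Dual k (ExteriorAlgebra k (Ω × ZMod M →₀ k)),
      ξ (wedge k (sphereCycle k M l)) = 1 := by
    refine Module.Projective.exists_dual_eq_one k ?_
    rw [wedge_sphereCycle]
    exact prod_circleWedge_ne_zero hM hl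
  refine ⟨ξ ∘ₗ wedge k, hξ, fun τ κ x hx hx0 ↦ ?_⟩
  obtain ⟨r, y, hy, rfl⟩ := (spherical_sphereLang hM hl).top x hx hx0
  have h_bdry : wedge k (boundary k y) = 0 := by
    rw [wedge_boundary, wedge_eq_zero_of_mem_chains_sphereLang k hy, map_zero]
  have h_rotate : wedge k (mapLetters k (rotate τ κ) (boundary k y)) = 0 := by
    rw [wedge_mapLetters, h_bdry, map_zero]
  simp only [LinearMap.comp_apply, map_add, map_smul, h_bdry, h_rotate,
    wedge_mapLetters_rotate_sphereCycle_of_perm k hl h_all]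

end InvariantFunctional

/-! ### The chain map for rotations of all circles by the same angle -/

section JoinPathCarry

variable (k : Type*) [CommRing k] {Ω : Type*} {M : ℕ} [NeZero M]

lemma carry_eq_div (a b : ZMod M) : carry a b = ((a.val + b.val) / M : ℕ) := by
  refine mul_left_cancel₀ (Int.natCast_ne_zero.2 (NeZero.ne M)) ?_
  have h_div_add_mod : (M * ((a.val + b.val) / M : ℕ) + (a + b).val : ℤ) = a.val + b.val := by
    rw [ZMod.val_add]
    exact_mod_cast Nat.div_add_mod _ _
  rw [mul_carry]
  linear_combination -h_div_add_mod

lemma joinPath_mul_modulus_add (ω : Ω) (a : ZMod M) (q l : ℕ) :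
    joinPath k ω a (M * q + l) = q • joinCircle k ω + joinPath k ω a l := by
  induction q with
  | zero => rw [mul_zero, zero_add, zero_nsmul, zero_add]
  | succ q ih =>
    rw [mul_add, mul_one, add_right_comm, add_comm, joinPath_add, joinPath_modulus,
      ZMod.natCast_self, add_zero, ih, succ_nsmul', add_assoc]

lemma joinPath_sub_joinPath_sub (ω : Ω) (a b c : ZMod M) :
    joinPath k ω b (c - b).val - (joinPath k ω a (c - a).val - joinPath k ω a (b - a).val) =
      ((carry (b - a) (c - b) : ℤ) : k) • joinCircle k ω := by
  have h_mod : (c - a).val = ((b - a).val + (c - b).val) % M := by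
    rw [← ZMod.val_add, sub_add_sub_cancel']
  have h_concat := joinPath_add k ω a (b - a).val (c - b).val
  rw [ZMod.natCast_zmod_val, add_sub_cancel, ← Nat.div_add_mod ((b - a).val + (c - b).val) M,
    joinPath_mul_modulus_add, ← h_mod] at h_concat
  refine LinearMap.ext fun x ↦ ?_
  have h_concat_x := eq_sub_of_add_eq (LinearMap.congr_fun h_concat x)
  rw [carry_eq_div, Int.cast_natCast, Nat.cast_smul_eq_nsmul, h_concat_x]
  simp only [LinearMap.sub_apply, LinearMap.add_apply]
  abel

end JoinPathCarry

section DifferenceCarry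

variable (k : Type*) [CommRing k] {M : ℕ}

/-- The carry in the addition of consecutive differences, a homogeneous cocycle of degree `2` on
`ℤ/M`. -/
def differenceCarry (a : ℕ → ZMod M) : k := ((carry (a 1 - a 0) (a 2 - a 1) : ℤ) : k)

/-- The cup power of `differenceCarry`. -/
def differenceCarryPow : ℕ → (ℕ → ZMod M) → k
  | 0 => fun _ ↦ 1
  | n + 1 => homogeneousCup 2 (differenceCarry k) (differenceCarryPow n)

lemma dependsOn_differenceCarry : DependsOn (differenceCarry k (M := M)) (Set.Iio 3) := by
  intro a b h
  simp only [differenceCarry, h 0 (by simp), h 1 (by simp), h 2 (by simp)]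

lemma differenceCarry_add (a : ℕ → ZMod M) (c : ZMod M) :
    differenceCarry k (fun j ↦ a j + c) = differenceCarry k a := by
  simp only [differenceCarry, add_sub_add_right_eq_sub]

lemma altSum_differenceCarry [NeZero M] (a : ℕ → ZMod M) : altSum 4 (differenceCarry k) a = 0 := by
  have h_cocycle := congrArg (Int.cast : ℤ → k) (carry_cocycle (a 1 - a 0) (a 2 - a 1) (a 3 - a 2))
  rw [sub_add_sub_cancel', sub_add_sub_cancel'] at h_cocycle
  push_cast at h_cocycle
  simp only [altSum_succ, altSum_zero, differenceCarry, scons_zero, scons_succ, stail_apply,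
    zero_add, Nat.reduceAdd]
  linear_combination h_cocycle

end DifferenceCarry

section RotationChain

variable (k : Type*) [CommRing k] {Ω : Type*} {M : ℕ} [NeZero M]

/-- The augmented chain map from the bar resolution of `ℤ/M` to the chains on a join of circles on
which `ℤ/M` acts by rotating all circles simultaneously: points and paths of the first circle in
low degrees, and the cup product with `differenceCarry` in higher degrees. The integer `d` counts
the entries of the sequence which matter, so that the topological degree is `d - 1`. -/
def rotationChain : List Ω → ℕ → (ℕ → ZMod M) → (List (Ω × ZMod M) →₀ k)
  | _, 0 => fun _ ↦ Finsupp.single [] 1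
  | [], _ + 1 => fun _ ↦ 0
  | ω :: _, 1 => fun a ↦ prepend k (ω, a 0) (Finsupp.single [] 1)
  | ω :: _, 2 => fun a ↦ joinPath k ω (a 0) (a 1 - a 0).val (Finsupp.single [] 1)
  | ω :: l, d + 3 => homogeneousCup 2 (differenceCarry k) fun a ↦
      joinCircle k ω (rotationChain l (d + 1) a)

lemma rotationChain_zero (l : List Ω) (a : ℕ → ZMod M) :
    rotationChain k l 0 a = Finsupp.single [] 1 := by
  cases l <;> rfl

lemma rotationChain_mem_chains [DecidableEq Ω] {l : List Ω} (hl : l.Nodup) (d : ℕ)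
    (a : ℕ → ZMod M) :
    rotationChain k l d a ∈ chains k (sphereLang M l) d := by
  induction l generalizing d a with
  | nil =>
    cases d with
    | zero => exact single_mem_chains (nil_mem_sphereLang []) 1
    | succ d => exact zero_mem _
  | cons ω l ih =>
    rw [List.nodup_cons] at hl
    have h_empty : Finsupp.single [] (1 : k) ∈ chains k (sphereLang M l) 0 :=
      single_mem_chains (nil_mem_sphereLang l) 1
    have hω := ne_of_mem_sphereLang (M := M) hl.1
    match d with
    | 0 => exact single_mem_chains (nil_mem_sphereLang _) 1
    | 1 => exact prepend_mem_chains_joinLang hω ⟨a 0, rfl⟩ (left_mem_edge _) h_empty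
    | 2 => exact joinPath_mem_chains hω (fun i _ ↦ ⟨a 0 + i, rfl⟩) h_empty
    | d + 3 => exact Submodule.smul_mem _ _ (joinCircle_mem_chains hω (ih hl.2 (d + 1) _))

lemma dependsOn_rotationChain (l : List Ω) (d : ℕ) :
    DependsOn (rotationChain k (M := M) l d) (Set.Iio d) := by
  induction l generalizing d with
  | nil => cases d <;> exact fun _ _ _ ↦ rfl
  | cons ω l ih =>
    match d with
    | 0 => exact fun _ _ _ ↦ rfl
    | 1 => exact fun a b h ↦ by simp only [rotationChain, h 0 (by simp)]
    | 2 => exact fun a b h ↦ by simp only [rotationChain, h 0 (by simp), h 1 (by simp)]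
    | d + 3 =>
      have h_cup := dependsOn_homogeneousCup (dependsOn_differenceCarry k)
        fun _ _ h ↦ congrArg (joinCircle k ω) (ih (d + 1) h)
      rwa [show 2 + d + 1 = d + 3 by ring] at h_cup

lemma mapLetters_rotationChain (l : List Ω) (d : ℕ) (c : ZMod M) (a : ℕ → ZMod M) :
    mapLetters k (rotate id fun _ ↦ c) (rotationChain k l d a) =
      rotationChain k l d fun j ↦ a j + c := by
  induction l generalizing d a with
  | nil => cases d <;> simp [rotationChain]
  | cons ω l ih =>
    match d with
    | 0 => simp [rotationChain]
    | 1 => simp [rotationChain, rotate]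
    | 2 => simp [rotationChain, mapLetters_rotate_joinPath]
    | d + 3 =>
      simp only [rotationChain, homogeneousCup, map_smul, mapLetters_rotate_joinCircle, ih,
        differenceCarry_add, id]

lemma altSum_rotationChain_cons (ω : Ω) (l : List Ω) (d : ℕ) (a : ℕ → ZMod M) :
    altSum (d + 3) (rotationChain k (ω :: l) (d + 2)) a = homogeneousCup 2 (differenceCarry k)
      (fun u ↦ joinCircle k ω (altSum (d + 1) (rotationChain k l d) u)) a := by
  cases d with
  | zero =>
    simp only [altSum_succ, altSum_zero, rotationChain_zero, sub_zero]
    exact LinearMap.congr_fun (joinPath_sub_joinPath_sub k ω (a 0) (a 1) (a 2)) _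
  | succ d =>
    rw [rotationChain, show d + 1 + 3 = 2 + d + 2 by ring,
      altSum_homogeneousCup_of_altSum_eq_zero d _ (dependsOn_differenceCarry k)
        (altSum_differenceCarry k), neg_one_sq, one_smul]
    exact congrArg (differenceCarry k a • ·)
      (altSum_map (joinCircle k ω).toAddMonoidHom (d + 2) _ _).symm

lemma boundary_rotationChain (l : List Ω) (d : ℕ) (hd : d < 2 * l.length) (a : ℕ → ZMod M) :
    boundary k (rotationChain k l (d + 1) a) = altSum (d + 1) (rotationChain k l d) a := by
  induction l generalizing d a with
  | nil => simp at hd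
  | cons ω l ih =>
    match d with
    | 0 =>
      refine (boundary_prepend k _ _).trans ?_
      rw [boundary_single_nil, map_zero, sub_zero, zero_add, altSum_succ, altSum_zero, sub_zero,
        rotationChain_zero]
    | 1 =>
      simp only [rotationChain, altSum]
      rw [boundary_joinPath _ _ _ (boundary_single_nil k)]
      simp
    | d + 2 =>
      rw [List.length_cons] at hd
      rw [altSum_rotationChain_cons, rotationChain, homogeneousCup, homogeneousCup, map_smul,
        boundary_joinCircle, ih d (by omega)]

lemma altSum_rotationChain_top (l : List Ω) (a : ℕ → ZMod M) :
    altSum (2 * l.length + 1) (rotationChain k l (2 * l.length)) a =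
      differenceCarryPow k l.length a • sphereCycle k M l := by
  induction l generalizing a with
  | nil => simp [altSum, rotationChain, differenceCarryPow, sphereCycle]
  | cons ω l ih =>
    rw [List.length_cons, mul_add, mul_one, altSum_rotationChain_cons, homogeneousCup, ih,
      map_smul, smul_smul]
    rfl

end RotationChain

/-! ### Equivariant chain maps extending a given one -/

lemma map_altSum_eq_zero {α T : Type*} [AddCommGroup T] {δ : T →+ T} {φ : ℕ → (ℕ → α) → T} {N : ℕ}
    (h_zero : ∀ w, δ (φ 0 w) = 0)
    (h_chain : ∀ d < N, ∀ w, δ (φ (d + 1) w) = altSum (d + 1) (φ d) w) (w : ℕ → α) :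
    δ (altSum (N + 1) (φ N) w) = 0 := by
  rw [altSum_map]
  cases N with
  | zero => simp only [h_zero, altSum_zero_fun]
  | succ N =>
    simp only [h_chain N N.lt_succ_self]
    exact altSum_altSum (N + 1) (φ N) w

section Normalize

variable {G C : Type*} [Group G] [Group C]

/-- The translate by `(w 0)⁻¹` of the first `N` terms of the sequence `w`, continued by `1`: a
representative of the orbit under left translation. -/
def normalize (N : ℕ) (w : ℕ → G) (j : ℕ) : G := if j < N then (w 0)⁻¹ * w j else 1

lemma dependsOn_normalize (N : ℕ) : DependsOn (normalize (G := G) N) (Set.Iio N) := by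
  intro w w' h
  funext j
  simp only [normalize]
  split_ifs with hj
  · rw [h j hj, h 0 (Nat.zero_lt_of_lt hj)]
  · rfl

lemma normalize_mul_left (N : ℕ) (g : G) (w : ℕ → G) :
    normalize N ((g * ·) ∘ w) = normalize N w := by
  funext j
  simp only [normalize, Function.comp_apply]
  group

lemma normalize_comp (N : ℕ) (i : C →* G) (u : ℕ → C) :
    normalize N (i ∘ u) = i ∘ normalize N u := by
  funext j
  simp only [normalize, Function.comp_apply, apply_ite i, map_mul, map_inv, map_one]

lemma mul_normalize {N j : ℕ} (hj : j < N) (w : ℕ → G) : w 0 * normalize N w j = w j := by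
  rw [normalize, if_pos hj, mul_inv_cancel_left]

end Normalize

section Extension

variable {k T G C : Type*} [CommRing k] [AddCommGroup T] [Module k T] [Group G] [Group C]

/-- `φ` is a `ρ`-equivariant cochain with values in `X` which depends on the first `d` entries and
restricts to `ψ` along `i`. -/
structure IsEquivariantExtension (i : C →* G) (ρ : Representation k G T) (X : Set T) (d : ℕ)
    (ψ : (ℕ → C) → T) (φ : (ℕ → G) → T) : Prop where
  mem : ∀ w, φ w ∈ X
  dependsOn : DependsOn φ (Set.Iio d)
  mul_left : ∀ g w, φ ((g * ·) ∘ w) = ρ g (φ w)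
  comp : ∀ u, φ (i ∘ u) = ψ u

variable {i : C →* G} {ρ : Representation k G T}

lemma IsEquivariantExtension.apply_eq_of_zero {X : Set T} {ψ : (ℕ → C) → T} {φ : (ℕ → G) → T}
    (h : IsEquivariantExtension i ρ X 0 ψ φ) (w : ℕ → G) (u : ℕ → C) : φ w = ψ u := by
  rw [← h.comp]
  exact h.dependsOn (by simp)

/-- The values are chosen freely on normalized sequences and then translated; this is consistent
with `ψ` because the normalization commutes with `i`. -/
lemma exists_isEquivariantExtension (hi : Function.Injective i) {N : ℕ} {S : (ℕ → G) → Set T}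
    (hS : DependsOn S (Set.Iio (N + 1))) (hSρ : ∀ g w, ∀ x ∈ S w, ρ g x ∈ S ((g * ·) ∘ w))
    (h_nonempty : ∀ w, (S w).Nonempty) {ψ : (ℕ → C) → T} (hψS : ∀ u, ψ u ∈ S (i ∘ u))
    (hψ : DependsOn ψ (Set.Iio (N + 1))) (hψρ : ∀ c u, ψ ((c * ·) ∘ u) = ρ (i c) (ψ u)) :
    ∃ φ, IsEquivariantExtension i ρ Set.univ (N + 1) ψ φ ∧ ∀ w, φ w ∈ S w := by
  have h_choice (w : ℕ → G) : ∃ x ∈ S w, ∀ u, i ∘ u = w → x = ψ u := by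
    by_cases hw : ∃ u, i ∘ u = w
    · obtain ⟨u, rfl⟩ := hw
      exact ⟨ψ u, hψS u, fun u' h ↦ congrArg ψ (hi.comp_left h).symm⟩
    · exact (h_nonempty w).imp fun x hx ↦ ⟨hx, fun u hu ↦ (hw ⟨u, hu⟩).elim⟩
  choose f hfS hfψ using h_choice
  refine ⟨fun w ↦ ρ (w 0) (f (normalize (N + 1) w)), ⟨fun _ ↦ trivial, ?_, ?_, ?_⟩, ?_⟩
  · intro w w' h
    simp only [h 0 (Nat.succ_pos N), dependsOn_normalize (N + 1) h]
  · intro g w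
    rw [normalize_mul_left, Function.comp_apply, map_mul, Module.End.mul_apply]
  · intro u
    rw [normalize_comp, hfψ _ _ rfl, Function.comp_apply, ← hψρ]
    exact hψ fun j hj ↦ mul_normalize hj u
  · intro w
    have h_translate : S ((w 0 * ·) ∘ normalize (N + 1) w) = S w :=
      hS fun j hj ↦ mul_normalize hj w
    exact h_translate ▸ hSρ (w 0) _ _ (hfS _)

variable {δ : T →ₗ[k] T} {X : ℕ → Submodule k T} {ψ : ℕ → (ℕ → C) → T}

lemma IsEquivariantExtension.exists_succ (hi : Function.Injective i)
    (hδ : ∀ g x, δ (ρ g x) = ρ g (δ x)) (hX : ∀ d g, ∀ x ∈ X d, ρ g x ∈ X d) {N : ℕ}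
    (h_exact : ∀ x ∈ X N, δ x = 0 → ∃ y ∈ X (N + 1), δ y = x)
    (hψX : ∀ u, ψ (N + 1) u ∈ X (N + 1)) (hψ : DependsOn (ψ (N + 1)) (Set.Iio (N + 1)))
    (hψρ : ∀ c u, ψ (N + 1) ((c * ·) ∘ u) = ρ (i c) (ψ (N + 1) u))
    (hψδ : ∀ u, δ (ψ (N + 1) u) = altSum (N + 1) (ψ N) u) {φ : (ℕ → G) → T}
    (hφ : IsEquivariantExtension i ρ (X N) N (ψ N) φ)
    (h_cycle : ∀ w, δ (altSum (N + 1) φ w) = 0) :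
    ∃ φ', IsEquivariantExtension i ρ (X (N + 1)) (N + 1) (ψ (N + 1)) φ' ∧
      ∀ w, δ (φ' w) = altSum (N + 1) φ w := by
  have h_translate (g : G) (w : ℕ → G) :
      altSum (N + 1) φ ((g * ·) ∘ w) = ρ g (altSum (N + 1) φ w) := by
    rw [altSum_comp]
    simp only [hφ.mul_left]
    exact (altSum_map (ρ g).toAddMonoidHom (N + 1) φ w).symm
  obtain ⟨φ', hφ', hφ'S⟩ := exists_isEquivariantExtension (ρ := ρ) hi (ψ := ψ (N + 1))
    (S := fun w ↦ {y | y ∈ X (N + 1) ∧ δ y = altSum (N + 1) φ w})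
    (fun w w' h ↦ by simp only [dependsOn_altSum hφ.dependsOn h])
    (fun g w x hx ↦ ⟨hX _ g x hx.1, by rw [hδ, hx.2, h_translate]⟩)
    (fun w ↦ h_exact _ (altSum_mem (X N) _ _ hφ.mem w) (h_cycle w))
    (fun u ↦ ⟨hψX u, by simp only [hψδ, altSum_comp, hφ.comp]⟩) hψ hψρ
  exact ⟨φ', { hφ' with mem := fun w ↦ (hφ'S w).1 }, fun w ↦ (hφ'S w).2⟩

theorem exists_equivariant_extension (hi : Function.Injective i)
    (hδ : ∀ g x, δ (ρ g x) = ρ g (δ x)) (hX : ∀ d g, ∀ x ∈ X d, ρ g x ∈ X d) {N : ℕ}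
    (h_exact : ∀ d < N, ∀ x ∈ X d, δ x = 0 → ∃ y ∈ X (d + 1), δ y = x)
    (hψX : ∀ d u, ψ d u ∈ X d) (hψ : ∀ d, DependsOn (ψ d) (Set.Iio d))
    (hψρ : ∀ d c u, ψ d ((c * ·) ∘ u) = ρ (i c) (ψ d u))
    (hψδ : ∀ d < N, ∀ u, δ (ψ (d + 1) u) = altSum (d + 1) (ψ d) u)
    (hψρ_zero : ∀ g u, ρ g (ψ 0 u) = ψ 0 u) (hψδ_zero : ∀ u, δ (ψ 0 u) = 0) :
    ∃ φ : ℕ → (ℕ → G) → T, (∀ d ≤ N, IsEquivariantExtension i ρ (X d) d (ψ d) (φ d)) ∧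
      ∀ d < N, ∀ w, δ (φ (d + 1) w) = altSum (d + 1) (φ d) w := by
  induction N with
  | zero =>
    refine ⟨fun _ _ ↦ ψ 0 1, fun d hd ↦ ?_, fun d hd ↦ (Nat.not_lt_zero d hd).elim⟩
    obtain rfl := Nat.le_zero.1 hd
    exact ⟨fun _ ↦ hψX 0 _, fun _ _ _ ↦ rfl, fun g _ ↦ (hψρ_zero g _).symm,
      fun u ↦ hψ 0 (by simp)⟩
  | succ N ih =>
    obtain ⟨φ, hφ, hφδ⟩ := ih (fun d hd ↦ h_exact d (hd.trans N.lt_succ_self))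
      fun d hd ↦ hψδ d (hd.trans N.lt_succ_self)
    have h_zero (w : ℕ → G) : δ (φ 0 w) = 0 := by
      rw [(hφ 0 N.zero_le).apply_eq_of_zero w 1, hψδ_zero]
    obtain ⟨φ', hφ', hφ'δ⟩ := (hφ N le_rfl).exists_succ hi hδ hX (h_exact N N.lt_succ_self)
      (hψX _) (hψ _) (hψρ _) (hψδ N N.lt_succ_self)
      (map_altSum_eq_zero (δ := δ.toAddMonoidHom) h_zero hφδ)
    refine ⟨Function.update φ (N + 1) φ', fun d hd ↦ ?_, fun d hd ↦ ?_⟩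
    · obtain rfl | hd := hd.eq_or_lt
      · rwa [Function.update_self]
      · rw [Function.update_of_ne hd.ne]
        exact hφ d (Nat.lt_succ_iff.1 hd)
    · rw [Function.update_of_ne hd.ne]
      obtain rfl | hd := (Nat.lt_succ_iff.1 hd).eq_or_lt
      · rwa [Function.update_self]
      · rw [Function.update_of_ne (Nat.succ_lt_succ hd).ne]
        exact hφδ d hd

end Extension

/-! ### The Euler class of a monomial representation -/

section Euler

variable {P : Type*} [Group P] {A C : Subgroup P} {M : ℕ}

/-- The factor in `A` by which `g` moves the chosen representative of the coset `ω` off the chosen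
representative of `g • ω`. -/
def cosetFactor (g : P) (ω : P ⧸ A) : A :=
  ⟨(g • ω).out⁻¹ * g * ω.out, by
    rw [mul_assoc, ← QuotientGroup.eq, QuotientGroup.out_eq', ← smul_eq_mul g ω.out,
      MulAction.Quotient.coe_smul_out]⟩

lemma cosetFactor_mul (g h : P) (ω : P ⧸ A) :
    cosetFactor (g * h) ω = cosetFactor g (h • ω) * cosetFactor h ω := by
  refine Subtype.ext ?_
  simp only [cosetFactor, Subgroup.coe_mul, mul_smul]
  group

lemma smul_eq_of_mem_center {c : P} (hcA : c ∈ A) (hc : c ∈ Subgroup.center P) (ω : P ⧸ A) :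
    c • ω = ω := by
  rw [← QuotientGroup.out_eq' ω, MulAction.Quotient.smul_coe, smul_eq_mul, QuotientGroup.eq,
    ← Subgroup.mem_center_iff.1 hc]
  simpa using hcA

lemma cosetFactor_of_mem_center {c : P} (hcA : c ∈ A) (hc : c ∈ Subgroup.center P) (ω : P ⧸ A) :
    cosetFactor c ω = ⟨c, hcA⟩ := by
  refine Subtype.ext ?_
  change (c • ω).out⁻¹ * c * ω.out = c
  rw [smul_eq_of_mem_center hcA hc, Subgroup.mem_center_iff.1 hc, mul_assoc, inv_mul_cancel,
    mul_one]

variable (χ : A →* Multiplicative (ZMod M))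

/-- The action of `P` on the disjoint union of circles induced from the action of `A` on one circle
by rotations through the character `χ`. -/
def inducedRotation (g : P) : (P ⧸ A) × ZMod M → (P ⧸ A) × ZMod M :=
  rotate (MulAction.toPerm g : Equiv.Perm (P ⧸ A)) fun ω ↦ (χ (cosetFactor g ω)).toAdd

lemma inducedRotation_mul (g h : P) :
    inducedRotation χ (g * h) = inducedRotation χ g ∘ inducedRotation χ h := by
  funext ⟨ω, s⟩
  simp only [inducedRotation, rotate, Function.comp_apply, MulAction.toPerm_apply, mul_smul,
    cosetFactor_mul, map_mul, toAdd_mul, add_assoc, add_comm (χ (cosetFactor g _)).toAdd]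

lemma inducedRotation_of_mem_center {c : P} (hcA : c ∈ A) (hc : c ∈ Subgroup.center P) :
    inducedRotation χ c = rotate id fun _ ↦ (χ ⟨c, hcA⟩).toAdd := by
  funext ⟨ω, s⟩
  simp only [inducedRotation, rotate, MulAction.toPerm_apply, smul_eq_of_mem_center hcA hc,
    cosetFactor_of_mem_center hcA hc, id]

lemma inducedRotation_one : inducedRotation χ 1 = id := by
  rw [inducedRotation_of_mem_center χ (one_mem A) (one_mem _)]
  funext ⟨ω, s⟩
  simp [rotate, show (⟨1, one_mem A⟩ : A) = 1 from rfl]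

/-- The representation of `P` on the chains of the join of the circles indexed by `P ⧸ A`. -/
def joinRepresentation (k : Type*) [CommRing k] :
    Representation k P (List ((P ⧸ A) × ZMod M) →₀ k) where
  toFun g := mapLetters k (inducedRotation χ g)
  map_one' := by
    ext w : 2
    simp [inducedRotation_one]
  map_mul' g h := by
    refine LinearMap.ext fun x ↦ ?_
    rw [inducedRotation_mul, Module.End.mul_apply, mapLetters_mapLetters]

variable (k : Type*) [CommRing k]

lemma joinRepresentation_apply (g : P) (x : List ((P ⧸ A) × ZMod M) →₀ k) :
    joinRepresentation χ k g x = mapLetters k (inducedRotation χ g) x := rfl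

lemma joinRepresentation_rotationChain [NeZero M] (hCA : C ≤ A) (hC : C ≤ Subgroup.center P)
    (l : List (P ⧸ A)) (d : ℕ) (c : C) (u : ℕ → C) :
    joinRepresentation χ k c
        (rotationChain k l d fun j ↦ (χ (Subgroup.inclusion hCA (u j))).toAdd) =
      rotationChain k l d fun j ↦ (χ (Subgroup.inclusion hCA (c * u j))).toAdd := by
  rw [joinRepresentation_apply, inducedRotation_of_mem_center χ (hCA c.2) (hC c.2),
    mapLetters_rotationChain]
  simp only [map_mul, toAdd_mul, add_comm]
  rfl

lemma exists_equivariant_extension_rotationChain [DecidableEq (P ⧸ A)] [NeZero M] (hM : 3 ≤ M)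
    (hCA : C ≤ A) (hC : C ≤ Subgroup.center P) {l : List (P ⧸ A)} (hl : l.Nodup)
    (h_all : ∀ ω, ω ∈ l) :
    ∃ φ : ℕ → (ℕ → P) → (List ((P ⧸ A) × ZMod M) →₀ k),
      (∀ d ≤ 2 * l.length, IsEquivariantExtension C.subtype (joinRepresentation χ k)
        (chains k (sphereLang M l) d) d
        (fun u ↦ rotationChain k l d fun j ↦ (χ (Subgroup.inclusion hCA (u j))).toAdd) (φ d)) ∧
      ∀ d < 2 * l.length, ∀ w, boundary k (φ (d + 1) w) = altSum (d + 1) (φ d) w := by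
  refine exists_equivariant_extension C.subtype_injective ?_ ?_
    (spherical_sphereLang hM hl).exactAt ?_ ?_ ?_ ?_ ?_ ?_
  · exact fun g x ↦ (mapLetters_boundary _ _ x).symm
  · exact fun d g x hx ↦
      mapLetters_mem_chains k _ (fun w hw ↦ map_rotate_mem_sphereLang hl h_all _ _ hw) hx
  · exact fun d u ↦ rotationChain_mem_chains k hl d _
  · exact fun d u u' h ↦ dependsOn_rotationChain k l d fun j hj ↦ by rw [h j hj]
  · exact fun d c u ↦ (joinRepresentation_rotationChain χ k hCA hC l d c u).symm
  · intro d hd u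
    rw [boundary_rotationChain k l d hd]
    exact altSum_comp (fun c ↦ (χ (Subgroup.inclusion hCA c)).toAdd) (d + 1) (rotationChain k l d) u
  · intro g u
    rw [rotationChain_zero, joinRepresentation_apply, mapLetters_single, List.map_nil]
  · intro u
    rw [rotationChain_zero, boundary_single_nil]

/-- The equivariant chain map sends the boundary of a `2n`-simplex to a cycle in the top degree of
the sphere; an invariant functional turns this obstruction to extending further into a cocycle. -/
theorem exists_eulerClass {p : ℕ} [Fact p.Prime] {P : Type} [Group P] {M : ℕ} [NeZero M]
    (hM : 3 ≤ M) {A C : Subgroup P} [A.FiniteIndex] (hCA : C ≤ A) (hC : C ≤ Subgroup.center P)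
    (χ : A →* Multiplicative (ZMod M)) :
    ∃ (U : HStar p P) (F : (ℕ → P) → ZMod p), Represents (2 * A.index) F U ∧
      ∀ w : ℕ → C, F (C.subtype ∘ w) = differenceCarryPow (ZMod p) A.index
        fun j ↦ (χ (Subgroup.inclusion hCA (w j))).toAdd := by
  classical
  have := Fintype.ofFinite (P ⧸ A)
  let l : List (P ⧸ A) := Finset.univ.toList
  have hl : l.Nodup := Finset.nodup_toList _
  have h_all (ω) : ω ∈ l := Finset.mem_toList.2 (Finset.mem_univ ω)
  have h_length : l.length = A.index := by
    rw [Finset.length_toList, Finset.card_univ, Subgroup.index, Nat.card_eq_fintype_card]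
  rw [← h_length]
  obtain ⟨Θ, hΘ_sphere, hΘ⟩ := exists_invariant_functional (ZMod p) hM hl h_all
  obtain ⟨φ, hφ, hφ_chain⟩ :=
    exists_equivariant_extension_rotationChain χ (ZMod p) hM hCA hC hl h_all
  have h_zero (w) : boundary (ZMod p) (φ 0 w) = 0 := by
    rw [(hφ 0 (Nat.zero_le _)).apply_eq_of_zero w 1, rotationChain_zero, boundary_single_nil]
  have h_cycle := map_altSum_eq_zero (δ := (boundary (ZMod p)).toAddMonoidHom) h_zero hφ_chain
  have h_top := hφ (2 * l.length) le_rfl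
  let F (w : ℕ → P) : ZMod p := Θ (altSum (2 * l.length + 1) (φ (2 * l.length)) w)
  have hF_inv : InvariantUnder Set.univ F := by
    intro g _ w
    simp only [F, altSum_comp, h_top.mul_left]
    rw [← hΘ (MulAction.toPerm g) _ _ (altSum_mem _ _ _ h_top.mem w) (h_cycle w)]
    exact congrArg Θ (altSum_map (joinRepresentation χ (ZMod p) g).toAddMonoidHom _ _ w).symm
  have hF_closed (w) : altSum (2 * l.length + 2) F w = 0 := by
    refine (altSum_map Θ.toAddMonoidHom _ _ w).symm.trans ?_
    rw [altSum_altSum, map_zero]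
  obtain ⟨U, hU⟩ := exists_represents
    (fun w w' h ↦ congrArg Θ (dependsOn_altSum h_top.dependsOn h)) hF_inv hF_closed
  refine ⟨U, F, hU, fun w ↦ ?_⟩
  have h_rotation := altSum_comp (fun c ↦ (χ (Subgroup.inclusion hCA c)).toAdd)
    (2 * l.length + 1) (rotationChain (ZMod p) l (2 * l.length)) w
  rw [altSum_rotationChain_top] at h_rotation
  simp only [F, altSum_comp, h_top.comp]
  refine (congrArg Θ h_rotation.symm).trans ?_
  rw [map_smul, hΘ_sphere, smul_eq_mul, mul_one]
  rfl

end Euler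

/-! ### Powers of Bocksteins as restrictions of Euler classes -/

lemma exists_monoidHom_zmod_extension {A : Type*} [CommGroup A] [Finite A] {n : ℕ} [NeZero n]
    (hn : Monoid.exponent A ∣ n) {C : Subgroup A} (f : C →* Multiplicative (ZMod n)) :
    ∃ χ : A →* Multiplicative (ZMod n), ∀ c : C, χ c = f c := by
  let E : Multiplicative (ZMod n) ≃* rootsOfUnity n ℂ :=
    mulEquivOfCyclicCardEq (by rw [Complex.card_rootsOfUnity, Nat.card_congr Multiplicative.toAdd,
      Nat.card_zmod])
  obtain ⟨g, hg⟩ := MonoidHom.domRestrict_surjective ℂ C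
    ((rootsOfUnity n ℂ).subtype.comp (E.toMonoidHom.comp f))
  have h_root (a : A) : g a ∈ rootsOfUnity n ℂ := by
    rw [mem_rootsOfUnity, ← map_pow, Monoid.exponent_dvd_iff_forall_pow_eq_one.1 hn, map_one]
  exact ⟨E.symm.toMonoidHom.comp (g.codRestrict _ h_root),
    fun c ↦ E.symm_apply_eq.2 (Subtype.ext (DFunLike.congr_fun hg c))⟩

section Scale

/-- The embedding of `ℤ/p` as the subgroup of order `p` of `ℤ/pq`. -/
def scale (p q : ℕ) : ZMod p →+ ZMod (p * q) :=
  ZMod.lift p ⟨zmultiplesHom (ZMod (p * q)) q, by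
    rw [zmultiplesHom_apply, zsmul_eq_mul, Int.cast_natCast, ← Nat.cast_mul, ZMod.natCast_self]⟩

variable {p q : ℕ} [NeZero p] [NeZero q]

lemma val_scale (a : ZMod p) : (scale p q a).val = q * a.val := by
  have h_scale : scale p q a = (q * a.val : ℕ) := by
    conv_lhs => rw [← ZMod.natCast_zmod_val a, ← Int.cast_natCast, scale, ZMod.lift_coe]
    simp [mul_comm]
  rw [h_scale, ZMod.val_natCast_of_lt]
  rw [mul_comm p]
  exact Nat.mul_lt_mul_of_pos_left a.val_lt (NeZero.pos q)

lemma carry_scale (a b : ZMod p) : carry (scale p q a) (scale p q b) = carry a b := by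
  rw [carry_eq_div, carry_eq_div, val_scale, val_scale, ← mul_add, mul_comm p,
    Nat.mul_div_mul_left _ _ (NeZero.pos q)]

lemma differenceCarryPow_scale (k : Type*) [CommRing k] (n : ℕ) (a : ℕ → ZMod p) :
    differenceCarryPow k n (fun j ↦ scale p q (a j)) = differenceCarryPow k n a := by
  induction n generalizing a with
  | zero => rfl
  | succ n ih =>
    simp only [differenceCarryPow, homogeneousCup, differenceCarry, ← map_sub, carry_scale, ih]

end Scale

variable {p : ℕ} {G : Type} [Group G]

/-- The character defined by a cocycle of degree one. -/
def cocycleHom (f : Cocycle p G 1) : G →* Multiplicative (ZMod p) :=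
  MonoidHom.mk' (fun g ↦ .ofAdd (f.1 fun _ ↦ g)) (mem_cocycle_one_iff.1 f.2)

lemma differenceCarry_cocycleHom (f : Cocycle p G 1) (w : ℕ → G) :
    differenceCarry (ZMod p) (fun j ↦ (cocycleHom f (w j)).toAdd) =
      ((carry (f.1 fun _ ↦ (w 0)⁻¹ * w 1) (f.1 fun _ ↦ (w 1)⁻¹ * w 2) : ℤ) : ZMod p) := by
  have h_sub (g h : G) :
      (cocycleHom f h).toAdd - (cocycleHom f g).toAdd = f.1 fun _ ↦ g⁻¹ * h := by
    rw [← toAdd_div, ← map_div, div_eq_mul_inv, map_mul, mul_comm, ← map_mul]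
    rfl
  rw [differenceCarry, h_sub, h_sub]

lemma represents_bockstein_pow [NeZero p] (f : Cocycle p G 1) (n : ℕ) :
    Represents (2 * n) (fun w ↦ differenceCarryPow (ZMod p) n fun j ↦ (cocycleHom f (w j)).toAdd)
      (inDegree p G 2 (bockstein 1 (cls p G 1 f)) ^ n) := by
  induction n with
  | zero => exact represents_one
  | succ n ih =>
    have h_mul := (represents_bockstein f).mul ih
    rw [← pow_succ', show 2 + 2 * n = 2 * (n + 1) by ring] at h_mul
    simp only [← differenceCarry_cocycleHom] at h_mul
    exact h_mul

open scoped IsMulCommutative in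
theorem exists_res_eq_bockstein_pow [Fact p.Prime] {P : Type} [Group P] [Finite P]
    {A C : Subgroup P} [IsMulCommutative A] (hCA : C ≤ A) (hC : C ≤ Subgroup.center P)
    (h : H p C 1) :
    ∃ u ∈ LinearMap.range (inDegree p P (2 * A.index)),
      res p C.subtype u = inDegree p C 2 (bockstein 1 h) ^ A.index := by
  obtain ⟨f, rfl⟩ := cls_surjective 1 h
  let q := 3 * Monoid.exponent A
  have : NeZero q := ⟨mul_ne_zero three_ne_zero Monoid.exponent_ne_zero_of_finite⟩
  have hM : 3 ≤ p * q := Nat.le_of_dvd (NeZero.pos _) (dvd_mul_of_dvd_right (dvd_mul_right 3 _) p)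
  obtain ⟨χ, hχ⟩ := exists_monoidHom_zmod_extension (n := p * q) ⟨p * 3, by ring⟩
    ((scale p q).toMultiplicative.comp
      ((cocycleHom f).comp (Subgroup.subgroupOfEquivOfLe hCA).toMonoidHom))
  obtain ⟨U, F, hF, hFC⟩ := exists_eulerClass (p := p) hM hCA hC χ
  refine ⟨U, hF.mem_range, (hF.res C.subtype).unique ?_⟩
  convert represents_bockstein_pow f A.index using 2 with w
  have h_restrict (c : C) :
      (χ (Subgroup.inclusion hCA c)).toAdd = scale p q (cocycleHom f c).toAdd :=
    congrArg Multiplicative.toAdd (hχ ⟨Subgroup.inclusion hCA c, c.2⟩)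
  simp only [hFC, h_restrict, differenceCarryPow_scale]

section Commutation

variable {p : ℕ} {G : Type} [Group G]

lemma Represents.exists_homogeneous_two {F : (ℕ → G) → ZMod p} {u : HStar p G}
    (hF : Represents 2 F u) :
    ∃ f : G → G → G → ZMod p, (∀ w, F w = f (w 0) (w 1) (w 2)) ∧
      (∀ a b c d, f b c d - f a c d + f a b d - f a b c = 0) ∧
      ∀ g a b c, f (g * a) (g * b) (g * c) = f a b c := by
  have hF_eq (w : ℕ → G) : F w = F (scons (w 0) (scons (w 1) fun _ ↦ w 2)) := by
    refine hF.dependsOn fun i (hi : i < 3) ↦ ?_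
    interval_cases i <;> rfl
  refine ⟨fun a b c ↦ F (scons a (scons b fun _ ↦ c)), hF_eq, fun a b c d ↦ ?_,
    fun g a b c ↦ ?_⟩
  · have h_cocycle := hF.altSum_eq_zero (scons a (scons b (scons c fun _ ↦ d)))
    simp only [altSum_succ, altSum_zero] at h_cocycle
    simp only [hF_eq (stail _), hF_eq (scons _ (stail _)), hF_eq (scons _ (scons _ (stail _))),
      hF_eq (scons _ (scons _ (scons _ (stail _))))] at h_cocycle
    simp only [scons_zero, scons_succ, stail_apply] at h_cocycle
    linear_combination h_cocycle
  · beta_reduce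
    rw [← hF.invariant g trivial (scons a (scons b fun _ ↦ c))]
    exact (hF_eq ((g * ·) ∘ scons a (scons b fun _ ↦ c))).symm

theorem commute_of_mem_range_inDegree_two {u v : HStar p G}
    (hu : u ∈ LinearMap.range (inDegree p G 2)) (hv : v ∈ LinearMap.range (inDegree p G 2)) :
    Commute u v := by
  obtain ⟨F, hF⟩ := exists_represents_of_mem_range hu
  obtain ⟨H, hH⟩ := exists_represents_of_mem_range hv
  obtain ⟨f, hf, hf_cocycle, hf_inv⟩ := hF.exists_homogeneous_two
  obtain ⟨h, hh, hh_cocycle, hh_inv⟩ := hH.exists_homogeneous_two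
  -- The difference of the two products is the coboundary of Steenrod's cup-one product.
  refine sub_eq_zero.1 <| ((hF.mul hH).sub (hH.mul hF)).eq_zero_of_eq_altSum (d := 3)
    (F' := fun w ↦ f (w 0) (w 1) (w 3) * h (w 1) (w 2) (w 3) -
      f (w 0) (w 2) (w 3) * h (w 0) (w 1) (w 2)) (fun w w' hw ↦ ?_) (fun g _ w ↦ ?_) fun w ↦ ?_
  · simp only [hw 0 (by simp), hw 1 (by simp), hw 2 (by simp), hw 3 (by simp)]
  · simp only [Function.comp_apply, hf_inv, hh_inv]
  · simp only [homogeneousCup, altSum_succ, altSum_zero, hf, hh, scons, stail, smul_eq_mul]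
    linear_combination -hf_cocycle (w 0) (w 2) (w 3) (w 4) * h (w 0) (w 1) (w 2) +
      hf_cocycle (w 0) (w 1) (w 3) (w 4) * h (w 1) (w 2) (w 3) -
      hf_cocycle (w 0) (w 1) (w 2) (w 4) * h (w 2) (w 3) (w 4) +
      f (w 0) (w 3) (w 4) * hh_cocycle (w 0) (w 1) (w 2) (w 3) +
      f (w 0) (w 1) (w 4) * hh_cocycle (w 1) (w 2) (w 3) (w 4)

end Commutation

/-! ### Bocksteins of a family of splittings -/

lemma mul_mem_span_op {R : Type*} [Semiring R] {s : Set R} {a z : R} (ha : ∀ x ∈ s, Commute a x)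
    (hz : z ∈ Submodule.span Rᵐᵒᵖ s) : a * z ∈ Submodule.span Rᵐᵒᵖ s := by
  induction hz using Submodule.span_induction with
  | mem x hx =>
    exact (ha x hx).eq ▸ Submodule.smul_mem _ (MulOpposite.op a) (Submodule.subset_span hx)
  | zero => exact (mul_zero a).symm ▸ zero_mem _
  | add z z' _ _ h h' => exact (mul_add a z z').symm ▸ add_mem h h'
  | smul r z _ h => exact (mul_smul_comm r a z).symm ▸ Submodule.smul_mem _ r h

lemma altSum_const {G M : Type*} [AddCommGroup M] (d : ℕ) (r : M) (w : ℕ → G) :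
    altSum d (fun _ ↦ r) w = if Even d then 0 else r := by
  induction d generalizing w with
  | zero => simp [altSum_zero]
  | succ d ih =>
    rw [altSum_succ, ih]
    by_cases h : Even d <;> simp [h, Nat.even_add_one]

section Functoriality

variable {p : ℕ} {G K L : Type} [Group G] [Group K] [Group L]

lemma res_id : res p (MonoidHom.id G) = AlgHom.id (ZMod p) (HStar p G) := by
  refine DirectSum.algHom_ext (ZMod p) (H p G) fun n x ↦ ?_
  obtain ⟨f, rfl⟩ := cls_surjective n x
  exact ((represents_cls f).res (MonoidHom.id G)).unique (represents_cls f)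

lemma res_comp (φ : K →* G) (ψ : L →* K) : res p (φ.comp ψ) = (res p ψ).comp (res p φ) := by
  refine DirectSum.algHom_ext (ZMod p) (H p G) fun n x ↦ ?_
  obtain ⟨f, rfl⟩ := cls_surjective n x
  exact ((represents_cls f).res (φ.comp ψ)).unique (((represents_cls f).res φ).res ψ)

lemma Represents.eq_zero_of_const {d : ℕ} {r : ZMod p} {u : HStar p G}
    (h : Represents (d + 1) (fun _ ↦ r) u) : u = 0 := by
  by_cases hd : Even d
  · have h_closed := h.altSum_eq_zero 1
    rw [altSum_const, if_neg (by simp [Nat.even_add_one, hd])] at h_closed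
    refine h.eq_zero_of_eq_altSum (F' := fun _ ↦ 0) (fun _ _ _ ↦ rfl) (fun _ _ _ ↦ rfl) fun w ↦ ?_
    rw [altSum_const, h_closed, ite_self]
  · refine h.eq_zero_of_eq_altSum (F' := fun _ ↦ r) (fun _ _ _ ↦ rfl) (fun _ _ _ ↦ rfl) fun w ↦ ?_
    rw [altSum_const, if_neg (by simpa [Nat.even_add] using hd)]

lemma res_one_eq_zero {d : ℕ} {u : HStar p G} (hu : u ∈ LinearMap.range (inDegree p G (d + 1))) :
    res p (1 : K →* G) u = 0 := by
  obtain ⟨F, hF⟩ := exists_represents_of_mem_range hu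
  exact (hF.res 1).eq_zero_of_const (r := F fun _ ↦ 1)

end Functoriality

section Generation

variable {p : ℕ} {G : Type} [Group G]

namespace CentralSplitting

lemma res_bocksteinClass [NeZero p] (S : CentralSplitting p G) {φ : G →* G}
    (hφ : ∀ g, S.x (φ g) = S.x g) : res p φ S.bocksteinClass = S.bocksteinClass := by
  refine (S.represents_bocksteinClass.res φ).unique ?_
  convert S.represents_bocksteinClass using 2 with w
  simp only [bocksteinCochain, Function.comp_apply, ← map_inv, ← map_mul, hφ]

lemma commute_bocksteinClass [NeZero p] (S T : CentralSplitting p G) :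
    Commute S.bocksteinClass T.bocksteinClass :=
  commute_of_mem_range_inDegree_two ⟨_, rfl⟩ ⟨_, rfl⟩

variable [Fact (1 < p)]

/-- Iterates `exists_eq_res_add_mul_charClass_add`: each step pulls one more factor
`S.bocksteinClass` out of the class, at the price of terms pulled back from the kernel of
the character. -/
lemma exists_sub_bocksteinClass_pow_mul_mem (S : CentralSplitting p G) {φ : G →* G}
    (hφ : ∀ g, S.x (φ g) = S.x g) {J : Submodule (HStar p G)ᵐᵒᵖ (HStar p G)}
    (hJ : ∀ z ∈ J, S.bocksteinClass * z ∈ J) {m : ℕ}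
    (hJ_res : ∀ d, m < d → ∀ u ∈ LinearMap.range (inDegree p G d), res p (S.ρ.comp φ) u ∈ J)
    (N : ℕ) {u : HStar p G} (hu : u ∈ LinearMap.range (inDegree p G (m + 2 * N))) :
    ∃ v, res p φ u - S.bocksteinClass ^ N * v ∈ J := by
  induction N generalizing u with
  | zero => exact ⟨res p φ u, by simp⟩
  | succ N ih =>
    obtain ⟨s, hs, v, hv, h_decomposition⟩ :=
      S.exists_eq_res_add_mul_charClass_add (m := m + 2 * N) hu
    obtain ⟨z, hz⟩ := ih hv
    refine ⟨z, ?_⟩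
    have h_res : res p φ u - S.bocksteinClass ^ (N + 1) * z =
        res p (S.ρ.comp φ) u + res p (S.ρ.comp φ) s * res p φ S.charClass +
          S.bocksteinClass * (res p φ v - S.bocksteinClass ^ N * z) := by
      conv_lhs => rw [h_decomposition]
      rw [map_add, map_add, map_mul, map_mul, S.res_bocksteinClass hφ, res_comp, pow_succ']
      simp only [AlgHom.comp_apply]
      noncomm_ring
    rw [h_res]
    exact add_mem (add_mem (hJ_res _ (by omega) u hu)
      (J.smul_mem (MulOpposite.op _) (hJ_res _ (by omega) s hs))) (hJ _ hz)

end CentralSplitting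

variable [Fact (1 < p)] {ι : Type*} [DecidableEq ι] {S : ι → CentralSplitting p G}

theorem res_mem_span_bocksteinClass_pow
    (hS : ∀ i j g, (S j).x ((S i).ρ g) = if j = i then 0 else (S j).x g)
    (hS_inj : ∀ g, (∀ i, (S i).x g = 0) → g = 1) (n : ℕ) {s : Finset ι} {φ : G →* G}
    (hφ : ∀ j g, (S j).x (φ g) = if j ∈ s then (S j).x g else 0) {m : ℕ}
    (hm : s.card * (2 * n - 1) < m) {u : HStar p G} (hu : u ∈ LinearMap.range (inDegree p G m)) :
    res p φ u ∈ Submodule.span (HStar p G)ᵐᵒᵖ (Set.range fun i ↦ (S i).bocksteinClass ^ n) := by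
  induction s using Finset.induction_on generalizing φ m u with
  | empty =>
    obtain ⟨d, rfl⟩ : ∃ d, m = d + 1 := Nat.exists_eq_add_one.2 (Nat.zero_lt_of_lt hm)
    obtain rfl : φ = 1 := MonoidHom.ext fun g ↦ hS_inj (φ g) fun j ↦ by simp [hφ]
    rw [res_one_eq_zero hu]
    exact zero_mem _
  | insert i s his ih =>
    rw [Finset.card_insert_of_notMem his, add_mul, one_mul] at hm
    obtain ⟨k, rfl⟩ : ∃ k, m = k + 2 * n := Nat.exists_eq_add_of_le' (by omega)
    have hφ_comp (j : ι) (g : G) :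
        (S j).x (((S i).ρ.comp φ) g) = if j ∈ s then (S j).x g else 0 := by
      rw [MonoidHom.comp_apply, hS, hφ]
      by_cases hj : j = i
      · simp [hj, his]
      · simp [hj]
    obtain ⟨v, hv⟩ := (S i).exists_sub_bocksteinClass_pow_mul_mem (φ := φ) (by simp [hφ])
      (fun z ↦ mul_mem_span_op (Set.forall_mem_range.2 fun j ↦
        ((S i).commute_bocksteinClass (S j)).pow_right n))
      (fun d hd u hu ↦ ih hφ_comp (by omega) hu) n hu
    rw [← sub_add_cancel (res p φ u)]
    exact add_mem hv (Submodule.smul_mem _ (MulOpposite.op v) (Submodule.subset_span ⟨i, rfl⟩))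

end Generation

/-! ### The bound on the degrees of generators -/

section Bound

variable {p : ℕ} {P : Type} [Group P]

/-- The splitting of `C(P)` as the product of the line spanned by a basis vector and of the span
of the other basis vectors. -/
def basisSplitting [NeZero p] {ι : Type*} (b : Module.Basis ι (ZMod p) (Additive (C p P)))
    (i : ι) : CentralSplitting p (C p P) where
  x g := b.repr (.ofMul g) i
  t := (b i).toMul
  ρ := MonoidHom.mk' (fun g ↦ (Additive.ofMul g - b.repr (.ofMul g) i • b i).toMul) fun g h ↦ by
    rw [← toMul_add, ofMul_mul, map_add, Finsupp.add_apply, add_smul, add_sub_add_comm]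
  x_mul g h := by rw [ofMul_mul, map_add, Finsupp.add_apply]
  t_comm g := Subtype.ext (Subgroup.mem_center_iff.1 g.2.1 _)
  t_pow := Subtype.ext (b i).toMul.2.2
  x_t := by simp
  eq_mul g := by
    apply Additive.ofMul.injective
    change _ = (Additive.ofMul g - b.repr (.ofMul g) i • b i) + (b.repr (.ofMul g) i).val • b i
    rw [← Nat.cast_smul_eq_nsmul (ZMod p), ZMod.natCast_val, ZMod.cast_id, sub_add_cancel]

lemma basisSplitting_x_ρ [NeZero p] {ι : Type*} [DecidableEq ι]
    (b : Module.Basis ι (ZMod p) (Additive (C p P))) (i j : ι) (g : C p P) :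
    (basisSplitting b j).x ((basisSplitting b i).ρ g) =
      if j = i then 0 else (basisSplitting b j).x g := by
  change b.repr (Additive.ofMul g - b.repr (.ofMul g) i • b i) j =
    if j = i then 0 else b.repr (.ofMul g) j
  rw [map_sub, map_smul, b.repr_self, Finsupp.sub_apply, Finsupp.smul_apply, Finsupp.single_apply]
  by_cases h : j = i
  · simp [h]
  · simp [h, Ne.symm h]

lemma resC_mul_mem_decomposables {n : ℕ} (hn : 0 < n) {u : HStar p P}
    (hu : u ∈ LinearMap.range (inDegree p P n)) (v : HStar p (C p P)) :
    resC p P u * v ∈ decomposables p P := by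
  obtain ⟨a, rfl⟩ := hu
  exact Submodule.subset_span ⟨n, a, v, hn, rfl⟩

theorem e_le_of_forall_exists_resC_eq_bockstein_pow [Fact p.Prime] [Finite P] {n : ℕ} (hn : 0 < n)
    (hres : ∀ h : H p (C p P) 1, ∃ u ∈ LinearMap.range (inDegree p P (2 * n)),
      resC p P u = inDegree p (C p P) 2 (bockstein 1 h) ^ n) :
    e p P ≤ ((c p P * (2 * n - 1) : ℕ) : ℕ∞) := by
  have : Module.Finite (ZMod p) (Additive (C p P)) := Module.Finite.of_finite
  let b := Module.finBasis (ZMod p) (Additive (C p P))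
  refine iSup₂_le fun m ⟨z, hz⟩ ↦ ?_
  contrapose! hz with hm
  have h_mem := res_mem_span_bocksteinClass_pow (basisSplitting_x_ρ b)
    (fun g hg ↦ Additive.ofMul.injective (b.repr.map_eq_zero_iff.1 (Finsupp.ext hg))) n
    (s := Finset.univ) (φ := MonoidHom.id _) (by simp)
    (by rwa [Finset.card_univ, Fintype.card_fin, ← Nat.cast_lt (α := ℕ∞)])
    (LinearMap.mem_range_self (inDegree p (C p P) m) z)
  rw [res_id, AlgHom.id_apply, Submodule.mem_span_range_iff_exists_fun] at h_mem
  obtain ⟨v, hv⟩ := h_mem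
  rw [← hv]
  refine sum_mem fun i _ ↦ ?_
  obtain ⟨u, hu, hu_res⟩ := hres (cls p (C p P) 1 (basisSplitting b i).charCocycle)
  have h_decomposable := resC_mul_mem_decomposables (by omega) hu (v i).unop
  rwa [hu_res] at h_decomposable

end Bound

lemma le_of_le_center_of_maximal {G : Type*} [Group G] [Finite G] {A K : Subgroup G}
    (hA : IsMulCommutative A)
    (hmax : ∀ B : Subgroup G, IsMulCommutative B → Nat.card B ≤ Nat.card A)
    (hK : K ≤ Subgroup.center G) : K ≤ A := by
  have h_central : K ≤ Subgroup.centralizer (A ⊔ K : Subgroup G) :=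
    hK.trans (Subgroup.center_le_centralizer _)
  have h_sup : IsMulCommutative (A ⊔ K : Subgroup G) := by
    rw [← Subgroup.le_centralizer_iff_isMulCommutative] at hA ⊢
    refine sup_le (Subgroup.le_centralizer_iff.1 (sup_le hA ?_)) h_central
    exact hK.trans (Subgroup.center_le_centralizer _)
  rw [Subgroup.eq_of_le_of_card_ge (le_sup_left : A ≤ A ⊔ K) (hmax _ h_sup)]
  exact le_sup_right

end ModPCohomology

end

open ModPCohomology in
theorem mainTheorem5_general (p : ℕ) [Fact p.Prime] (P : Type) [Group P] [Finite P]
    (A : Subgroup P) [IsMulCommutative A] (hCA : C p P ≤ A) :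
    (∀ x : Module.Basis (Fin (c p P)) (ZMod p) (H p (C p P) 1),
      Algebra.adjoin (ZMod p)
        (Set.range fun i ↦ inDegree p (C p P) 2 (bockstein 1 (x i)) ^ A.index) ≤
          (resC p P).range) ∧
    e p P ≤ ((c p P * (2 * A.index - 1) : ℕ) : ℕ∞) := by
  have h_res := exists_res_eq_bockstein_pow (p := p) hCA fun _ hx ↦ hx.1
  refine ⟨fun x ↦ Algebra.adjoin_le ?_, e_le_of_forall_exists_resC_eq_bockstein_pow
    (Nat.pos_of_ne_zero A.index_ne_zero_of_finite) h_res⟩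
  rintro _ ⟨i, rfl⟩
  obtain ⟨u, -, hu⟩ := h_res (x i)
  exact ⟨u, hu⟩

open ModPCohomology in
theorem mainTheorem5 (p : ℕ) [Fact p.Prime] (P : Type) [Group P] [Finite P] (hP : IsPGroup p P)
    (A : Subgroup P) (hA : IsMulCommutative A)
    (hmax : ∀ B : Subgroup P, IsMulCommutative B → Nat.card B ≤ Nat.card A) :
    (∀ x : Module.Basis (Fin (c p P)) (ZMod p) (H p (C p P) 1),
      Algebra.adjoin (ZMod p) (Set.range fun i =>
          inDegree p (C p P) 2 (bockstein 1 (x i)) ^ (Nat.card P / Nat.card A)) ≤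
        (resC p P).range) ∧
    e p P ≤ ((c p P * (2 * (Nat.card P / Nat.card A) - 1) : ℕ) : ℕ∞) := by
  rw [Nat.div_eq_of_eq_mul_right Nat.card_pos A.card_mul_index.symm]
  exact mainTheorem5_general p P A (le_of_le_center_of_maximal hA hmax fun _ hx ↦ hx.1)
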